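/- Let $n\ge 2$ and $0\le m\le n$ be integers, let $p_{jk}\in\mathbb R$ ($1\le j,k\le n$), put $\Pi=(0,1)\times\mathbb R$, and let $BC^1(\Pi)$ be the space of bounded continuous functions $\overline\Pi\to\mathbb R$ whose first order partial derivatives are also bounded and continuous on $\overline\Pi$. Let $a_j, b_{jk}\in BC^1(\Pi)$ for $1\le j,k\le n$, and suppose that for some $\Lambda_0>0$ $$\inf_{\overline\Pi}a_j\ge\Lambda_0\ \text{ for } j\le m,\qquad \sup_{\overline\Pi}a_j\le-\Lambda_0\ \text{ for } j>m.$$ For $\tau\in\mathbb R$ consider the problem $$\partial_tu_j+a_j(x,t)\,\partial_xu_j+\sum_{k=1}^nb_{jk}(x,t)\,u_k=0,\qquad 0<x<1,\ t>\tau,\ 1\le j\le n,$$ $$u_j(0,t)=(Pu)_j(t)\ \ (j\le m),\qquad u_j(1,t)=(Pu)_j(t)\ \ (j>m),\qquad u(x,\tau)=\varphi(x),$$ where $(Pu)_j(t)=\sum_{k=1}^mp_{jk}u_k(1,t)+\sum_{k=m+1}^np_{jk}u_k(0,t)$. A classical solution is a solution $u\in C^1([0,1]\times[\tau,\infty))^n$.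 For $\varphi\in L^2(0,1)^n$, a function $u\in C([\tau,\infty),L^2(0,1)^n)$ is called an $L^2$-generalized solution if for every sequence $\varphi^l\in C_0^\infty(0,1)^n$ with $\varphi^l\to\varphi$ in $L^2(0,1)^n$ classical solutions $u^l$ with initial values $\varphi^l$ exist and any such solutions satisfy $\sup_{\tau\le\theta\le T}\|u(\theta)-u^l(\cdot,\theta)\|_{L^2(0,1)^n}\to0$ as $l\to\infty$ for every $T>\tau$. Then the problem generates an exponentially bounded evolution family on $X=L^2(0,1)^n$ (with the norm $\max_j\|u_j\|_{L^2(0,1)}$). That is, there are bounded linear operators $U(t,\tau)$ on $X$, $t\ge\tau$, such that 1. $U(\tau,\tau)=I$ and $U(t,s)U(s,\tau)=U(t,\tau)$ for all $t\ge s\ge\tau$, and for each $\varphi\in X$ the map $(t,\tau)\mapsto U(t,\tau)\varphi$ is continuous on $\{(t,\tau)\in\mathbb R^2: t\ge\tau\}$; 2. there are $\omega\in\mathbb R$ and $M\ge1$ with $\|U(t,\tau)\|\le Me^{\omega(t-\tau)}$ for all $t\ge\tau$; 3. for every $\tau\in\mathbb R$ and $\varphi\in X$, the function $t\mapsto U(t,\tau)\varphi$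 is an $L^2$-generalized solution with initial value $\varphi$ at time $\tau$. -/

import Mathlib

open Set Filter Topology MeasureTheory
open scoped ENNReal

noncomputable section

namespace HypSys

/-- `BC(Π)`: bounded and continuous on the closed strip `[0,1] × ℝ`. The value of `f` at the
point `(x,t)` is `f x t`; values outside the strip are irrelevant. -/
structure IsBC (f : ℝ → ℝ → ℝ) : Prop where
  continuousOn : ContinuousOn (fun q : ℝ × ℝ => f q.1 q.2) (Icc 0 1 ×ˢ univ)
  bounded : ∃ C : ℝ, ∀ x ∈ Icc (0 : ℝ) 1, ∀ t : ℝ, |f x t| ≤ C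

/-- `BC¹(Π)`: `f`, `∂ₓ f` and `∂ₜ f` belong to `BC(Π)`; the derivative in `x` is one-sided at
`x = 0` and `x = 1`. -/
structure IsBC1 (f : ℝ → ℝ → ℝ) : Prop where
  isBC : IsBC f
  deriv_x : ∃ fx : ℝ → ℝ → ℝ, IsBC fx ∧
    ∀ x ∈ Icc (0 : ℝ) 1, ∀ t : ℝ, HasDerivWithinAt (fun y => f y t) (fx x t) (Icc 0 1) x
  deriv_t : ∃ ft : ℝ → ℝ → ℝ, IsBC ft ∧
    ∀ x ∈ Icc (0 : ℝ) 1, ∀ t : ℝ, HasDerivAt (fun s => f x s) (ft x t) t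

variable {n : ℕ}

/-- The reflection operator: `(Pu)_j = ∑_{k ≤ m} p_{jk} u_k(1) + ∑_{k > m} p_{jk} u_k(0)`, for the
profile `u(·) = v` at a fixed time. The index `j = 1,…,n` of the mathematics is `j - 1 : Fin n`
here, so that `j ≤ m` reads `(j : ℕ) < m`. -/
def reflection (m : ℕ) (p : Fin n → Fin n → ℝ) (v : ℝ → Fin n → ℝ) (j : Fin n) : ℝ :=
  ∑ k : Fin n, p j k * (if (k : ℕ) < m then v 1 k else v 0 k)

/-- `u` (with `u x t j = u_j(x,t)`) is a classical solution on `[0,1] × [τ,∞)` of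
`∂ₜ u + a ∂ₓ u + b u = 0` with the reflection boundary conditions and the initial value
`u(·,τ) = φ`. -/
structure IsClassicalSolution (m : ℕ) (a : Fin n → ℝ → ℝ → ℝ) (b : Fin n → Fin n → ℝ → ℝ → ℝ)
    (p : Fin n → Fin n → ℝ) (τ : ℝ) (φ : ℝ → Fin n → ℝ) (u : ℝ → ℝ → Fin n → ℝ) : Prop where
  continuousOn : ContinuousOn (fun q : ℝ × ℝ => u q.1 q.2) (Icc 0 1 ×ˢ Ici τ)
  /-- `u` is continuously differentiable up to the boundary and satisfies the system. -/
  system : ∃ ux ut : ℝ → ℝ → Fin n → ℝ,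
    ContinuousOn (fun q : ℝ × ℝ => ux q.1 q.2) (Icc 0 1 ×ˢ Ici τ) ∧
    ContinuousOn (fun q : ℝ × ℝ => ut q.1 q.2) (Icc 0 1 ×ˢ Ici τ) ∧
    (∀ x ∈ Icc (0 : ℝ) 1, ∀ t ∈ Ici τ, ∀ j,
      HasDerivWithinAt (fun y => u y t j) (ux x t j) (Icc 0 1) x) ∧
    (∀ x ∈ Icc (0 : ℝ) 1, ∀ t ∈ Ici τ, ∀ j,
      HasDerivWithinAt (fun s => u x s j) (ut x t j) (Ici τ) t) ∧
    ∀ x ∈ Ioo (0 : ℝ) 1, ∀ t ∈ Ioi τ, ∀ j,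
      ut x t j + a j x t * ux x t j + ∑ k, b j k x t * u x t k = 0
  boundary : ∀ t ∈ Ici τ, ∀ j : Fin n,
    u (if (j : ℕ) < m then 0 else 1) t j = reflection m p (fun x => u x t) j
  initial : ∀ x ∈ Icc (0 : ℝ) 1, u x τ = φ x

/-- Lebesgue measure on `(0,1)`. -/
abbrev unitMeasure : Measure ℝ := volume.restrict (Ioo (0 : ℝ) 1)

/-- The Banach space `L²(0,1)ⁿ` of real-valued functions, with the norm `max_j ‖u_j‖_{L²}`. -/
abbrev L2n (n : ℕ) : Type := Fin n → Lp ℝ 2 unitMeasure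

/-- `L²(0,1)ⁿ`-distance between the class `f` and the function `g`. -/
def l2dist (f : L2n n) (g : ℝ → Fin n → ℝ) : ℝ≥0∞ :=
  ⨆ j, eLpNorm (fun x => f j x - g x j) 2 unitMeasure

/-- Smooth functions with compact support in `(0,1)`, extended by zero to the line. -/
structure IsTestFunction (φ : ℝ → Fin n → ℝ) : Prop where
  contDiff : ContDiff ℝ ((⊤ : ℕ∞) : WithTop ℕ∞) φ
  hasCompactSupport : HasCompactSupport φ
  tsupport_subset : tsupport φ ⊆ Ioo 0 1

/-- `u ∈ C([τ,∞), L²(0,1)ⁿ)` is the `L²`-generalized solution with initial value `φ` at time `τ`: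
for every sequence of test functions converging to `φ` in `L²(0,1)ⁿ`, classical solutions with
these initial values exist, and they converge to `u` in `L²(0,1)ⁿ` uniformly on `[τ,T]` for
every `T > τ`. -/
structure IsL2GeneralizedSolution (m : ℕ) (a : Fin n → ℝ → ℝ → ℝ)
    (b : Fin n → Fin n → ℝ → ℝ → ℝ) (p : Fin n → Fin n → ℝ) (τ : ℝ) (φ : L2n n)
    (u : ℝ → L2n n) : Prop where
  continuousOn : ContinuousOn u (Ici τ)
  approx : ∀ φl : ℕ → ℝ → Fin n → ℝ, (∀ l, IsTestFunction (φl l)) →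
    Tendsto (fun l => l2dist φ (φl l)) atTop (𝓝 0) →
    (∀ l, ∃ v, IsClassicalSolution m a b p τ (φl l) v) ∧
    ∀ ul : ℕ → ℝ → ℝ → Fin n → ℝ, (∀ l, IsClassicalSolution m a b p τ (φl l) (ul l)) →
      ∀ T > τ, Tendsto (fun l => ⨆ θ ∈ Icc τ T, l2dist (u θ) (fun x => ul l x θ)) atTop (𝓝 0)

/-- Evolution family on a Banach space; only the operators `U t τ` with `τ ≤ t` matter. -/
structure IsEvolutionFamily {X : Type*} [NormedAddCommGroup X] [NormedSpace ℝ X]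
    (U : ℝ → ℝ → X →L[ℝ] X) : Prop where
  refl : ∀ τ, U τ τ = ContinuousLinearMap.id ℝ X
  comp : ∀ t s τ, τ ≤ s → s ≤ t → (U t s).comp (U s τ) = U t τ
  strongly_continuous : ∀ x : X,
    ContinuousOn (fun q : ℝ × ℝ => U q.1 q.2 x) {q : ℝ × ℝ | q.2 ≤ q.1}

/-- Exponential boundedness of an evolution family. -/
def IsExponentiallyBounded {X : Type*} [NormedAddCommGroup X] [NormedSpace ℝ X]
    (U : ℝ → ℝ → X →L[ℝ] X) : Prop :=
  ∃ w M : ℝ, 1 ≤ M ∧ ∀ t τ, τ ≤ t → ‖U t τ‖ ≤ M * Real.exp (w * (t - τ))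

/-- The problem generates `U`: for every initial time `τ` and every `φ ∈ L²(0,1)ⁿ`, the function
`t ↦ U(t,τ)φ` is the `L²`-generalized solution with initial value `φ` at time `τ`. -/
def Generates (m : ℕ) (a : Fin n → ℝ → ℝ → ℝ) (b : Fin n → Fin n → ℝ → ℝ → ℝ)
    (p : Fin n → Fin n → ℝ) (U : ℝ → ℝ → L2n n →L[ℝ] L2n n) : Prop :=
  ∀ (τ : ℝ) (φ : L2n n), IsL2GeneralizedSolution m a b p τ φ (fun t => U t τ φ)

end HypSys

end

noncomputable section

namespace HypSys

open scoped NNReal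

/-! ### Global flow of a bounded scalar vector field -/

/-! Two ingredients suffice: classical solutions for test functions, and an `L²` estimate with
constants independent of `τ`. Test functions are dense in `X`, so the solution operator of classical
solutions extends by continuity to `U(t,τ)`. The cocycle law and the exponential bound pass to the
extension, and every classical solution is an orbit of `U`, which gives the convergence required of
generalized solutions.

Classical solutions (`exists_isClassicalSolution`). Let `g` be the initial time derivative dictated
by the system. Subtracting `φ + sin(t-τ) g` leaves a problem with zero initial data and a source
vanishing at `t = τ`. Dividing the `j`-th equation by `a_j` turns it into `∂ₓw_j + q_j ∂ₜw_j = …`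
with `q_j = 1/a_j`, so `x` is the independent variable of the characteristic equation `dt/dx = q_j`
and each characteristic is followed from the end of `[0,1]` where it enters. Integrating along
characteristics gives a fixed point equation for `w`. It is solved in its differentiated form, for
`v = ∂ₜw`, so that the fixed point already carries `C¹` regularity in time. The map is a contraction
in a sup norm weighted by `exp(λ(t-τ) + μ(1-|x-e_j|))`, where `e_j` is the entry end: a large `μ`
beats the reflection coefficients and a large `λ` beats the integral terms. The solution is
therefore global in time at once. The derivative in `x` is recovered from the derivative along
characteristics (`TransportSystem.exists_solution`).

Estimate (`exists_energy_estimate`). The energy `∑ⱼ ∫ ρ_j u_j²` uses weights `ρ_j` that are affine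
in `x`, equal to `δ` at the entry end and `1` at the exit end. For small `δ` the reflected energy is
dominated by the outgoing energy, so the boundary flux has a good sign and Gronwall's inequality
applies. An inhomogeneity is allowed: applied to `u - φ`, the estimate yields `U(t,τ)φ → φ` as `t -
τ → 0`, uniformly in `τ`. With continuity in `t` and the cocycle law this gives joint strong
continuity (`continuousOn_of_exp_bound`). -/

theorem exists_global_solution {v : ℝ → ℝ → ℝ} {K L : ℝ≥0} (hlip : ∀ t, LipschitzWith K (v t))
    (hc : ∀ x, Continuous fun t => v t x) (hb : ∀ t x, ‖v t x‖ ≤ L) (t₀ x₀ : ℝ) :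
    ∃ α : ℝ → ℝ, α t₀ = x₀ ∧ ∀ t, HasDerivAt α (v t (α t)) t := by
  have key : ∀ N : ℕ, ∃ α : ℝ → ℝ, α t₀ = x₀ ∧
      ∀ t ∈ Ioo (t₀ - (N + 1)) (t₀ + (N + 1)), HasDerivAt α (v t (α t)) t := by
    intro N
    have ht₀ : t₀ ∈ Icc (t₀ - (N + 1 : ℝ)) (t₀ + (N + 1)) := by
      constructor <;> linarith [(Nat.cast_nonneg N : (0 : ℝ) ≤ N)]
    -- With speed at most `L`, a curve cannot leave the ball of radius `L * (N + 1)` within time `N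
    -- + 1`, so the Picard–Lindelöf smallness condition is an equality.
    have hPL : IsPicardLindelof v (⟨t₀, ht₀⟩ : Icc (t₀ - (N + 1 : ℝ)) (t₀ + (N + 1))) x₀
        (L * (N + 1)) 0 L K :=
      { lipschitzOnWith := fun t _ => (hlip t).lipschitzOnWith
        continuousOn := fun x _ => (hc x).continuousOn
        norm_le := fun t _ x _ => hb t x
        mul_max_le := by simp }
    obtain ⟨α, h0, hα⟩ := hPL.exists_eq_forall_mem_Icc_hasDerivWithinAt₀
    exact ⟨α, h0, fun t ht => (hα t (Ioo_subset_Icc_self ht)).hasDerivAt (Icc_mem_nhds ht.1 ht.2)⟩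
  choose α h0 hα using key
  have agree : ∀ N M : ℕ, N ≤ M → ∀ t ∈ Ioo (t₀ - (N + 1)) (t₀ + (N + 1)), α M t = α N t := by
    intro N M hNM t ht
    have hc : (N : ℝ) ≤ M := by exact_mod_cast hNM
    refine ODE_solution_unique_of_mem_Ioo (v := v) (s := fun _ => univ) (K := K)
      (a := t₀ - (N + 1)) (b := t₀ + (N + 1)) (t₀ := t₀)
      (fun t _ => (hlip t).lipschitzOnWith) ?_ ?_ ?_ ((h0 M).trans (h0 N).symm) ht
    · constructor <;> linarith [(Nat.cast_nonneg N : (0 : ℝ) ≤ N)]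
    · exact fun s hs => ⟨hα M s ⟨by linarith [hs.1], by linarith [hs.2]⟩, trivial⟩
    · exact fun s hs => ⟨hα N s hs, trivial⟩
  have mem : ∀ t : ℝ, t ∈ Ioo (t₀ - (⌈|t - t₀|⌉₊ + 1)) (t₀ + (⌈|t - t₀|⌉₊ + 1)) := by
    intro t
    have h := abs_le.1 (Nat.le_ceil |t - t₀|)
    constructor <;> linarith [h.1, h.2]
  -- The index varies with `t`; near `t` uniqueness identifies this patchwork with one fixed local
  -- solution.
  refine ⟨fun t => α ⌈|t - t₀|⌉₊ t, h0 _, fun t => ?_⟩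
  refine (hα _ t (mem t)).congr_of_eventuallyEq ?_
  filter_upwards [Ioo_mem_nhds (mem t).1 (mem t).2] with s hs
  rcases le_total ⌈|s - t₀|⌉₊ ⌈|t - t₀|⌉₊ with h | h
  · exact (agree _ _ h s (mem s)).symm
  · exact agree _ _ h s hs

/-- `T x t` is the integral curve of `q` through the point `(x, t)`. -/
structure IsFlow (q : ℝ → ℝ → ℝ) (T : ℝ → ℝ → ℝ → ℝ) : Prop where
  start : ∀ x t, T x t x = t
  hasDerivAt : ∀ x t ξ, HasDerivAt (T x t) (q ξ (T x t ξ)) ξ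

/-- `f` is continuous on the plane, with continuous partial derivative `ft` in the second
variable. -/
structure IsTimeC1 (f ft : ℝ → ℝ → ℝ) : Prop where
  cont : Continuous fun z : ℝ × ℝ => f z.1 z.2
  cont' : Continuous fun z : ℝ × ℝ => ft z.1 z.2
  hasDerivAt : ∀ x t, HasDerivAt (f x) (ft x t) t

theorem IsTimeC1.abs_sub_le {f ft : ℝ → ℝ → ℝ} (hf : IsTimeC1 f ft) {K : ℝ}
    (hK : ∀ x t, |ft x t| ≤ K) (x s t : ℝ) : |f x s - f x t| ≤ K * |s - t| := by
  simpa using! Convex.norm_image_sub_le_of_norm_hasDerivWithin_le (s := univ) (f := f x)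
    (f' := ft x) (fun t _ => (hf.hasDerivAt x t).hasDerivWithinAt) (fun t _ => hK x t) convex_univ
    (mem_univ t) (mem_univ s)

theorem IsTimeC1.lipschitz {f ft : ℝ → ℝ → ℝ} (hf : IsTimeC1 f ft) {K : ℝ}
    (hK : ∀ x t, |ft x t| ≤ K) (x : ℝ) : LipschitzWith K.toNNReal (f x) := by
  have hK0 : 0 ≤ K := (abs_nonneg _).trans (hK 0 0)
  refine LipschitzWith.of_dist_le_mul fun s t => ?_
  rw [Real.coe_toNNReal _ hK0]
  exact hf.abs_sub_le hK x s t

theorem IsTimeC1.exists_flow {q qt : ℝ → ℝ → ℝ} (hq : IsTimeC1 q qt) {L K : ℝ}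
    (hL : ∀ x t, |q x t| ≤ L) (hK : ∀ x t, |qt x t| ≤ K) : ∃ T, IsFlow q T := by
  have hL0 : 0 ≤ L := (abs_nonneg _).trans (hL 0 0)
  have := fun x t : ℝ => exists_global_solution (v := q) (L := L.toNNReal) (hq.lipschitz hK)
    (fun s => hq.cont.comp (by fun_prop : Continuous fun x : ℝ => (x, s)))
    (fun x t => by rw [Real.coe_toNNReal _ hL0]; exact hL x t) x t
  choose T h1 h2 using this
  exact ⟨T, h1, h2⟩

/-! ### Dependence of characteristics on the starting point -/

namespace IsFlow

variable {q qt : ℝ → ℝ → ℝ} {T : ℝ → ℝ → ℝ → ℝ} {L K : ℝ}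

theorem continuous_right (hT : IsFlow q T) (x t : ℝ) : Continuous (T x t) :=
  continuous_iff_continuousAt.2 fun ξ => (hT.hasDerivAt x t ξ).continuousAt

theorem eq_of_eq (hT : IsFlow q T) (hq : IsTimeC1 q qt) (hK : ∀ x t, |qt x t| ≤ K)
    {x t y s ξ₀ : ℝ} (h : T x t ξ₀ = T y s ξ₀) : T x t = T y s :=
  ODE_solution_unique_univ (v := q) (s := fun _ => univ) (t₀ := ξ₀)
    (fun t => (hq.lipschitz hK t).lipschitzOnWith) (fun ξ => ⟨hT.hasDerivAt x t ξ, trivial⟩)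
    (fun ξ => ⟨hT.hasDerivAt y s ξ, trivial⟩) h

theorem comp (hT : IsFlow q T) (hq : IsTimeC1 q qt) (hK : ∀ x t, |qt x t| ≤ K) (x t y : ℝ) :
    T y (T x t y) = T x t :=
  hT.eq_of_eq hq hK (hT.start y _)

theorem abs_sub_le (hT : IsFlow q T) (hL : ∀ x t, |q x t| ≤ L) (x t ξ η : ℝ) :
    |T x t ξ - T x t η| ≤ L * |ξ - η| := by
  simpa using! Convex.norm_image_sub_le_of_norm_hasDerivWithin_le (s := univ) (f := T x t)
    (fun η _ => (hT.hasDerivAt x t η).hasDerivWithinAt) (fun η _ => hL η _) convex_univ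
    (mem_univ η) (mem_univ ξ)

/-- The divided difference of `q` along two integral curves. -/
def dividedDiff (q : ℝ → ℝ → ℝ) (T : ℝ → ℝ → ℝ → ℝ) (x t t' ξ : ℝ) : ℝ :=
  (q ξ (T x t' ξ) - q ξ (T x t ξ)) / (T x t' ξ - T x t ξ)

theorem ne_of_ne (hT : IsFlow q T) (hq : IsTimeC1 q qt) (hK : ∀ x t, |qt x t| ≤ K)
    {x t t' : ℝ} (h : t ≠ t') (ξ : ℝ) : T x t' ξ - T x t ξ ≠ 0 := by
  intro h0
  have := hT.eq_of_eq hq hK (sub_eq_zero.1 h0)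
  apply h
  rw [← hT.start x t, ← hT.start x t', this]

theorem continuous_dividedDiff (hT : IsFlow q T) (hq : IsTimeC1 q qt) (hK : ∀ x t, |qt x t| ≤ K)
    {x t t' : ℝ} (h : t ≠ t') : Continuous (dividedDiff q T x t t') := by
  have h1 := hT.continuous_right x t
  have h2 := hT.continuous_right x t'
  exact ((hq.cont.comp (continuous_id.prodMk h2)).sub (hq.cont.comp (continuous_id.prodMk h1))).div
    (h2.sub h1) (hT.ne_of_ne hq hK h)

theorem abs_dividedDiff_le (hq : IsTimeC1 q qt) (hK : ∀ x t, |qt x t| ≤ K)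
    (x t t' ξ : ℝ) : |dividedDiff q T x t t' ξ| ≤ K := by
  rw [dividedDiff, abs_div]
  exact div_le_of_le_mul₀ (abs_nonneg _) ((abs_nonneg _).trans (hK 0 0)) (hq.abs_sub_le hK _ _ _)

/-- The difference of two integral curves solves a scalar linear equation whose coefficient is the
divided difference, and it never vanishes by uniqueness. This exact formula yields both the
Lipschitz bound in `t` and, as `t' → t`, differentiability in `t`. -/
theorem sub_eq (hT : IsFlow q T) (hq : IsTimeC1 q qt) (hK : ∀ x t, |qt x t| ≤ K)
    {x t t' : ℝ} (h : t ≠ t') (ξ : ℝ) :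
    T x t' ξ - T x t ξ = (t' - t) * Real.exp (∫ η in x..ξ, dividedDiff q T x t t' η) := by
  have hc := hT.continuous_dividedDiff hq hK h (x := x)
  have hd : ∀ ξ, HasDerivAt (fun ξ => (T x t' ξ - T x t ξ) *
      Real.exp (-∫ η in x..ξ, dividedDiff q T x t t' η)) 0 ξ := by
    intro ξ
    have h1 := ((hT.hasDerivAt x t' ξ).sub (hT.hasDerivAt x t ξ)).mul
      ((hc.integral_hasStrictDerivAt x ξ).hasDerivAt.neg.exp)
    refine h1.congr_deriv ?_
    have h3 := hT.ne_of_ne hq hK h ξ (x := x)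
    simp only [dividedDiff, Pi.sub_apply, Pi.neg_apply]
    field_simp
    ring
  have h2 := is_const_of_deriv_eq_zero (fun ξ => (hd ξ).differentiableAt)
    (fun ξ => (hd ξ).deriv) ξ x
  simp only [hT.start, intervalIntegral.integral_same, neg_zero, Real.exp_zero, mul_one] at h2
  rw [← h2, mul_assoc, ← Real.exp_add]
  simp

theorem abs_integral_le_of_abs_le {f : ℝ → ℝ} {K : ℝ} (h : ∀ x, |f x| ≤ K) (x y : ℝ) :
    |∫ η in x..y, f η| ≤ K * |y - x| := by
  simpa using intervalIntegral.norm_integral_le_of_norm_le_const (a := x) (b := y) (f := f)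
    fun η _ => h η

theorem abs_sub_le_exp (hT : IsFlow q T) (hq : IsTimeC1 q qt) (hK : ∀ x t, |qt x t| ≤ K)
    (x t t' ξ : ℝ) : |T x t' ξ - T x t ξ| ≤ |t' - t| * Real.exp (K * |ξ - x|) := by
  rcases eq_or_ne t t' with rfl | h
  · simp
  · rw [hT.sub_eq hq hK h, abs_mul, Real.abs_exp]
    gcongr
    exact (le_abs_self _).trans (abs_integral_le_of_abs_le (abs_dividedDiff_le hq hK x t t') x ξ)

theorem continuous (hT : IsFlow q T) (hq : IsTimeC1 q qt) (hL : ∀ x t, |q x t| ≤ L)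
    (hK : ∀ x t, |qt x t| ≤ K) : Continuous fun z : ℝ × ℝ × ℝ => T z.1 z.2.1 z.2.2 := by
  rw [continuous_iff_continuousAt]
  rintro ⟨x, t, ξ⟩
  rw [ContinuousAt, tendsto_iff_dist_tendsto_zero]
  have hL0 : 0 ≤ L := (abs_nonneg _).trans (hL 0 0)
  refine squeeze_zero (g := fun z : ℝ × ℝ × ℝ => (|z.2.1 - t| + L * |x - z.1|) *
    Real.exp (K * |ξ - x|) + L * |z.2.2 - ξ|) (fun _ => dist_nonneg) ?_ ?_
  · rintro ⟨x', t', ξ'⟩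
    simp only [Real.dist_eq]
    -- The curve through `(x', t')` is restarted at `x`, so only the time variable of the starting
    -- point differs.
    have h1 := hT.abs_sub_le hL x' t' ξ' ξ
    have h2 := hT.abs_sub_le_exp hq hK x t (T x' t' x) ξ
    rw [hT.comp hq hK] at h2
    have h3 := hT.abs_sub_le hL x' t' x x'
    rw [hT.start] at h3
    have h4 : |T x' t' x - t| ≤ |t' - t| + L * |x - x'| := by
      have := abs_add_le (T x' t' x - t') (t' - t)
      rw [sub_add_sub_cancel] at this
      linarith
    have h5 : |T x' t' x - t| * Real.exp (K * |ξ - x|) ≤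
        (|t' - t| + L * |x - x'|) * Real.exp (K * |ξ - x|) := by gcongr
    have := abs_add_le (T x' t' ξ' - T x' t' ξ) (T x' t' ξ - T x t ξ)
    rw [sub_add_sub_cancel] at this
    linarith
  · have : Continuous fun z : ℝ × ℝ × ℝ => (|z.2.1 - t| + L * |x - z.1|) *
        Real.exp (K * |ξ - x|) + L * |z.2.2 - ξ| := by fun_prop
    simpa using! this.tendsto (x, t, ξ)

/-- The derivative of the flow `T x t ξ` with respect to `t`. -/
def timeDeriv (qt : ℝ → ℝ → ℝ) (T : ℝ → ℝ → ℝ → ℝ) (x t ξ : ℝ) : ℝ :=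
  Real.exp (∫ η in x..ξ, qt η (T x t η))

theorem timeDeriv_pos (x t ξ : ℝ) : 0 < timeDeriv qt T x t ξ := Real.exp_pos _

theorem timeDeriv_le (hK : ∀ x t, |qt x t| ≤ K) (x t ξ : ℝ) :
    timeDeriv qt T x t ξ ≤ Real.exp (K * |ξ - x|) :=
  Real.exp_le_exp.2 ((le_abs_self _).trans (abs_integral_le_of_abs_le (fun _ => hK _ _) x ξ))

/-- By `sub_eq` the difference quotient is the exponential of an integral of divided differences.
These are bounded by `K` and converge pointwise to `qt`, so dominated convergence applies. -/
theorem hasDerivAt_time (hT : IsFlow q T) (hq : IsTimeC1 q qt) (hL : ∀ x t, |q x t| ≤ L)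
    (hK : ∀ x t, |qt x t| ≤ K) (x t ξ : ℝ) :
    HasDerivAt (fun t => T x t ξ) (timeDeriv qt T x t ξ) t := by
  rw [hasDerivAt_iff_tendsto_slope]
  have h1 : Tendsto (fun t' => ∫ η in x..ξ, dividedDiff q T x t t' η) (𝓝[≠] t)
      (𝓝 (∫ η in x..ξ, qt η (T x t η))) := by
    refine intervalIntegral.tendsto_integral_filter_of_dominated_convergence (fun _ => K) ?_ ?_
      (by simp) ?_
    · filter_upwards [self_mem_nhdsWithin] with t' ht'
      exact (hT.continuous_dividedDiff hq hK (Ne.symm ht')).aestronglyMeasurable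
    · exact Eventually.of_forall fun t' => Eventually.of_forall fun η _ =>
        abs_dividedDiff_le hq hK x t t' η
    · refine Eventually.of_forall fun η _ => ?_
      have h2 := (hasDerivAt_iff_tendsto_slope.1 (hq.hasDerivAt η (T x t η)))
      have h3 : Tendsto (fun t' => T x t' η) (𝓝[≠] t) (𝓝[≠] (T x t η)) := by
        refine tendsto_nhdsWithin_iff.2 ⟨?_, ?_⟩
        · exact (((hT.continuous hq hL hK).comp
            (by fun_prop : Continuous fun t' : ℝ => (x, t', η))).tendsto t).mono_left
              nhdsWithin_le_nhds
        · filter_upwards [self_mem_nhdsWithin] with t' ht'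
          exact sub_ne_zero.1 (hT.ne_of_ne hq hK (Ne.symm ht') η)
      refine (h2.comp h3).congr fun t' => ?_
      simp [slope_def_field, dividedDiff]
  refine ((Real.continuous_exp.tendsto _).comp h1).congr' ?_
  filter_upwards [self_mem_nhdsWithin] with t' ht'
  rw [slope_def_field, hT.sub_eq hq hK (Ne.symm ht')]
  have : t' - t ≠ 0 := sub_ne_zero.2 ht'
  simp [mul_div_cancel_left₀ _ this]

theorem continuous_timeDeriv (hT : IsFlow q T) (hq : IsTimeC1 q qt) (hL : ∀ x t, |q x t| ≤ L)
    (hK : ∀ x t, |qt x t| ≤ K) :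
    Continuous fun z : ℝ × ℝ × ℝ => timeDeriv qt T z.1 z.2.1 z.2.2 := by
  have hTc := hT.continuous hq hL hK
  have h0 : Continuous fun w : (ℝ × ℝ × ℝ) × ℝ => qt w.2 (T w.1.1 w.1.2.1 w.2) :=
    hq.cont'.comp (continuous_snd.prodMk
      (hTc.comp (by fun_prop : Continuous fun w : (ℝ × ℝ × ℝ) × ℝ => (w.1.1, w.1.2.1, w.2))))
  have h1 : ∀ s : ℝ × ℝ × ℝ → ℝ, Continuous s → Continuous fun z : ℝ × ℝ × ℝ =>
      ∫ η in (0 : ℝ)..s z, qt η (T z.1 z.2.1 η) := fun s hs =>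
    intervalIntegral.continuous_parametric_intervalIntegral_of_continuous
      (f := fun (z : ℝ × ℝ × ℝ) η => qt η (T z.1 z.2.1 η)) h0 hs
  have h2 : ∀ z : ℝ × ℝ × ℝ, ∀ a b, IntervalIntegrable (fun η => qt η (T z.1 z.2.1 η))
      volume a b := fun z a b =>
    (h0.comp (by fun_prop : Continuous fun η : ℝ => (z, η))).intervalIntegrable a b
  refine Real.continuous_exp.comp (((h1 (fun z => z.2.2) (by fun_prop)).sub
    (h1 (fun z => z.1) (by fun_prop))).congr fun z => ?_)
  exact intervalIntegral.integral_interval_sub_left (h2 z _ _) (h2 z _ _)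

end IsFlow

end HypSys

namespace HypSys

open scoped NNReal

/-! ### Parameter integrals with a jump across a level set -/

theorem ae_ne_of_injective {θ : ℝ → ℝ} (hθ : Function.Injective θ) (τ : ℝ) :
    ∀ᵐ ξ : ℝ, θ ξ ≠ τ := by
  have : ({ξ | θ ξ = τ} : Set ℝ).Subsingleton := fun a ha b hb => hθ (ha.trans hb.symm)
  exact measure_mono_null (fun ξ hξ => by simpa using hξ) (this.measure_zero volume)

/-- The function `g`, cut off where `θ ≤ τ`. -/
def cutoff (τ : ℝ) (θ g : ℝ → ℝ) (ξ : ℝ) : ℝ := if τ < θ ξ then g ξ else 0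

theorem cutoff_of_le {τ : ℝ} {θ g : ℝ → ℝ} {ξ : ℝ} (h : θ ξ ≤ τ) : cutoff τ θ g ξ = 0 :=
  if_neg h.not_gt

theorem cutoff_of_lt {τ : ℝ} {θ g : ℝ → ℝ} {ξ : ℝ} (h : τ < θ ξ) : cutoff τ θ g ξ = g ξ :=
  if_pos h

theorem abs_cutoff_le {τ : ℝ} {θ g : ℝ → ℝ} {ξ : ℝ} : |cutoff τ θ g ξ| ≤ |g ξ| := by
  unfold cutoff; split_ifs <;> simp

theorem measurable_cutoff {τ : ℝ} {θ g : ℝ → ℝ} (hθ : Continuous θ) (hg : Continuous g) :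
    Measurable (cutoff τ θ g) :=
  Measurable.ite (isOpen_lt continuous_const hθ).measurableSet hg.measurable measurable_const

theorem intervalIntegrable_cutoff {τ : ℝ} {θ g : ℝ → ℝ} (hθ : Continuous θ) (hg : Continuous g)
    (a b : ℝ) : IntervalIntegrable (cutoff τ θ g) volume a b :=
  (hg.intervalIntegrable a b).mono_fun (measurable_cutoff hθ hg).aestronglyMeasurable
    (Eventually.of_forall fun _ => abs_cutoff_le)

theorem exists_bound_near {X : Type*} [TopologicalSpace X] [LocallyCompactSpace X]
    {g : X → ℝ → ℝ} (hg : Continuous fun w : X × ℝ => g w.1 w.2) (z : X) (a b : ℝ) :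
    ∃ C, ∃ s ∈ 𝓝 z, ∀ y ∈ s, ∀ ξ ∈ Icc a b, |g y ξ| ≤ C := by
  obtain ⟨s, hs, hz⟩ := exists_compact_mem_nhds z
  obtain ⟨C, hC⟩ := (hs.prod (isCompact_Icc (a := a) (b := b))).exists_bound_of_continuousOn
    hg.continuousOn
  exact ⟨C, s, hz, fun y hy ξ hξ => hC (y, ξ) ⟨hy, hξ⟩⟩

/-- Injectivity confines the jump of the integrand to at most one `ξ` for each parameter. For almost
every `ξ` the integrand is therefore continuous at the given parameter, and dominated convergence
applies. -/
theorem continuous_integral_cutoff {X : Type*} [TopologicalSpace X] [LocallyCompactSpace X]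
    [FirstCountableTopology X] {τ : ℝ} {θ g : X → ℝ → ℝ}
    (hθ : Continuous fun w : X × ℝ => θ w.1 w.2) (hg : Continuous fun w : X × ℝ => g w.1 w.2)
    (hinj : ∀ z, Function.Injective (θ z)) (e : ℝ) :
    Continuous fun p : X × ℝ => ∫ ξ in e..p.2, cutoff τ (θ p.1) (g p.1) ξ := by
  rw [continuous_iff_continuousAt]
  rintro ⟨z, y⟩
  have hθ1 : ∀ z, Continuous (θ z) := fun z =>
    hθ.comp (by fun_prop : Continuous fun ξ : ℝ => (z, ξ))
  have hg1 : ∀ z, Continuous (g z) := fun z =>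
    hg.comp (by fun_prop : Continuous fun ξ : ℝ => (z, ξ))
  have hab : min e y - 1 ≤ max e y + 1 := by
    linarith [min_le_left e y, le_max_left e y]
  obtain ⟨C, s, hs, hC⟩ := exists_bound_near hg z (min e y - 1) (max e y + 1)
  refine intervalIntegral.continuousAt_parametric_primitive_of_dominated
    (F := fun z => cutoff τ (θ z) (g z)) (fun _ => C) (min e y - 1) (max e y + 1)
    (fun z => (measurable_cutoff (hθ1 z) (hg1 z)).aestronglyMeasurable) ?_
    (by simp) ?_ ?_ ?_ (by simp)
  · filter_upwards [hs] with z' hz'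
    filter_upwards [ae_restrict_mem measurableSet_uIoc] with ξ hξ
    rw [uIoc_of_le hab] at hξ
    exact abs_cutoff_le.trans (hC z' hz' ξ (Ioc_subset_Icc_self hξ))
  · filter_upwards [ae_restrict_of_ae (ae_ne_of_injective (hinj z) τ)] with ξ hξ
    have hc1 : Continuous fun z => θ z ξ := hθ.comp (by fun_prop : Continuous fun z : X => (z, ξ))
    have hc2 : Continuous fun z => g z ξ := hg.comp (by fun_prop : Continuous fun z : X => (z, ξ))
    rcases lt_or_gt_of_ne hξ with h | h
    · refine (continuousAt_const (y := (0 : ℝ))).congr ?_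
      filter_upwards [hc1.continuousAt.eventually_lt continuousAt_const h] with z' hz'
      exact (cutoff_of_le hz'.le).symm
    · refine hc2.continuousAt.congr ?_
      filter_upwards [continuousAt_const.eventually_lt hc1.continuousAt h] with z' hz'
      exact (cutoff_of_lt hz').symm
  · constructor <;> linarith [min_le_left e y, le_max_left e y]
  · constructor <;> linarith [min_le_right e y, le_max_right e y]

/-- The jump moves with `t`, but `g` vanishes at time `τ`, so no boundary term arises and one may
differentiate under the integral. -/
theorem hasDerivAt_integral_cutoff {τ : ℝ} {θ θ' g gt : ℝ → ℝ → ℝ} (hg : IsTimeC1 g gt)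
    (hgτ : ∀ ξ, g ξ τ = 0) (hθ : Continuous fun w : ℝ × ℝ => θ w.1 w.2)
    (hθ' : Continuous fun w : ℝ × ℝ => θ' w.1 w.2)
    (hd : ∀ t ξ, HasDerivAt (fun t => θ t ξ) (θ' t ξ) t)
    (hinj : ∀ t, Function.Injective (θ t)) (a b t : ℝ) :
    HasDerivAt (fun t => ∫ ξ in a..b, cutoff τ (θ t) (fun ξ => g ξ (θ t ξ)) ξ)
      (∫ ξ in a..b, cutoff τ (θ t) (fun ξ => gt ξ (θ t ξ) * θ' t ξ) ξ) t := by
  have hθ1 : ∀ t, Continuous (θ t) := fun t =>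
    hθ.comp (by fun_prop : Continuous fun ξ : ℝ => (t, ξ))
  have hθ1' : ∀ t, Continuous (θ' t) := fun t =>
    hθ'.comp (by fun_prop : Continuous fun ξ : ℝ => (t, ξ))
  have hg1 : ∀ t, Continuous fun ξ => g ξ (θ t ξ) := fun t =>
    hg.cont.comp (continuous_id.prodMk (hθ1 t))
  have hgt1 : ∀ t, Continuous fun ξ => gt ξ (θ t ξ) * θ' t ξ := fun t =>
    (hg.cont'.comp (continuous_id.prodMk (hθ1 t))).mul (hθ1' t)
  obtain ⟨C₁, s₁, hs₁, hC₁⟩ := exists_bound_near hθ t (min a b) (max a b)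
  obtain ⟨C₂, s₂, hs₂, hC₂⟩ := exists_bound_near hθ' t (min a b) (max a b)
  obtain ⟨C₃, hC₃⟩ := ((isCompact_Icc (a := min a b) (b := max a b)).prod
    (isCompact_Icc (a := -(|C₁| + |τ|)) (b := |C₁| + |τ|))).exists_bound_of_continuousOn
    hg.cont'.continuousOn
  obtain ⟨r, hr, hball⟩ := Metric.mem_nhds_iff.1 (inter_mem hs₁ hs₂)
  -- The cut-off integrand is a composition with `max · τ`, hence locally Lipschitz in `s` even
  -- across the jump set.
  have hcut : ∀ s ξ, cutoff τ (θ s) (fun ξ => g ξ (θ s ξ)) ξ = g ξ (max (θ s ξ) τ) := by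
    intro s ξ
    rcases le_or_gt (θ s ξ) τ with h | h
    · rw [cutoff_of_le h, max_eq_right h, hgτ]
    · rw [cutoff_of_lt h, max_eq_left h.le]
  refine (intervalIntegral.hasDerivAt_integral_of_dominated_loc_of_lip
    (F := fun t ξ => cutoff τ (θ t) (fun ξ => g ξ (θ t ξ)) ξ) (bound := fun _ => C₃ * C₂)
    (Metric.ball_mem_nhds t hr) ?_ ?_ ?_ ?_ (by simp) ?_).2
  · exact Eventually.of_forall fun s => (measurable_cutoff (hθ1 s) (hg1 s)).aestronglyMeasurable
  · exact intervalIntegrable_cutoff (hθ1 t) (hg1 t) a b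
  · exact (measurable_cutoff (hθ1 t) (hgt1 t)).aestronglyMeasurable
  · refine Eventually.of_forall fun ξ hξ => ?_
    have hξ' : ξ ∈ Icc (min a b) (max a b) := Ioc_subset_Icc_self hξ
    refine LipschitzOnWith.of_dist_le_mul fun s hs s' hs' => ?_
    have hmem : ∀ s ∈ Metric.ball t r, max (θ s ξ) τ ∈ Icc (-(|C₁| + |τ|)) (|C₁| + |τ|) := by
      intro s hs
      have h1 := abs_le.1 ((hC₁ s (hball hs).1 ξ hξ').trans (le_abs_self _))
      have h2 := abs_le.1 (le_refl |τ|)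
      constructor
      · exact le_max_of_le_left (by linarith [h1.1, abs_nonneg τ])
      · exact max_le (by linarith [h1.2, abs_nonneg τ]) (by linarith [h2.2, abs_nonneg C₁])
    have h1 : |g ξ (max (θ s ξ) τ) - g ξ (max (θ s' ξ) τ)| ≤
        C₃ * |max (θ s ξ) τ - max (θ s' ξ) τ| := by
      simpa using! Convex.norm_image_sub_le_of_norm_hasDerivWithin_le (f := g ξ) (f' := gt ξ)
        (fun t _ => (hg.hasDerivAt ξ t).hasDerivWithinAt) (fun t ht => hC₃ (ξ, t) ⟨hξ', ht⟩)
        (convex_Icc _ _) (hmem s' hs') (hmem s hs)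
    have h2 : |θ s ξ - θ s' ξ| ≤ C₂ * |s - s'| := by
      simpa using! Convex.norm_image_sub_le_of_norm_hasDerivWithin_le (f := fun s => θ s ξ)
        (f' := fun s => θ' s ξ) (fun t _ => (hd t ξ).hasDerivWithinAt)
        (fun t ht => hC₂ t (hball ht).2 ξ hξ') (convex_ball t r) hs' hs
    have h3 : |max (θ s ξ) τ - max (θ s' ξ) τ| ≤ |θ s ξ - θ s' ξ| := by
      simpa using! abs_max_sub_max_le_abs (θ s ξ) (θ s' ξ) τ
    have hC₃0 : 0 ≤ C₃ := (norm_nonneg _).trans (hC₃ (ξ, _) ⟨hξ', hmem s hs⟩)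
    simp only [hcut, Real.dist_eq, Real.coe_nnabs]
    calc _ ≤ C₃ * (C₂ * |s - s'|) :=
          h1.trans (mul_le_mul_of_nonneg_left (h3.trans h2) hC₃0)
      _ = C₃ * C₂ * |s - s'| := by ring
      _ ≤ _ := by gcongr; exact le_abs_self _
  · filter_upwards [ae_ne_of_injective (hinj t) τ] with ξ hξ _
    have hc1 : ContinuousAt (fun s => θ s ξ) t := (hd t ξ).continuousAt
    rcases lt_or_gt_of_ne hξ with h | h
    · rw [cutoff_of_le h.le]
      refine (hasDerivAt_const t (0 : ℝ)).congr_of_eventuallyEq ?_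
      filter_upwards [hc1.eventually_lt continuousAt_const h] with s hs
      exact cutoff_of_le hs.le
    · rw [cutoff_of_lt h]
      refine ((hg.hasDerivAt ξ (θ t ξ)).comp t (hd t ξ)).congr_of_eventuallyEq ?_
      filter_upwards [continuousAt_const.eventually_lt hc1 h] with s hs
      exact cutoff_of_lt hs

/-- The gain `1 / γ` is what makes the integral terms small once `γ` is a large multiple of the time
weight. -/
theorem abs_integral_le_of_exp_decay {g : ℝ → ℝ} {B γ e x : ℝ} (hγ : 0 < γ) (hB : 0 ≤ B)
    (hg : ∀ ξ ∈ uIoc e x, |g ξ| ≤ B * Real.exp (-(γ * |x - ξ|))) :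
    |∫ ξ in e..x, g ξ| ≤ B / γ := by
  have h1 : ‖∫ ξ in e..x, g ξ‖ ≤ |∫ ξ in e..x, B * Real.exp (-(γ * |x - ξ|))| :=
    intervalIntegral.norm_integral_le_abs_of_norm_le
      ((ae_restrict_iff' measurableSet_uIoc).2 (Eventually.of_forall fun ξ hξ => hg ξ hξ))
      (by apply Continuous.intervalIntegrable; fun_prop)
  refine h1.trans ?_
  -- The sign of `x - e` is `σ`, so that one primitive serves entry from the left and from the
  -- right.
  have key : ∀ σ : ℝ, σ = 1 ∨ σ = -1 → (∀ ξ ∈ uIcc e x, |x - ξ| = σ * (x - ξ)) →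
      |∫ ξ in e..x, B * Real.exp (-(γ * |x - ξ|))| ≤ B / γ := by
    intro σ hσ habs
    have h2 : ∫ ξ in e..x, B * Real.exp (-(γ * |x - ξ|)) =
        ∫ ξ in e..x, B * Real.exp (-(γ * (σ * (x - ξ)))) :=
      intervalIntegral.integral_congr fun ξ hξ => by simp only [habs ξ hξ]
    have h3 : ∫ ξ in e..x, B * Real.exp (-(γ * (σ * (x - ξ)))) =
        B * σ / γ * Real.exp (-(γ * (σ * (x - x)))) -
          B * σ / γ * Real.exp (-(γ * (σ * (x - e)))) := by
      refine intervalIntegral.integral_eq_sub_of_hasDerivAt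
        (f := fun ξ => B * σ / γ * Real.exp (-(γ * (σ * (x - ξ))))) (fun ξ _ => ?_)
        (by apply Continuous.intervalIntegrable; fun_prop)
      have := (((((hasDerivAt_id ξ).const_sub x).const_mul σ).const_mul γ).neg.exp).const_mul
        (B * σ / γ)
      refine this.congr_deriv ?_
      have hσ2 : σ * σ = 1 := by rcases hσ with rfl | rfl <;> norm_num
      simp only [id, Pi.neg_apply]
      field_simp
      linear_combination B * hσ2
    rw [h2, h3, ← habs e left_mem_uIcc]
    have h4 : 0 < Real.exp (-(γ * |x - e|)) := Real.exp_pos _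
    have h5 : Real.exp (-(γ * |x - e|)) ≤ 1 :=
      Real.exp_le_one_iff.2 (by have := mul_nonneg hγ.le (abs_nonneg (x - e)); linarith)
    have h6 : |B * σ / γ| = B / γ := by
      rw [abs_div, abs_mul, abs_of_nonneg hB, abs_of_pos hγ]
      rcases hσ with rfl | rfl <;> simp
    simp only [sub_self, mul_zero, neg_zero, Real.exp_zero]
    rw [← mul_sub, abs_mul, h6]
    exact mul_le_of_le_one_right (by positivity) (abs_le.2 ⟨by linarith, by linarith⟩)
  rcases le_total e x with h | h
  · refine key 1 (Or.inl rfl) fun ξ hξ => ?_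
    rw [uIcc_of_le h] at hξ
    rw [one_mul, abs_of_nonneg (by linarith [hξ.2])]
  · refine key (-1) (Or.inr rfl) fun ξ hξ => ?_
    rw [uIcc_of_ge h] at hξ
    rw [abs_of_nonpos (by linarith [hξ.1])]
    ring

/-! ### Direction of propagation -/

/-- The characteristics `dt/dx = q` enter the strip at `x = e`, and time grows along them at
rate at least `κ`. -/
def IsIncoming (q : ℝ → ℝ → ℝ) (κ e : ℝ) : Prop :=
  (e = 0 ∧ ∀ x t, κ ≤ q x t) ∨ (e = 1 ∧ ∀ x t, q x t ≤ -κ)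

theorem IsIncoming.mem {q : ℝ → ℝ → ℝ} {κ e : ℝ} (h : IsIncoming q κ e) : e ∈ Icc (0 : ℝ) 1 := by
  rcases h with ⟨rfl, _⟩ | ⟨rfl, _⟩ <;> simp

theorem IsIncoming.abs_outgoing_sub {q : ℝ → ℝ → ℝ} {κ e : ℝ} (h : IsIncoming q κ e) :
    |1 - e - e| = 1 := by
  rcases h with ⟨rfl, _⟩ | ⟨rfl, _⟩ <;> simp

theorem IsFlow.injective {q : ℝ → ℝ → ℝ} {T : ℝ → ℝ → ℝ → ℝ} (hT : IsFlow q T) {κ e : ℝ}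
    (hκ : 0 < κ) (h : IsIncoming q κ e) (x t : ℝ) : Function.Injective (T x t) := by
  rcases h with ⟨_, h⟩ | ⟨_, h⟩
  · refine (strictMono_of_deriv_pos fun ξ => ?_).injective
    rw [(hT.hasDerivAt x t ξ).deriv]
    exact hκ.trans_le (h _ _)
  · refine (strictAnti_of_deriv_neg fun ξ => ?_).injective
    rw [(hT.hasDerivAt x t ξ).deriv]
    linarith [h ξ (T x t ξ)]

/-- Since `|dt/dx| ≥ κ`, following a characteristic back from `x` to `ξ` goes back in time by at
least `κ |x - ξ|`. Every decay factor `exp(-λκ|x - ξ|)` comes from this. -/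
theorem IsFlow.le_sub {q : ℝ → ℝ → ℝ} {T : ℝ → ℝ → ℝ → ℝ} (hT : IsFlow q T) {κ e : ℝ}
    (h : IsIncoming q κ e) {x ξ : ℝ} (hx : x ∈ Icc (0 : ℝ) 1) (hξ : ξ ∈ uIcc e x) (t : ℝ) :
    T x t ξ ≤ t - κ * |x - ξ| := by
  have hm : ∀ c, ∀ y, HasDerivAt (fun y => T x t y + c * y) (q y (T x t y) + c) y := fun c y => by
    simpa using! (hT.hasDerivAt x t y).add ((hasDerivAt_id y).const_mul c)
  rcases h with ⟨rfl, h⟩ | ⟨rfl, h⟩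
  · rw [uIcc_of_le hx.1] at hξ
    have := monotone_of_deriv_nonneg (fun y => (hm (-κ) y).differentiableAt)
      (fun y => by rw [(hm (-κ) y).deriv]; linarith [h y (T x t y)]) hξ.2
    simp only [hT.start] at this
    rw [abs_of_nonneg (by linarith [hξ.2])]
    linarith
  · rw [uIcc_of_ge hx.2] at hξ
    have := antitone_of_deriv_nonpos (fun y => (hm κ y).differentiableAt)
      (fun y => by rw [(hm κ y).deriv]; linarith [h y (T x t y)]) hξ.1
    simp only [hT.start] at this
    rw [abs_of_nonpos (by linarith [hξ.1])]
    linarith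

end HypSys

namespace HypSys

open scoped NNReal BoundedContinuousFunction

/-! ### Hyperbolic systems with zero initial data -/

/-- A system `∂ₓ w_j + q_j ∂ₜ w_j = h_j - ∑ₖ β_{jk} w_k` on the plane, with the characteristics
`T j` of its `j`-th equation, which enter the strip at `x = e j`, and with a source `h` vanishing
at the initial time `τ`. -/
structure TransportSystem (n : ℕ) where
  (q qt h ht : Fin n → ℝ → ℝ → ℝ)
  (β βt : Fin n → Fin n → ℝ → ℝ → ℝ)
  (p : Fin n → Fin n → ℝ)
  (T : Fin n → ℝ → ℝ → ℝ → ℝ)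
  (e : Fin n → ℝ)
  (τ κ C : ℝ)
  κ_pos : 0 < κ
  q_C1 : ∀ j, IsTimeC1 (q j) (qt j)
  h_C1 : ∀ j, IsTimeC1 (h j) (ht j)
  β_C1 : ∀ j k, IsTimeC1 (β j k) (βt j k)
  q_le : ∀ j x t, |q j x t| ≤ C
  qt_le : ∀ j x t, |qt j x t| ≤ C
  ht_le : ∀ j x t, |ht j x t| ≤ C
  β_le : ∀ j k x t, |β j k x t| ≤ C
  βt_le : ∀ j k x t, |βt j k x t| ≤ C
  h_start : ∀ j x, h j x τ = 0
  flow : ∀ j, IsFlow (q j) (T j)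
  incoming : ∀ j, IsIncoming (q j) κ (e j)

namespace TransportSystem

variable {n : ℕ} (D : TransportSystem n)

/-- The time derivative of the characteristics. -/
def S (j : Fin n) : ℝ → ℝ → ℝ → ℝ := IsFlow.timeDeriv (D.qt j) (D.T j)

theorem C_nonneg (j : Fin n) : 0 ≤ D.C := (abs_nonneg _).trans (D.q_le j 0 0)

theorem continuous_T (j : Fin n) : Continuous fun z : ℝ × ℝ × ℝ => D.T j z.1 z.2.1 z.2.2 :=
  (D.flow j).continuous (D.q_C1 j) (D.q_le j) (D.qt_le j)

theorem continuous_S (j : Fin n) : Continuous fun z : ℝ × ℝ × ℝ => D.S j z.1 z.2.1 z.2.2 :=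
  (D.flow j).continuous_timeDeriv (D.q_C1 j) (D.q_le j) (D.qt_le j)

theorem hasDerivAt_T (j : Fin n) (x t ξ : ℝ) :
    HasDerivAt (fun t => D.T j x t ξ) (D.S j x t ξ) t :=
  (D.flow j).hasDerivAt_time (D.q_C1 j) (D.q_le j) (D.qt_le j) x t ξ

theorem injective_T (j : Fin n) (x t : ℝ) : Function.Injective (D.T j x t) :=
  (D.flow j).injective D.κ_pos (D.incoming j) x t

theorem T_le (j : Fin n) {x ξ : ℝ} (hx : x ∈ Icc (0 : ℝ) 1) (hξ : ξ ∈ uIcc (D.e j) x) (t : ℝ) :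
    D.T j x t ξ ≤ t - D.κ * |x - ξ| :=
  (D.flow j).le_sub (D.incoming j) hx hξ t

theorem T_le_self (j : Fin n) {x ξ : ℝ} (hx : x ∈ Icc (0 : ℝ) 1) (hξ : ξ ∈ uIcc (D.e j) x)
    (t : ℝ) : D.T j x t ξ ≤ t := by
  have := mul_nonneg D.κ_pos.le (abs_nonneg (x - ξ))
  linarith [D.T_le j hx hξ t]

theorem S_pos (j : Fin n) (x t ξ : ℝ) : 0 < D.S j x t ξ := IsFlow.timeDeriv_pos x t ξ

theorem S_le (j : Fin n) (x t ξ : ℝ) : D.S j x t ξ ≤ Real.exp (D.C * |x - ξ|) := by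
  rw [abs_sub_comm]; exact IsFlow.timeDeriv_le (D.qt_le j) x t ξ

theorem abs_sub_le_one (j : Fin n) {x ξ : ℝ} (hx : x ∈ Icc (0 : ℝ) 1)
    (hξ : ξ ∈ uIcc (D.e j) x) : |x - ξ| ≤ 1 := by
  have h := uIcc_subset_Icc (D.incoming j).mem hx hξ
  exact abs_le.2 ⟨by linarith [h.2, hx.1], by linarith [h.1, hx.2]⟩

/-- The time integral `∫_τ^t v`. -/
def prim (v : ℝ → ℝ → Fin n → ℝ) (x t : ℝ) (j : Fin n) : ℝ := ∫ s in D.τ..t, v x s j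

/-- Right-hand side of the `j`-th equation. -/
def rhs (w : ℝ → ℝ → Fin n → ℝ) (j : Fin n) (x t : ℝ) : ℝ :=
  D.h j x t - ∑ k, D.β j k x t * w x t k

/-- Time derivative of the right-hand side of the `j`-th equation if `v = ∂ₜ w`. -/
def rhsDeriv (v w : ℝ → ℝ → Fin n → ℝ) (j : Fin n) (x t : ℝ) : ℝ :=
  D.ht j x t - ∑ k, (D.βt j k x t * w x t k + D.β j k x t * v x t k)

/-- Integration of the equations along the characteristics. -/
def solve (w : ℝ → ℝ → Fin n → ℝ) (j : Fin n) (x t : ℝ) : ℝ :=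
  ∑ k, D.p j k * w (1 - D.e k) (D.T j x t (D.e j)) k +
    ∫ ξ in D.e j..x, cutoff D.τ (D.T j x t) (fun ξ => D.rhs w j ξ (D.T j x t ξ)) ξ

/-- The time derivative of `solve (prim v)`. -/
def step (v : ℝ → ℝ → Fin n → ℝ) (j : Fin n) (x t : ℝ) : ℝ :=
  (∑ k, D.p j k * v (1 - D.e k) (D.T j x t (D.e j)) k) * D.S j x t (D.e j) +
    ∫ ξ in D.e j..x, cutoff D.τ (D.T j x t)
      (fun ξ => D.rhsDeriv v (D.prim v) j ξ (D.T j x t ξ) * D.S j x t ξ) ξ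

/-! ### Regularity and causality of the characteristic integral operator -/

section Regularity

variable {v : ℝ → ℝ → Fin n → ℝ}

theorem continuous_prim (hv : ∀ j, Continuous fun z : ℝ × ℝ => v z.1 z.2 j) (j : Fin n) :
    Continuous fun z : ℝ × ℝ => D.prim v z.1 z.2 j := by
  refine intervalIntegral.continuous_parametric_intervalIntegral_of_continuous
    (f := fun (z : ℝ × ℝ) s => v z.1 s j) ?_ continuous_snd
  exact (hv j).comp (by fun_prop : Continuous fun w : (ℝ × ℝ) × ℝ => (w.1.1, w.2))

theorem hasDerivAt_prim (hv : ∀ j, Continuous fun z : ℝ × ℝ => v z.1 z.2 j) (j : Fin n)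
    (x t : ℝ) : HasDerivAt (fun s => D.prim v x s j) (v x t j) t :=
  (((hv j).comp (by fun_prop : Continuous fun s : ℝ => (x, s))).integral_hasStrictDerivAt
    D.τ t).hasDerivAt

theorem prim_of_le (h0 : ∀ x t, t ≤ D.τ → v x t = 0) {x t : ℝ} (ht : t ≤ D.τ) :
    D.prim v x t = 0 := by
  funext j
  have : ∫ s in D.τ..t, v x s j = ∫ s in D.τ..t, (0 : ℝ) := by
    refine intervalIntegral.integral_congr fun s hs => ?_
    rw [uIcc_of_ge ht] at hs
    simp [h0 x s hs.2]
  simp [prim, this]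

theorem rhs_C1 (hv : ∀ j, Continuous fun z : ℝ × ℝ => v z.1 z.2 j) (j : Fin n) :
    IsTimeC1 (D.rhs (D.prim v) j) (D.rhsDeriv v (D.prim v) j) where
  cont := (D.h_C1 j).cont.sub (continuous_finsetSum _ fun k _ =>
    (D.β_C1 j k).cont.mul (D.continuous_prim hv k))
  cont' := (D.h_C1 j).cont'.sub (continuous_finsetSum _ fun k _ =>
    ((D.β_C1 j k).cont'.mul (D.continuous_prim hv k)).add ((D.β_C1 j k).cont.mul (hv k)))
  hasDerivAt x t := ((D.h_C1 j).hasDerivAt x t).sub (HasDerivAt.fun_sum fun k _ =>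
    ((D.β_C1 j k).hasDerivAt x t).mul (D.hasDerivAt_prim hv k x t))

theorem rhs_start (v : ℝ → ℝ → Fin n → ℝ) (j : Fin n) (x : ℝ) : D.rhs (D.prim v) j x D.τ = 0 := by
  simp [rhs, prim, D.h_start]

theorem continuous_step (hv : ∀ j, Continuous fun z : ℝ × ℝ => v z.1 z.2 j) (j : Fin n) :
    Continuous fun z : ℝ × ℝ => D.step v j z.1 z.2 := by
  have h0 : Continuous fun z : ℝ × ℝ => (z.1, z.2, D.e j) := by fun_prop
  have hT0 := (D.continuous_T j).comp h0
  have h1 : Continuous fun w : (ℝ × ℝ) × ℝ => (w.1.1, w.1.2, w.2) := by fun_prop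
  have hT := (D.continuous_T j).comp h1
  refine Continuous.add (Continuous.mul (continuous_finsetSum _ fun k _ =>
    continuous_const.mul ((hv k).comp (continuous_const.prodMk hT0)))
      ((D.continuous_S j).comp h0)) ?_
  refine (continuous_integral_cutoff (X := ℝ × ℝ) (τ := D.τ) (θ := fun z => D.T j z.1 z.2)
    (g := fun z ξ => D.rhsDeriv v (D.prim v) j ξ (D.T j z.1 z.2 ξ) * D.S j z.1 z.2 ξ)
    hT ?_ (fun z => D.injective_T j z.1 z.2) (D.e j)).comp
      (by fun_prop : Continuous fun z : ℝ × ℝ => (z, z.1))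
  exact ((D.rhs_C1 hv j).cont'.comp (continuous_snd.prodMk hT)).mul ((D.continuous_S j).comp h1)

theorem hasDerivAt_solve (hv : ∀ j, Continuous fun z : ℝ × ℝ => v z.1 z.2 j) (j : Fin n)
    (x t : ℝ) : HasDerivAt (fun t => D.solve (D.prim v) j x t) (D.step v j x t) t := by
  have h1 : Continuous fun w : ℝ × ℝ => (x, w.1, w.2) := by fun_prop
  refine HasDerivAt.add ?_ (hasDerivAt_integral_cutoff (D.rhs_C1 hv j) (D.rhs_start v j)
    ((D.continuous_T j).comp h1) ((D.continuous_S j).comp h1) (fun t ξ => D.hasDerivAt_T j x t ξ)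
    (fun t => D.injective_T j x t) (D.e j) x t)
  rw [Finset.sum_mul]
  refine HasDerivAt.fun_sum fun k _ => ?_
  rw [mul_assoc]
  exact ((D.hasDerivAt_prim hv k _ _).comp t (D.hasDerivAt_T j x t (D.e j))).const_mul _

/-- Causality: inside the strip a characteristic traced back to its entry end meets only earlier
times. -/
theorem step_of_le (h0 : ∀ x t, t ≤ D.τ → v x t = 0) (j : Fin n) {x t : ℝ}
    (hx : x ∈ Icc (0 : ℝ) 1) (ht : t ≤ D.τ) : D.step v j x t = 0 := by
  have h1 : ∫ ξ in D.e j..x, cutoff D.τ (D.T j x t)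
      (fun ξ => D.rhsDeriv v (D.prim v) j ξ (D.T j x t ξ) * D.S j x t ξ) ξ =
      ∫ ξ in D.e j..x, (0 : ℝ) :=
    intervalIntegral.integral_congr fun ξ hξ => cutoff_of_le ((D.T_le_self j hx hξ t).trans ht)
  rw [step, h1]
  simp [h0 _ _ ((D.T_le_self j hx left_mem_uIcc t).trans ht)]

theorem solve_of_le (h0 : ∀ x t, t ≤ D.τ → v x t = 0) (j : Fin n) {x t : ℝ}
    (hx : x ∈ Icc (0 : ℝ) 1) (ht : t ≤ D.τ) : D.solve v j x t = 0 := by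
  have h1 : ∫ ξ in D.e j..x, cutoff D.τ (D.T j x t) (fun ξ => D.rhs v j ξ (D.T j x t ξ)) ξ =
      ∫ ξ in D.e j..x, (0 : ℝ) :=
    intervalIntegral.integral_congr fun ξ hξ => cutoff_of_le ((D.T_le_self j hx hξ t).trans ht)
  rw [solve, h1]
  simp [h0 _ _ ((D.T_le_self j hx left_mem_uIcc t).trans ht)]

end Regularity

/-! ### Contraction estimate in the weighted norm -/

section Contraction

/-- The weight of the `j`-th component. -/
def weight (lam μ : ℝ) (j : Fin n) (x t : ℝ) : ℝ :=
  Real.exp (lam * (t - D.τ) + μ * (1 - |x - D.e j|))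

theorem weight_pos (lam μ : ℝ) (j : Fin n) (x t : ℝ) : 0 < D.weight lam μ j x t := Real.exp_pos _

theorem continuous_weight (lam μ : ℝ) (j : Fin n) :
    Continuous fun z : ℝ × ℝ => D.weight lam μ j z.1 z.2 := by
  unfold weight; fun_prop

theorem abs_sub_e_le_one (j : Fin n) {x : ℝ} (hx : x ∈ Icc (0 : ℝ) 1) : |x - D.e j| ≤ 1 :=
  D.abs_sub_le_one j hx left_mem_uIcc

theorem le_weight {lam μ : ℝ} (hμ : 0 ≤ μ) (j : Fin n) {x : ℝ} (hx : x ∈ Icc (0 : ℝ) 1) (t : ℝ) :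
    Real.exp (lam * (t - D.τ)) ≤ D.weight lam μ j x t :=
  Real.exp_le_exp.2 (by have := mul_nonneg hμ (sub_nonneg.2 (D.abs_sub_e_le_one j hx)); linarith)

theorem weight_le {lam μ : ℝ} (hμ : 0 ≤ μ) (j : Fin n) (x t : ℝ) :
    D.weight lam μ j x t ≤ Real.exp μ * Real.exp (lam * (t - D.τ)) := by
  rw [← Real.exp_add]
  exact Real.exp_le_exp.2 (by have := mul_nonneg hμ (abs_nonneg (x - D.e j)); linarith)

theorem weight_outgoing (lam μ : ℝ) (j : Fin n) (t : ℝ) :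
    D.weight lam μ j (1 - D.e j) t = Real.exp (lam * (t - D.τ)) := by
  rw [weight, (D.incoming j).abs_outgoing_sub]; simp

variable {v v' : ℝ → ℝ → Fin n → ℝ} {lam μ N : ℝ}

/-- Integrating `exp(λ(s-τ))` in time costs at most `1/λ ≤ 1`, so lower order terms in `w` obey the
same bound as those in `v`. -/
theorem abs_prim_sub_le (hv : ∀ j, Continuous fun z : ℝ × ℝ => v z.1 z.2 j)
    (hv' : ∀ j, Continuous fun z : ℝ × ℝ => v' z.1 z.2 j) (hμ : 0 ≤ μ) (hlam : 1 ≤ lam)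
    (hN : 0 ≤ N) (hd : ∀ x t j, |v x t j - v' x t j| ≤ N * D.weight lam μ j x t) (x t : ℝ)
    (ht : D.τ ≤ t) (j : Fin n) :
    |D.prim v x t j - D.prim v' x t j| ≤ N * (Real.exp μ * Real.exp (lam * (t - D.τ))) := by
  have hl : 0 < lam := by linarith
  have hc : Continuous fun s : ℝ => (x, s) := by fun_prop
  have hi : IntervalIntegrable (fun s => v x s j) volume D.τ t :=
    ((hv j).comp hc).intervalIntegrable _ _
  have hi' : IntervalIntegrable (fun s => v' x s j) volume D.τ t :=
    ((hv' j).comp hc).intervalIntegrable _ _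
  rw [prim, prim, ← intervalIntegral.integral_sub hi hi']
  refine (abs_integral_le_of_exp_decay (γ := lam)
    (B := N * (Real.exp μ * Real.exp (lam * (t - D.τ)))) hl (by positivity) fun s hs => ?_).trans
      (div_le_self (by positivity) hlam)
  rw [uIoc_of_le ht] at hs
  refine (hd x s j).trans ?_
  rw [mul_assoc]
  refine mul_le_mul_of_nonneg_left ((D.weight_le hμ j x s).trans (le_of_eq ?_)) hN
  rw [abs_of_nonneg (by linarith [hs.2])]
  simp only [← Real.exp_add]
  ring_nf

/-- Each of the two terms contributes a quarter of the weight. Reflected values are read at exit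
ends, where the weight carries no factor `exp μ`. On the way from the entry end to `x`, the factor
`exp(C|x-e|)` from `S` is absorbed by the elapsed time through `C + μ ≤ λκ`, which leaves `Cp / exp
μ ≤ 1/4`. In the integral, `n` summands with two coefficients bounded by `C`, the factor `exp μ`
from the weight and `exp C` from `S` meet the gain `1/(λκ)`. -/
theorem abs_step_sub_le {Cp : ℝ} (hv : ∀ j, Continuous fun z : ℝ × ℝ => v z.1 z.2 j)
    (hv' : ∀ j, Continuous fun z : ℝ × ℝ => v' z.1 z.2 j) (hμ : 0 ≤ μ) (hlam : 1 ≤ lam)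
    (hN : 0 ≤ N) (hd : ∀ x t j, |v x t j - v' x t j| ≤ N * D.weight lam μ j x t)
    (hp : ∀ j, ∑ k, |D.p j k| ≤ Cp) (hμp : 4 * Cp ≤ Real.exp μ) (hl₁ : D.C + μ ≤ lam * D.κ)
    (hl₂ : 8 * n * D.C * Real.exp (μ + D.C) ≤ lam * D.κ)
    (j : Fin n) {x : ℝ} (hx : x ∈ Icc (0 : ℝ) 1) (t : ℝ) :
    |D.step v j x t - D.step v' j x t| ≤ N / 2 * D.weight lam μ j x t := by
  have hC := D.C_nonneg j
  have hCp : 0 ≤ Cp := (Finset.sum_nonneg fun k _ => abs_nonneg _).trans (hp j)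
  have hlκ : 0 < lam * D.κ := mul_pos (by linarith) D.κ_pos
  have hl : 0 < lam := by linarith
  -- the boundary term
  have hb : |(∑ k, D.p j k * v (1 - D.e k) (D.T j x t (D.e j)) k) * D.S j x t (D.e j) -
      (∑ k, D.p j k * v' (1 - D.e k) (D.T j x t (D.e j)) k) * D.S j x t (D.e j)| ≤
      N / 4 * D.weight lam μ j x t := by
    rw [← sub_mul, ← Finset.sum_sub_distrib, abs_mul, abs_of_pos (D.S_pos _ _ _ _)]
    have h1 : |∑ k, (D.p j k * v (1 - D.e k) (D.T j x t (D.e j)) k -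
        D.p j k * v' (1 - D.e k) (D.T j x t (D.e j)) k)| ≤
        Cp * (N * Real.exp (lam * (D.T j x t (D.e j) - D.τ))) := by
      refine (Finset.abs_sum_le_sum_abs _ _).trans ?_
      calc _ ≤ ∑ k, |D.p j k| * (N * Real.exp (lam * (D.T j x t (D.e j) - D.τ))) := by
            refine Finset.sum_le_sum fun k _ => ?_
            rw [← mul_sub, abs_mul]
            refine mul_le_mul_of_nonneg_left ?_ (abs_nonneg _)
            simpa only [D.weight_outgoing] using hd (1 - D.e k) (D.T j x t (D.e j)) k
        _ ≤ _ := by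
            rw [← Finset.sum_mul]
            exact mul_le_mul_of_nonneg_right (hp j) (by positivity)
    calc _ ≤ Cp * (N * Real.exp (lam * (D.T j x t (D.e j) - D.τ))) *
          Real.exp (D.C * |x - D.e j|) :=
          mul_le_mul h1 (D.S_le _ _ _ _) (D.S_pos _ _ _ _).le (by positivity)
      _ = Cp * N * Real.exp (lam * (D.T j x t (D.e j) - D.τ) + D.C * |x - D.e j|) := by
          rw [Real.exp_add]; ring
      _ ≤ Cp * N * Real.exp (lam * (t - D.τ) + μ * (1 - |x - D.e j|) - μ) := by
          refine mul_le_mul_of_nonneg_left (Real.exp_le_exp.2 ?_) (by positivity)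
          have h2 := mul_le_mul_of_nonneg_left (D.T_le j hx left_mem_uIcc t) hl.le
          have h3 := mul_le_mul_of_nonneg_right hl₁ (abs_nonneg (x - D.e j))
          nlinarith
      _ = Cp / Real.exp μ * N * D.weight lam μ j x t := by
          rw [Real.exp_sub, weight]; ring
      _ ≤ _ := by
          refine mul_le_mul_of_nonneg_right ?_ (D.weight_pos _ _ _ _ _).le
          have : Cp / Real.exp μ ≤ 1 / 4 := by
            rw [div_le_iff₀ (Real.exp_pos _)]; linarith
          nlinarith
  -- the integral term
  have hcx : Continuous fun ξ : ℝ => (x, t, ξ) := by fun_prop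
  have hTc : Continuous (D.T j x t) := (D.continuous_T j).comp hcx
  have hgc : ∀ v : ℝ → ℝ → Fin n → ℝ, (∀ j, Continuous fun z : ℝ × ℝ => v z.1 z.2 j) →
      Continuous fun ξ => D.rhsDeriv v (D.prim v) j ξ (D.T j x t ξ) * D.S j x t ξ := fun v hv =>
    ((D.rhs_C1 hv j).cont'.comp (continuous_id.prodMk hTc)).mul ((D.continuous_S j).comp hcx)
  have hi : |(∫ ξ in D.e j..x, cutoff D.τ (D.T j x t)
        (fun ξ => D.rhsDeriv v (D.prim v) j ξ (D.T j x t ξ) * D.S j x t ξ) ξ) -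
      ∫ ξ in D.e j..x, cutoff D.τ (D.T j x t)
        (fun ξ => D.rhsDeriv v' (D.prim v') j ξ (D.T j x t ξ) * D.S j x t ξ) ξ| ≤
      N / 4 * D.weight lam μ j x t := by
    rw [← intervalIntegral.integral_sub (intervalIntegrable_cutoff hTc (hgc v hv) _ _)
      (intervalIntegrable_cutoff hTc (hgc v' hv') _ _)]
    have hB : 0 ≤ 2 * n * D.C * Real.exp (μ + D.C) * (N * Real.exp (lam * (t - D.τ))) := by
      positivity
    refine (abs_integral_le_of_exp_decay hlκ hB fun ξ hξ => ?_).trans ?_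
    · rcases le_or_gt (D.T j x t ξ) D.τ with h | h
      · rw [cutoff_of_le h, cutoff_of_le h, sub_zero, abs_zero]
        positivity
      rw [cutoff_of_lt h, cutoff_of_lt h, ← sub_mul, abs_mul, abs_of_pos (D.S_pos _ _ _ _)]
      set s := D.T j x t ξ with hs
      set Q := N * (Real.exp μ * Real.exp (lam * (s - D.τ))) with hQ
      have hQ0 : 0 ≤ Q := by positivity
      have h1 : |D.rhsDeriv v (D.prim v) j ξ s - D.rhsDeriv v' (D.prim v') j ξ s| ≤
          n * (2 * D.C * Q) := by
        have : D.rhsDeriv v (D.prim v) j ξ s - D.rhsDeriv v' (D.prim v') j ξ s =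
            -∑ k, (D.βt j k ξ s * (D.prim v ξ s k - D.prim v' ξ s k) +
              D.β j k ξ s * (v ξ s k - v' ξ s k)) := by
          rw [rhsDeriv, rhsDeriv, sub_sub_sub_cancel_left, ← Finset.sum_sub_distrib,
            ← Finset.sum_neg_distrib]
          exact Finset.sum_congr rfl fun k _ => by ring
        rw [this, abs_neg]
        refine (Finset.abs_sum_le_sum_abs _ _).trans ?_
        refine (Finset.sum_le_card_nsmul _ _ (2 * D.C * Q) fun k _ => ?_).trans (by simp)
        refine (abs_add_le _ _).trans ?_
        rw [abs_mul, abs_mul]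
        have h2 := mul_le_mul (D.βt_le j k ξ s)
          (D.abs_prim_sub_le hv hv' hμ hlam hN hd ξ s h.le k) (abs_nonneg _) hC
        have h3 := mul_le_mul (D.β_le j k ξ s) ((hd ξ s k).trans
          (mul_le_mul_of_nonneg_left (D.weight_le hμ k ξ s) hN)) (abs_nonneg _) hC
        linarith
      have hξ' : ξ ∈ uIcc (D.e j) x := Ioc_subset_Icc_self hξ
      have h4 : D.S j x t ξ ≤ Real.exp D.C :=
        (D.S_le _ _ _ _).trans (Real.exp_le_exp.2
          (mul_le_of_le_one_right hC (D.abs_sub_le_one j hx hξ')))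
      calc _ ≤ n * (2 * D.C * Q) * Real.exp D.C :=
            mul_le_mul h1 h4 (D.S_pos _ _ _ _).le (by positivity)
        _ = 2 * n * D.C * Real.exp (μ + D.C) * (N * Real.exp (lam * (s - D.τ))) := by
            rw [hQ, Real.exp_add]; ring
        _ ≤ 2 * n * D.C * Real.exp (μ + D.C) *
            (N * (Real.exp (lam * (t - D.τ)) * Real.exp (-(lam * D.κ * |x - ξ|)))) := by
            rw [← Real.exp_add]
            have h5 := mul_le_mul_of_nonneg_left (D.T_le j hx hξ' t) hl.le
            gcongr
            rw [← hs] at h5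
            linarith
        _ = _ := by ring
    · have h1 := D.le_weight (lam := lam) hμ j hx t
      rw [div_le_iff₀ hlκ]
      calc 2 * n * D.C * Real.exp (μ + D.C) * (N * Real.exp (lam * (t - D.τ)))
          = (8 * n * D.C * Real.exp (μ + D.C)) * (N / 4 * Real.exp (lam * (t - D.τ))) := by ring
        _ ≤ lam * D.κ * (N / 4 * D.weight lam μ j x t) := by gcongr
        _ = _ := by ring
  have h6 : ∀ a b c d : ℝ, |a - c| ≤ N / 4 * D.weight lam μ j x t →
      |b - d| ≤ N / 4 * D.weight lam μ j x t →
      |a + b - (c + d)| ≤ N / 2 * D.weight lam μ j x t := by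
    intro a b c d h1 h2
    have := abs_add_le (a - c) (b - d)
    rw [show a + b - (c + d) = a - c + (b - d) by ring]
    linarith
  exact h6 _ _ _ _ hb hi

end Contraction

end TransportSystem

end HypSys

namespace HypSys

open scoped NNReal BoundedContinuousFunction

/-- The projection of the line onto `[0,1]`. -/
def clamp (x : ℝ) : ℝ := max 0 (min x 1)

theorem clamp_mem (x : ℝ) : clamp x ∈ Icc (0 : ℝ) 1 :=
  ⟨le_max_left _ _, max_le zero_le_one (min_le_right _ _)⟩

theorem clamp_of_mem {x : ℝ} (hx : x ∈ Icc (0 : ℝ) 1) : clamp x = x := by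
  rw [clamp, min_eq_left hx.2, max_eq_right hx.1]

theorem continuous_clamp : Continuous clamp := by unfold clamp; fun_prop

/-! ### Fixed point and solution with zero initial data -/

namespace TransportSystem

variable {n : ℕ} (D : TransportSystem n)

/-- Only `ht` survives when `v = 0`. A constant bound becomes a weighted one because the weight is
at least `1` after `τ`, while before `τ`, where it may be tiny, `step` vanishes. -/
theorem abs_step_zero_le {lam μ : ℝ} (hlam : 0 ≤ lam) (hμ : 0 ≤ μ) (j : Fin n) {x : ℝ}
    (hx : x ∈ Icc (0 : ℝ) 1) (t : ℝ) :
    |D.step (fun _ _ => 0) j x t| ≤ D.C * Real.exp D.C * D.weight lam μ j x t := by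
  have hC := D.C_nonneg j
  rcases le_or_gt t D.τ with ht | ht
  · rw [D.step_of_le (fun _ _ _ => rfl) j hx ht, abs_zero]
    have := D.weight_pos lam μ j x t
    positivity
  · have h1 : 1 ≤ D.weight lam μ j x t :=
      (Real.one_le_exp (mul_nonneg hlam (by linarith))).trans (D.le_weight hμ j hx t)
    have h2 : |D.step (fun _ _ => 0) j x t| ≤ D.C * Real.exp D.C * |x - D.e j| := by
      have h3 := intervalIntegral.norm_integral_le_of_norm_le_const (a := D.e j) (b := x)
        (C := D.C * Real.exp D.C) (f := cutoff D.τ (D.T j x t)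
          (fun ξ => D.rhsDeriv (fun _ _ => 0) (D.prim (fun _ _ => 0)) j ξ (D.T j x t ξ) *
            D.S j x t ξ)) fun ξ hξ => by
        refine abs_cutoff_le.trans ?_
        have h5 : D.S j x t ξ ≤ Real.exp D.C :=
          (D.S_le _ _ _ _).trans (Real.exp_le_exp.2
            (mul_le_of_le_one_right hC (D.abs_sub_le_one j hx (Ioc_subset_Icc_self hξ))))
        simp only [rhsDeriv, prim, Pi.zero_apply, intervalIntegral.integral_zero, mul_zero,
          add_zero, Finset.sum_const_zero, sub_zero]
        rw [abs_mul, abs_of_pos (D.S_pos _ _ _ _)]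
        exact mul_le_mul (D.ht_le _ _ _) h5 (D.S_pos _ _ _ _).le hC
      simpa [step] using h3
    have h4 := D.abs_sub_e_le_one j hx
    have h5 : 0 ≤ D.C * Real.exp D.C := by positivity
    nlinarith

/-- Removal of the weight. -/
def unweight (lam μ : ℝ) (V : ℝ × ℝ →ᵇ (Fin n → ℝ)) (x t : ℝ) (j : Fin n) : ℝ :=
  D.weight lam μ j x t * V (x, t) j

theorem continuous_unweight (lam μ : ℝ) (V : ℝ × ℝ →ᵇ (Fin n → ℝ)) (j : Fin n) :
    Continuous fun z : ℝ × ℝ => D.unweight lam μ V z.1 z.2 j :=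
  (D.continuous_weight lam μ j).mul ((continuous_apply j).comp V.continuous)

theorem abs_unweight_sub_le (lam μ : ℝ) (V V' : ℝ × ℝ →ᵇ (Fin n → ℝ)) (x t : ℝ) (j : Fin n) :
    |D.unweight lam μ V x t j - D.unweight lam μ V' x t j| ≤
      dist V V' * D.weight lam μ j x t := by
  rw [unweight, unweight, ← mul_sub, abs_mul, abs_of_pos (D.weight_pos _ _ _ _ _), mul_comm]
  refine mul_le_mul_of_nonneg_right ?_ (D.weight_pos _ _ _ _ _).le
  exact (dist_le_pi_dist (V (x, t)) (V' (x, t)) j).trans (V.dist_coe_le_dist _)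

/-- There are weights for which `step` is a contraction. -/
theorem exists_weights : ∃ lam μ : ℝ, 0 ≤ μ ∧ 1 ≤ lam ∧ ∀ V V' : ℝ × ℝ →ᵇ (Fin n → ℝ), ∀ j,
    ∀ x ∈ Icc (0 : ℝ) 1, ∀ t,
    |D.step (D.unweight lam μ V) j x t - D.step (D.unweight lam μ V') j x t| ≤
      dist V V' / 2 * D.weight lam μ j x t := by
  set Cp := ∑ j, ∑ k, |D.p j k| with hCp
  have hCp0 : 0 ≤ Cp := Finset.sum_nonneg fun j _ => Finset.sum_nonneg fun k _ => abs_nonneg _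
  -- The `+ 1` keeps `μ` nonnegative when the reflection coefficients are small or zero.
  set μ := Real.log (4 * Cp + 1) with hμ
  have hexp : Real.exp μ = 4 * Cp + 1 := Real.exp_log (by positivity)
  have hμ0 : 0 ≤ μ := Real.log_nonneg (by linarith)
  -- `A` dominates both lower bounds needed for `λκ`. The absolute values are there because `C` is
  -- known to be nonnegative only when some index `j` exists.
  set A := |D.C| + μ + 8 * n * |D.C| * Real.exp (μ + D.C) with hA
  have hA0 : 0 ≤ A := by positivity
  have hκ := D.κ_pos
  have hlκ : A ≤ (1 + A / D.κ) * D.κ := by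
    rw [add_mul, div_mul_cancel₀ _ hκ.ne']; linarith
  have hx0 : 0 ≤ 8 * n * |D.C| * Real.exp (μ + D.C) := by positivity
  refine ⟨1 + A / D.κ, μ, hμ0, ?_, fun V V' j x hx t => ?_⟩
  · have : 0 ≤ A / D.κ := by positivity
    linarith
  · have hC : |D.C| = D.C := abs_of_nonneg (D.C_nonneg j)
    rw [hC] at hA hx0
    refine D.abs_step_sub_le (Cp := Cp) (D.continuous_unweight _ _ V)
      (D.continuous_unweight _ _ V') hμ0 ?_ dist_nonneg (D.abs_unweight_sub_le _ _ V V')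
      (fun j => ?_) (by linarith) ?_ ?_ j hx t
    · have : 0 ≤ A / D.κ := by positivity
      linarith
    · exact Finset.single_le_sum (f := fun j => ∑ k, |D.p j k|)
        (fun j _ => Finset.sum_nonneg fun k _ => abs_nonneg _) (Finset.mem_univ j)
    · linarith
    · have := D.C_nonneg j
      linarith

/-- The fixed point of `step`. -/
theorem exists_fixedPoint : ∃ v : ℝ → ℝ → Fin n → ℝ,
    (∀ j, Continuous fun z : ℝ × ℝ => v z.1 z.2 j) ∧ (∀ x t, t ≤ D.τ → v x t = 0) ∧
    ∀ j, ∀ x ∈ Icc (0 : ℝ) 1, ∀ t, D.step v j x t = v x t j := by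
  obtain ⟨lam, μ, hμ, hlam, hcontr⟩ := D.exists_weights
  have hcc : Continuous fun z : ℝ × ℝ => (clamp z.1, z.2) :=
    (continuous_clamp.comp continuous_fst).prodMk continuous_snd
  have hcont : ∀ V : ℝ × ℝ →ᵇ (Fin n → ℝ), Continuous fun (z : ℝ × ℝ) (j : Fin n) =>
      D.step (D.unweight lam μ V) j (clamp z.1) z.2 / D.weight lam μ j (clamp z.1) z.2 :=
    fun V => continuous_pi fun j =>
      ((D.continuous_step (D.continuous_unweight lam μ V) j).comp hcc).div
        ((D.continuous_weight lam μ j).comp hcc) fun z => (D.weight_pos _ _ _ _ _).ne'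
  have hbound : ∀ V : ℝ × ℝ →ᵇ (Fin n → ℝ), ∀ z : ℝ × ℝ, ‖fun j : Fin n =>
      D.step (D.unweight lam μ V) j (clamp z.1) z.2 / D.weight lam μ j (clamp z.1) z.2‖ ≤
      |D.C| * Real.exp D.C + dist V 0 := by
    intro V z
    refine (pi_norm_le_iff_of_nonneg (by positivity)).2 fun j => ?_
    rw [Real.norm_eq_abs, abs_div, abs_of_pos (D.weight_pos _ _ _ _ _),
      div_le_iff₀ (D.weight_pos _ _ _ _ _)]
    have h1 := hcontr V 0 j _ (clamp_mem z.1) z.2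
    have h2 := D.abs_step_zero_le (lam := lam) (by linarith) hμ j (clamp_mem z.1) z.2
    have h0 : D.unweight lam μ (0 : ℝ × ℝ →ᵇ (Fin n → ℝ)) = fun _ _ => 0 := by
      funext x t j; simp [unweight]
    rw [h0] at h1
    have h3 := abs_add_le (D.step (D.unweight lam μ V) j (clamp z.1) z.2 -
      D.step (fun _ _ => 0) j (clamp z.1) z.2) (D.step (fun _ _ => 0) j (clamp z.1) z.2)
    rw [sub_add_cancel] at h3
    have h4 := mul_nonneg (dist_nonneg (x := V) (y := 0))
      (D.weight_pos lam μ j (clamp z.1) z.2).le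
    rw [abs_of_nonneg (D.C_nonneg j)]
    linarith
  -- Dividing by the weight moves the problem to bounded continuous functions with the usual sup
  -- norm; `clamp` evaluates only inside the strip, where the estimates hold.
  set F : (ℝ × ℝ →ᵇ (Fin n → ℝ)) → (ℝ × ℝ →ᵇ (Fin n → ℝ)) := fun V =>
    BoundedContinuousFunction.ofNormedAddCommGroup _ (hcont V) _ (hbound V) with hF
  have hFapp : ∀ V x t j, F V (x, t) j =
    D.step (D.unweight lam μ V) j (clamp x) t / D.weight lam μ j (clamp x) t :=
    fun _ _ _ _ => rfl
  have hcontracting : ContractingWith (1 / 2) F := by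
    refine ⟨by rw [← NNReal.coe_lt_coe]; norm_num, LipschitzWith.of_dist_le_mul fun V V' => ?_⟩
    refine (BoundedContinuousFunction.dist_le (by positivity)).2 fun z => ?_
    refine (dist_pi_le_iff (by positivity)).2 fun j => ?_
    obtain ⟨x, t⟩ := z
    rw [hFapp, hFapp, Real.dist_eq, ← sub_div, abs_div, abs_of_pos (D.weight_pos _ _ _ _ _),
      div_le_iff₀ (D.weight_pos _ _ _ _ _)]
    refine (hcontr V V' j _ (clamp_mem x) t).trans (le_of_eq ?_)
    push_cast; ring
  set V := hcontracting.fixedPoint F with hV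
  have hfix : F V = V := hcontracting.fixedPoint_isFixedPt
  -- Vanishing up to time `τ` is a closed condition that `F` preserves by causality, so the limit of
  -- the iterates of `0` inherits it.
  have hclosed : IsClosed {V : ℝ × ℝ →ᵇ (Fin n → ℝ) | ∀ x t, t ≤ D.τ → V (x, t) = 0} := by
    simp only [Set.ofPred_forall]
    refine isClosed_iInter fun x => isClosed_iInter fun t => isClosed_iInter fun _ => ?_
    exact isClosed_eq (continuous_eval_const (x, t))
      continuous_const
  have hzero : ∀ x t, t ≤ D.τ → V (x, t) = 0 := by
    refine hclosed.mem_of_tendsto (hcontracting.tendsto_iterate_fixedPoint 0)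
      (Eventually.of_forall fun k => ?_)
    induction k with
    | zero => intro x t _; rfl
    | succ k ih =>
      intro x t ht
      rw [Function.iterate_succ_apply']
      funext j
      rw [hFapp, D.step_of_le (fun x t ht => ?_) j (clamp_mem x) ht, zero_div]
      · rfl
      · funext j
        simp [unweight, ih x t ht]
  refine ⟨D.unweight lam μ V, D.continuous_unweight lam μ V, fun x t ht => ?_,
    fun j x hx t => ?_⟩
  · funext j
    simp [unweight, hzero x t ht]
  · conv_rhs => rw [unweight, ← hfix]
    rw [hFapp, clamp_of_mem hx, mul_div_cancel₀ _ (D.weight_pos _ _ _ _ _).ne']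

/-- Where the first factor vanishes, the product rule needs only continuity of the second; this
allows a factor built from `v`, whose differentiability is unknown. -/
theorem hasDerivWithinAt_mul_of_eq_zero {a c : ℝ → ℝ} {a' x : ℝ} {s : Set ℝ}
    (ha : HasDerivWithinAt a a' s x) (hax : a x = 0) (hc : ContinuousWithinAt c s x) :
    HasDerivWithinAt (fun y => a y * c y) (a' * c x) s x := by
  rw [hasDerivWithinAt_iff_tendsto_slope] at ha ⊢
  refine (ha.mul (hc.tendsto.mono_left (nhdsWithin_mono x sdiff_subset))).congr fun y => ?_
  simp only [slope_def_field, hax]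
  ring

/-- Existence for the system with zero initial data. -/
theorem exists_solution : ∃ w v : ℝ → ℝ → Fin n → ℝ,
    (∀ j, Continuous fun z : ℝ × ℝ => w z.1 z.2 j) ∧
    (∀ j, Continuous fun z : ℝ × ℝ => v z.1 z.2 j) ∧ (∀ x, w x D.τ = 0) ∧
    (∀ j x t, HasDerivAt (fun s => w x s j) (v x t j) t) ∧
    (∀ j, ∀ x ∈ Icc (0 : ℝ) 1, ∀ t ≥ D.τ, HasDerivWithinAt (fun y => w y t j)
      (D.rhs w j x t - D.q j x t * v x t j) (Icc 0 1) x) ∧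
    ∀ j t, w (D.e j) t j = ∑ k, D.p j k * w (1 - D.e k) t k := by
  obtain ⟨v, hv, hv0, hfix⟩ := D.exists_fixedPoint
  have hw0 : ∀ x t, t ≤ D.τ → D.prim v x t = 0 := fun x t ht => D.prim_of_le hv0 ht
  -- Both sides have time derivative `v` and vanish at `τ`.
  have hsolve : ∀ j, ∀ x ∈ Icc (0 : ℝ) 1, ∀ t, D.solve (D.prim v) j x t = D.prim v x t j := by
    intro j x hx t
    have hd : ∀ t, HasDerivAt (fun t => D.solve (D.prim v) j x t - D.prim v x t j) 0 t := by
      intro t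
      have := (D.hasDerivAt_solve hv j x t).sub (D.hasDerivAt_prim hv j x t)
      rwa [hfix j x hx t, sub_self] at this
    have h1 := is_const_of_deriv_eq_zero (fun t => (hd t).differentiableAt)
      (fun t => (hd t).deriv) t D.τ
    rw [D.solve_of_le hw0 j hx le_rfl, hw0 x D.τ le_rfl, Pi.zero_apply, sub_zero] at h1
    linarith
  refine ⟨D.prim v, v, D.continuous_prim hv, hv, fun x => hw0 x _ le_rfl,
    D.hasDerivAt_prim hv, fun j x hx t ht => ?_, fun j t => ?_⟩
  · set γ := D.T j x t with hγ
    have hγc : Continuous γ := (D.flow j).continuous_right x t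
    have hγx : γ x = t := (D.flow j).start x t
    have hcut : cutoff D.τ γ (fun ξ => D.rhs (D.prim v) j ξ (γ ξ)) =
        fun ξ => D.rhs (D.prim v) j ξ (max (γ ξ) D.τ) := by
      funext ξ
      rcases le_or_gt (γ ξ) D.τ with h | h
      · rw [cutoff_of_le h, max_eq_right h, D.rhs_start]
      · rw [cutoff_of_lt h, max_eq_left h.le]
    have hcont : Continuous fun ξ => D.rhs (D.prim v) j ξ (max (γ ξ) D.τ) :=
      (D.rhs_C1 hv j).cont.comp (continuous_id.prodMk (hγc.max continuous_const))
    have h1 : ∀ y ∈ Icc (0 : ℝ) 1, D.prim v y (γ y) j =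
        ∑ k, D.p j k * D.prim v (1 - D.e k) (γ (D.e j)) k +
          ∫ ξ in D.e j..y, D.rhs (D.prim v) j ξ (max (γ ξ) D.τ) := by
      intro y hy
      rw [← hsolve j y hy, solve, hγ, (D.flow j).comp (D.q_C1 j) (D.qt_le j) x t y, ← hγ, hcut]
    -- Along the characteristic through `(x, t)` the boundary contribution is constant and the
    -- fundamental theorem of calculus gives the derivative.
    have h2 : HasDerivWithinAt (fun y => D.prim v y (γ y) j) (D.rhs (D.prim v) j x t)
        (Icc 0 1) x := by
      have h3 := ((hcont.integral_hasStrictDerivAt (D.e j) x).hasDerivAt.const_add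
        (∑ k, D.p j k * D.prim v (1 - D.e k) (γ (D.e j)) k)).hasDerivWithinAt (s := Icc 0 1)
      rw [hγx, max_eq_left ht] at h3
      exact h3.congr h1 (h1 x hx)
    -- To return from the characteristic to the horizontal line at height `t`, the increment in time
    -- is written as `γ y - t`, which vanishes at `y = x`, times a continuous average of `v`.
    have h4 : ∀ y, D.prim v y (γ y) j - D.prim v y t j =
        (γ y - t) * ∫ θ in (0 : ℝ)..1, v y (t + (γ y - t) * θ) j := by
      intro y
      have hvy : Continuous fun s => v y s j :=
        (hv j).comp (by fun_prop : Continuous fun s : ℝ => (y, s))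
      rw [← smul_eq_mul,
        intervalIntegral.smul_integral_comp_add_mul (f := fun s => v y s j), prim, prim,
        intervalIntegral.integral_interval_sub_left (hvy.intervalIntegrable _ _)
          (hvy.intervalIntegrable _ _)]
      simp
    have h5 : HasDerivWithinAt (fun y => (γ y - t) * ∫ θ in (0 : ℝ)..1, v y (t + (γ y - t) * θ) j)
        (D.q j x t * v x t j) (Icc 0 1) x := by
      have hc : Continuous fun y => ∫ θ in (0 : ℝ)..1, v y (t + (γ y - t) * θ) j := by
        refine intervalIntegral.continuous_parametric_intervalIntegral_of_continuous'
          (f := fun y θ => v y (t + (γ y - t) * θ) j) ?_ 0 1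
        exact (hv j).comp (by fun_prop : Continuous fun z : ℝ × ℝ =>
          (z.1, t + (γ z.1 - t) * z.2))
      have h6 := hasDerivWithinAt_mul_of_eq_zero
        (((D.flow j).hasDerivAt x t x).sub_const t).hasDerivWithinAt
        (by simp [(D.flow j).start]) (hc.continuousWithinAt (s := Icc 0 1) (x := x))
      simpa [← hγ, hγx] using h6
    refine (h2.sub h5).congr (fun y _ => ?_) ?_
    · rw [Pi.sub_apply, ← h4]; ring
    · rw [Pi.sub_apply, ← h4]; ring
  · rw [← hsolve j _ (D.incoming j).mem t, solve, (D.flow j).start]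
    simp

end TransportSystem

end HypSys

namespace HypSys

open scoped NNReal BoundedContinuousFunction

/-! ### Classical solutions for test functions -/

/-- `f` is bounded and continuous, with bounded and continuous time derivative. -/
def IsTimeBC1 (f : ℝ → ℝ → ℝ) : Prop :=
  ∃ ft C, IsTimeC1 f ft ∧ (∀ x t, |f x t| ≤ C) ∧ ∀ x t, |ft x t| ≤ C

namespace IsTimeBC1

variable {f g : ℝ → ℝ → ℝ}

theorem add (hf : IsTimeBC1 f) (hg : IsTimeBC1 g) : IsTimeBC1 fun x t => f x t + g x t := by
  obtain ⟨ft, C, h1, h2, h3⟩ := hf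
  obtain ⟨gt, C', h1', h2', h3'⟩ := hg
  exact ⟨fun x t => ft x t + gt x t, C + C', ⟨h1.cont.add h1'.cont, h1.cont'.add h1'.cont',
    fun x t => (h1.hasDerivAt x t).add (h1'.hasDerivAt x t)⟩,
    fun x t => (abs_add_le _ _).trans (add_le_add (h2 x t) (h2' x t)),
    fun x t => (abs_add_le _ _).trans (add_le_add (h3 x t) (h3' x t))⟩

theorem neg (hf : IsTimeBC1 f) : IsTimeBC1 fun x t => -f x t := by
  obtain ⟨ft, C, h1, h2, h3⟩ := hf
  exact ⟨fun x t => -ft x t, C, ⟨h1.cont.neg, h1.cont'.neg, fun x t => (h1.hasDerivAt x t).neg⟩,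
    fun x t => by rw [abs_neg]; exact h2 x t, fun x t => by rw [abs_neg]; exact h3 x t⟩

theorem mul (hf : IsTimeBC1 f) (hg : IsTimeBC1 g) : IsTimeBC1 fun x t => f x t * g x t := by
  obtain ⟨ft, C, h1, h2, h3⟩ := hf
  obtain ⟨gt, C', h1', h2', h3'⟩ := hg
  have hC : 0 ≤ C := (abs_nonneg _).trans (h2 0 0)
  have hC' : 0 ≤ C' := (abs_nonneg _).trans (h2' 0 0)
  have hm : ∀ a b : ℝ, |a| ≤ C → |b| ≤ C' → |a * b| ≤ C * C' := fun a b ha hb => by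
    rw [abs_mul]; exact mul_le_mul ha hb (abs_nonneg _) hC
  refine ⟨fun x t => ft x t * g x t + f x t * gt x t, C * C' + C * C',
    ⟨h1.cont.mul h1'.cont, (h1.cont'.mul h1'.cont).add (h1.cont.mul h1'.cont'),
    fun x t => (h1.hasDerivAt x t).mul (h1'.hasDerivAt x t)⟩,
    fun x t => (hm _ _ (h2 x t) (h2' x t)).trans (by nlinarith),
    fun x t => (abs_add_le _ _).trans
      (add_le_add (hm _ _ (h3 x t) (h2' x t)) (hm _ _ (h2 x t) (h3' x t)))⟩

theorem inv (hf : IsTimeBC1 f) {c : ℝ} (hc : 0 < c) (h : ∀ x t, c ≤ |f x t|) :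
    IsTimeBC1 fun x t => (f x t)⁻¹ := by
  obtain ⟨ft, C, h1, h2, h3⟩ := hf
  have hne : ∀ x t, f x t ≠ 0 := fun x t => abs_pos.1 (hc.trans_le (h x t))
  have hC : 0 ≤ C := (abs_nonneg _).trans (h2 0 0)
  refine ⟨fun x t => -ft x t / f x t ^ 2, c⁻¹ + C / c ^ 2,
    ⟨h1.cont.inv₀ fun z => hne z.1 z.2, h1.cont'.neg.div (h1.cont.pow 2) fun z =>
      pow_ne_zero 2 (hne z.1 z.2), fun x t => (h1.hasDerivAt x t).inv (hne x t)⟩,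
    fun x t => ?_, fun x t => ?_⟩
  · rw [abs_inv]
    have := inv_anti₀ hc (h x t)
    have : 0 ≤ C / c ^ 2 := by positivity
    linarith
  · rw [abs_div, abs_neg, abs_pow]
    have : |ft x t| / |f x t| ^ 2 ≤ C / c ^ 2 :=
      div_le_div₀ hC (h3 x t) (by positivity) (pow_le_pow_left₀ hc.le (h x t) 2)
    have : 0 < c⁻¹ := inv_pos.2 hc
    linarith

theorem zero : IsTimeBC1 fun _ _ => 0 :=
  ⟨fun _ _ => 0, 0, ⟨continuous_const, continuous_const, fun _ t => hasDerivAt_const t _⟩,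
    by simp, by simp⟩

theorem sum {ι : Type*} (s : Finset ι) {F : ι → ℝ → ℝ → ℝ} (hF : ∀ i, IsTimeBC1 (F i)) :
    IsTimeBC1 fun x t => ∑ i ∈ s, F i x t := by
  classical
  induction s using Finset.induction_on with
  | empty => simpa using zero
  | insert i s hi ih => simpa only [Finset.sum_insert hi] using (hF i).add ih

theorem of_continuousOn {g : ℝ → ℝ} (hg : ContinuousOn g (Icc 0 1)) :
    IsTimeBC1 fun x _ => g (clamp x) := by
  obtain ⟨C, hC⟩ := isCompact_Icc.exists_bound_of_continuousOn hg
  have hc : Continuous fun x => g (clamp x) := hg.comp_continuous continuous_clamp clamp_mem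
  exact ⟨fun _ _ => 0, C, ⟨hc.comp continuous_fst, continuous_const,
    fun x t => hasDerivAt_const t _⟩, fun x _ => hC _ (clamp_mem x),
    fun x _ => by simpa using (norm_nonneg _).trans (hC _ (clamp_mem x))⟩

theorem sin (τ : ℝ) : IsTimeBC1 fun _ t => Real.sin (t - τ) :=
  ⟨fun _ t => Real.cos (t - τ), 1, ⟨by fun_prop, by fun_prop, fun _ t => by
    simpa using! ((hasDerivAt_id t).sub_const τ).sin⟩, fun _ _ => Real.abs_sin_le_one _,
    fun _ _ => Real.abs_cos_le_one _⟩

theorem cos (τ : ℝ) : IsTimeBC1 fun _ t => Real.cos (t - τ) :=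
  ⟨fun _ t => -Real.sin (t - τ), 1, ⟨by fun_prop, by fun_prop, fun _ t => by
    simpa using! ((hasDerivAt_id t).sub_const τ).cos⟩, fun _ _ => Real.abs_cos_le_one _,
    fun _ _ => by simpa using Real.abs_sin_le_one _⟩

end IsTimeBC1

theorem IsBC.continuous_clamp {f : ℝ → ℝ → ℝ} (hf : IsBC f) :
    Continuous fun z : ℝ × ℝ => f (clamp z.1) z.2 :=
  hf.continuousOn.comp_continuous
    ((HypSys.continuous_clamp.comp continuous_fst).prodMk continuous_snd)
    fun z => ⟨clamp_mem z.1, trivial⟩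

theorem IsBC.continuousOn_slice {f : ℝ → ℝ → ℝ} (hf : IsBC f) (t : ℝ) :
    ContinuousOn (fun x => f x t) (Icc 0 1) :=
  hf.continuousOn.comp (by fun_prop : ContinuousOn (fun x : ℝ => (x, t)) (Icc 0 1))
    fun _ hx => ⟨hx, trivial⟩

theorem IsBC1.isTimeBC1 {f : ℝ → ℝ → ℝ} (hf : IsBC1 f) : IsTimeBC1 fun x t => f (clamp x) t := by
  obtain ⟨ft, hft, hd⟩ := hf.deriv_t
  obtain ⟨C, hC⟩ := hf.isBC.bounded
  obtain ⟨C', hC'⟩ := hft.bounded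
  exact ⟨fun x t => ft (clamp x) t, max C C', ⟨hf.isBC.continuous_clamp, hft.continuous_clamp,
    fun x t => hd _ (clamp_mem x) t⟩, fun x t => (hC _ (clamp_mem x) t).trans (le_max_left _ _),
    fun x t => (hC' _ (clamp_mem x) t).trans (le_max_right _ _)⟩

theorem exists_le_of_finite {ι : Type*} [Finite ι] (C : ι → ℝ) : ∃ B, ∀ i, C i ≤ B := by
  obtain ⟨B, hB⟩ := (Set.finite_range C).bddAbove
  exact ⟨B, fun i => hB ⟨i, rfl⟩⟩

/-- Construction of a transport system from its coefficients. -/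
theorem exists_transportSystem {n : ℕ} {q h : Fin n → ℝ → ℝ → ℝ}
    {β : Fin n → Fin n → ℝ → ℝ → ℝ} (p : Fin n → Fin n → ℝ) {e : Fin n → ℝ} {τ κ : ℝ}
    (hκ : 0 < κ) (hq : ∀ j, IsTimeBC1 (q j)) (hh : ∀ j, IsTimeBC1 (h j))
    (hβ : ∀ j k, IsTimeBC1 (β j k)) (hτ : ∀ j x, h j x τ = 0)
    (he : ∀ j, IsIncoming (q j) κ (e j)) :
    ∃ D : TransportSystem n, D.q = q ∧ D.h = h ∧ D.β = β ∧ D.p = p ∧ D.e = e ∧ D.τ = τ := by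
  choose qt Cq hq1 hq2 hq3 using hq
  choose ht Ch hh1 hh2 hh3 using hh
  choose βt Cβ hβ1 hβ2 hβ3 using hβ
  obtain ⟨B₁, hB₁⟩ := exists_le_of_finite Cq
  obtain ⟨B₂, hB₂⟩ := exists_le_of_finite Ch
  obtain ⟨B₃, hB₃⟩ := exists_le_of_finite fun i : Fin n × Fin n => Cβ i.1 i.2
  choose T hT using fun j => (hq1 j).exists_flow (hq2 j) (hq3 j)
  have h1 : B₁ ≤ max B₁ (max B₂ B₃) := le_max_left _ _
  have h2 : B₂ ≤ max B₁ (max B₂ B₃) := (le_max_left _ _).trans (le_max_right _ _)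
  have h3 : B₃ ≤ max B₁ (max B₂ B₃) := (le_max_right _ _).trans (le_max_right _ _)
  exact ⟨{
    q := q, qt := qt, h := h, ht := ht, β := β, βt := βt, p := p, T := T, e := e, τ := τ, κ := κ
    C := max B₁ (max B₂ B₃)
    κ_pos := hκ
    q_C1 := hq1
    h_C1 := hh1
    β_C1 := hβ1
    q_le := fun j x t => (hq2 j x t).trans ((hB₁ j).trans h1)
    qt_le := fun j x t => (hq3 j x t).trans ((hB₁ j).trans h1)
    ht_le := fun j x t => (hh3 j x t).trans ((hB₂ j).trans h2)
    β_le := fun j k x t => (hβ2 j k x t).trans ((hB₃ (j, k)).trans h3)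
    βt_le := fun j k x t => (hβ3 j k x t).trans ((hB₃ (j, k)).trans h3)
    h_start := hτ
    flow := hT
    incoming := he }, rfl, rfl, rfl, rfl, rfl, rfl⟩

theorem IsTestFunction.eventuallyEq_zero {n : ℕ} {φ : ℝ → Fin n → ℝ} (hφ : IsTestFunction φ)
    {x : ℝ} (hx : x ∉ Ioo (0 : ℝ) 1) : φ =ᶠ[𝓝 x] 0 :=
  notMem_tsupport_iff_eventuallyEq.1 fun h => hx (hφ.tsupport_subset h)

/-- The function `φ + sin(t-τ) g` has the right value and time derivative at `τ`, so the remainder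
satisfies all compatibility conditions with zero data. The sine has value `0` and slope `1` at `τ`
like `t - τ`, but is bounded with bounded derivative. Since `φ` and `g` vanish at both ends, the
remainder inherits the boundary conditions. -/
theorem exists_isClassicalSolution {n m : ℕ} {a : Fin n → ℝ → ℝ → ℝ}
    {b : Fin n → Fin n → ℝ → ℝ → ℝ} (p : Fin n → Fin n → ℝ) (ha : ∀ j, IsBC1 (a j))
    (hb : ∀ i j, IsBC1 (b i j)) {Λ₀ : ℝ} (hΛ₀ : 0 < Λ₀)
    (hpos : ∀ j : Fin n, (j : ℕ) < m → ∀ x ∈ Icc (0 : ℝ) 1, ∀ t : ℝ, Λ₀ ≤ a j x t)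
    (hneg : ∀ j : Fin n, m ≤ (j : ℕ) → ∀ x ∈ Icc (0 : ℝ) 1, ∀ t : ℝ, a j x t ≤ -Λ₀)
    (τ : ℝ) {φ : ℝ → Fin n → ℝ} (hφ : IsTestFunction φ) :
    ∃ u, IsClassicalSolution m a b p τ φ u := by
  have hsm : ∀ j, ContDiff ℝ 2 fun y => φ y j := fun j =>
    contDiff_infty.1 (contDiff_pi.1 hφ.contDiff j) 2
  set φ₁ : Fin n → ℝ → ℝ := fun j => deriv fun y => φ y j with hφ₁
  set φ₂ : Fin n → ℝ → ℝ := fun j => deriv (φ₁ j) with hφ₂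
  have hc0 : ∀ j, Continuous fun y => φ y j := fun j => (hsm j).continuous
  have hsm1 : ∀ j, ContDiff ℝ 1 (φ₁ j) := fun j => by
    have := (contDiff_succ_iff_deriv (n := 1)).1 (by simpa using! hsm j)
    exact this.2.2
  have hc1 : ∀ j, Continuous (φ₁ j) := fun j => (hsm1 j).continuous
  have hc2 : ∀ j, Continuous (φ₂ j) := fun j => (hsm1 j).continuous_deriv le_rfl
  have hd0 : ∀ j x, HasDerivAt (fun y => φ y j) (φ₁ j x) x := fun j x =>
    ((hsm j).differentiable (by norm_num) x).hasDerivAt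
  have hd1 : ∀ j x, HasDerivAt (φ₁ j) (φ₂ j x) x := fun j x =>
    ((hsm1 j).differentiable (by norm_num) x).hasDerivAt
  choose ax hax haxd using fun j => (ha j).deriv_x
  choose bx hbx hbxd using fun i j => (hb i j).deriv_x
  set g : Fin n → ℝ → ℝ := fun j x => -(a j x τ * φ₁ j x + ∑ k, b j k x τ * φ x k) with hg
  set g' : Fin n → ℝ → ℝ := fun j x => -(ax j x τ * φ₁ j x + a j x τ * φ₂ j x +
    ∑ k, (bx j k x τ * φ x k + b j k x τ * φ₁ k x)) with hg'
  have hgd : ∀ j, ∀ x ∈ Icc (0 : ℝ) 1, HasDerivWithinAt (g j) (g' j x) (Icc 0 1) x :=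
    fun j x hx => (((haxd j x hx τ).mul (hd1 j x).hasDerivWithinAt).add
      (HasDerivWithinAt.fun_sum fun k _ =>
        (hbxd j k x hx τ).mul (hd0 k x).hasDerivWithinAt)).neg
  have hgc : ∀ j, ContinuousOn (g j) (Icc 0 1) := fun j x hx => (hgd j x hx).continuousWithinAt
  have hgc' : ∀ j, ContinuousOn (g' j) (Icc 0 1) := fun j =>
    ((((hax j).continuousOn_slice τ).mul (hc1 j).continuousOn).add
      (((ha j).isBC.continuousOn_slice τ).mul (hc2 j).continuousOn) |>.add
      (continuousOn_finsetSum _ fun k _ =>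
        (((hbx j k).continuousOn_slice τ).mul (hc0 k).continuousOn).add
          (((hb j k).isBC.continuousOn_slice τ).mul (hc1 k).continuousOn))).neg
  -- coefficients of the transport system
  set A : Fin n → ℝ → ℝ → ℝ := fun j x t => a j (clamp x) t with hA
  have hAlow : ∀ j x t, Λ₀ ≤ |A j x t| := by
    intro j x t
    rcases lt_or_ge (j : ℕ) m with h | h
    · exact (hpos j h _ (clamp_mem x) t).trans (le_abs_self _)
    · exact (le_neg.1 (hneg j h _ (clamp_mem x) t)).trans (neg_le_abs _)
  have hAne : ∀ j x t, A j x t ≠ 0 := fun j x t => abs_pos.1 (hΛ₀.trans_le (hAlow j x t))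
  have hAC : ∀ j, IsTimeBC1 (A j) := fun j => (ha j).isTimeBC1
  have hqC : ∀ j, IsTimeBC1 fun x t => (A j x t)⁻¹ := fun j => (hAC j).inv hΛ₀ (hAlow j)
  -- Minus the differential operator applied to `φ + sin(t-τ) g`; at `t = τ` it vanishes by the
  -- choice of `g`.
  set F : Fin n → ℝ → ℝ → ℝ := fun j x t => -(Real.cos (t - τ) * g j (clamp x) +
    A j x t * (φ₁ j (clamp x) + Real.sin (t - τ) * g' j (clamp x)) +
    ∑ k, b j k (clamp x) t * (φ (clamp x) k + Real.sin (t - τ) * g k (clamp x))) with hF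
  have hFC : ∀ j, IsTimeBC1 (F j) := fun j =>
    ((((IsTimeBC1.cos τ).mul (.of_continuousOn (hgc j))).add ((hAC j).mul
      ((IsTimeBC1.of_continuousOn (hc1 j).continuousOn).add
        ((IsTimeBC1.sin τ).mul (.of_continuousOn (hgc' j)))))).add
      (IsTimeBC1.sum _ fun k => (hb j k).isTimeBC1.mul
        ((IsTimeBC1.of_continuousOn (hc0 k).continuousOn).add
          ((IsTimeBC1.sin τ).mul (.of_continuousOn (hgc k)))))).neg
  have hFτ : ∀ j x, F j x τ = 0 := by
    intro j x
    simp [hF, hg, hA]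
  -- a bound from below for `1 / |a|`
  obtain ⟨B, hB⟩ : ∃ B, ∀ j x t, |A j x t| ≤ B := by
    choose At CA _ h2 _ using hAC
    obtain ⟨B, hB⟩ := exists_le_of_finite CA
    exact ⟨B, fun j x t => (h2 j x t).trans (hB j)⟩
  -- A lower bound for `1/|a_j|`, with `max` guarding against a nonpositive `B`.
  have hκ : 0 < (max B 1)⁻¹ := by positivity
  have hin : ∀ j : Fin n, IsIncoming (fun x t => (A j x t)⁻¹) (max B 1)⁻¹
      (if (j : ℕ) < m then 0 else 1) := by
    intro j
    have hB' : ∀ x t, |A j x t| ≤ max B 1 := fun x t => (hB j x t).trans (le_max_left _ _)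
    rcases lt_or_ge (j : ℕ) m with h | h
    · refine Or.inl ⟨if_pos h, fun x t => ?_⟩
      have h1 : 0 < A j x t := hΛ₀.trans_le (hpos j h _ (clamp_mem x) t)
      exact inv_anti₀ h1 ((le_abs_self _).trans (hB' x t))
    · refine Or.inr ⟨if_neg h.not_gt, fun x t => ?_⟩
      have h1 : 0 < -A j x t := hΛ₀.trans_le (le_neg.1 (hneg j h _ (clamp_mem x) t))
      have h2 := inv_anti₀ h1 ((neg_le_abs _).trans (hB' x t))
      rw [inv_neg] at h2
      linarith
  obtain ⟨D, hDq, hDh, hDβ, hDp, hDe, hDτ⟩ := exists_transportSystem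
    (q := fun j x t => (A j x t)⁻¹) (h := fun j x t => (A j x t)⁻¹ * F j x t)
    (β := fun j k x t => (A j x t)⁻¹ * b j k (clamp x) t) p hκ hqC
    (fun j => (hqC j).mul (hFC j)) (fun j k => (hqC j).mul (hb j k).isTimeBC1)
    (fun j x => by rw [hFτ, mul_zero]) hin
  obtain ⟨w, v, hw, hv, hw0, hwt, hwx, hwb⟩ := D.exists_solution
  rw [hDτ] at hw0 hwx
  have hgz : ∀ j, g j 0 = 0 ∧ g j 1 = 0 := by
    have : ∀ x, x ∉ Ioo (0 : ℝ) 1 → ∀ j, g j x = 0 := by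
      intro x hx j
      have h0 := hφ.eventuallyEq_zero hx
      have h1 : φ₁ j x = 0 := by
        have : (fun y => φ y j) =ᶠ[𝓝 x] fun _ => 0 := h0.mono fun y hy => congrFun hy j
        rw [hφ₁]
        simpa using this.deriv_eq
      simp [hg, h1, h0.eq_of_nhds]
    exact fun j => ⟨this 0 (by simp) j, this 1 (by simp) j⟩
  have hφz : φ 0 = 0 ∧ φ 1 = 0 :=
    ⟨(hφ.eventuallyEq_zero (by simp)).eq_of_nhds, (hφ.eventuallyEq_zero (by simp)).eq_of_nhds⟩
  have hgcl : ∀ j, Continuous fun z : ℝ × ℝ => g j (clamp z.1) := fun j =>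
    ((hgc j).comp_continuous continuous_clamp clamp_mem).comp continuous_fst
  have hgcl' : ∀ j, Continuous fun z : ℝ × ℝ => g' j (clamp z.1) := fun j =>
    ((hgc' j).comp_continuous continuous_clamp clamp_mem).comp continuous_fst
  have hrhs : ∀ j, Continuous fun z : ℝ × ℝ => D.rhs w j z.1 z.2 - D.q j z.1 z.2 * v z.1 z.2 j :=
    fun j => ((D.h_C1 j).cont.sub (continuous_finsetSum _ fun k _ =>
      (D.β_C1 j k).cont.mul (hw k))).sub ((D.q_C1 j).cont.mul (hv j))
  have hcl0 : clamp 0 = 0 := clamp_of_mem (by simp)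
  have hcl1 : clamp 1 = 1 := clamp_of_mem (by simp)
  refine ⟨fun x t j => φ x j + Real.sin (t - τ) * g j (clamp x) + w x t j, ?_,
    ⟨fun x t j => φ₁ j x + Real.sin (t - τ) * g' j (clamp x) +
      (D.rhs w j x t - D.q j x t * v x t j),
    fun x t j => Real.cos (t - τ) * g j (clamp x) + v x t j, ?_, ?_, ?_, ?_, ?_⟩, ?_, ?_⟩
  · refine (continuous_pi fun j => ?_).continuousOn
    have h1 := (hc0 j).comp (continuous_fst (X := ℝ) (Y := ℝ))
    have h2 := hgcl j
    have h3 := hw j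
    exact (h1.add (Continuous.mul (by fun_prop) h2)).add h3
  · refine (continuous_pi fun j => ?_).continuousOn
    have h1 := (hc1 j).comp (continuous_fst (X := ℝ) (Y := ℝ))
    exact (h1.add (Continuous.mul (by fun_prop) (hgcl' j))).add (hrhs j)
  · refine (continuous_pi fun j => ?_).continuousOn
    exact (Continuous.mul (by fun_prop) (hgcl j)).add (hv j)
  · intro x hx t ht j
    have h1 : HasDerivWithinAt (fun y => g j (clamp y)) (g' j (clamp x)) (Icc 0 1) x := by
      rw [clamp_of_mem hx]
      exact (hgd j x hx).congr (fun y hy => by rw [clamp_of_mem hy]) (by rw [clamp_of_mem hx])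
    exact ((hd0 j x).hasDerivWithinAt.add (h1.const_mul _)).add (hwx j x hx t ht)
  · intro x hx t ht j
    have h1 : HasDerivAt (fun s => Real.sin (s - τ)) (Real.cos (t - τ)) t := by
      simpa using! ((hasDerivAt_id t).sub_const τ).sin
    exact (((h1.mul_const _).const_add _).add (hwt j x t)).hasDerivWithinAt
  · intro x hx t ht j
    have hcl : clamp x = x := clamp_of_mem (Ioo_subset_Icc_self hx)
    have hane : a j x t ≠ 0 := by simpa only [hA, hcl] using hAne j x t
    simp only [TransportSystem.rhs, hDq, hDh, hDβ, hF, hA, hcl]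
    have hs : ∑ k, (a j x t)⁻¹ * b j k x t * w x t k =
        (a j x t)⁻¹ * ∑ k, b j k x t * w x t k := by
      rw [Finset.mul_sum]; exact Finset.sum_congr rfl fun k _ => by ring
    have hs2 : ∑ k, b j k x t * (φ x k + Real.sin (t - τ) * g k x + w x t k) =
        ∑ k, b j k x t * (φ x k + Real.sin (t - τ) * g k x) + ∑ k, b j k x t * w x t k := by
      rw [← Finset.sum_add_distrib]; exact Finset.sum_congr rfl fun k _ => by ring
    rw [hs, hs2]
    field_simp
    ring
  · intro t ht j
    have hwb' := hwb j t
    simp only [hDe, hDp] at hwb'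
    have hend : ∀ k : Fin n, ∀ x, x = 0 ∨ x = 1 →
        φ x k + Real.sin (t - τ) * g k (clamp x) + w x t k = w x t k := by
      rintro k x (rfl | rfl)
      · simp [hcl0, hφz.1, (hgz k).1]
      · simp [hcl1, hφz.2, (hgz k).2]
    simp only [reflection]
    rw [hend j _ (by split_ifs <;> simp), hwb']
    refine Finset.sum_congr rfl fun k _ => ?_
    rw [hend k 1 (Or.inr rfl), hend k 0 (Or.inl rfl)]
    split_ifs <;> simp
  · intro x hx
    funext j
    simp [hw0]

end HypSys

namespace HypSys

/-! ### Energy estimate -/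

/-- `u` is continuously differentiable on `[0,1] × [τ,∞)`, satisfies the boundary conditions, and
satisfies the system up to an error of at most `F`. -/
structure HasResidual {n : ℕ} (m : ℕ) (a : Fin n → ℝ → ℝ → ℝ) (b : Fin n → Fin n → ℝ → ℝ → ℝ)
    (p : Fin n → Fin n → ℝ) (τ F : ℝ) (u : ℝ → ℝ → Fin n → ℝ) : Prop where
  continuousOn : ContinuousOn (fun q : ℝ × ℝ => u q.1 q.2) (Icc 0 1 ×ˢ Ici τ)
  system : ∃ ux ut : ℝ → ℝ → Fin n → ℝ,
    ContinuousOn (fun q : ℝ × ℝ => ux q.1 q.2) (Icc 0 1 ×ˢ Ici τ) ∧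
    ContinuousOn (fun q : ℝ × ℝ => ut q.1 q.2) (Icc 0 1 ×ˢ Ici τ) ∧
    (∀ x ∈ Icc (0 : ℝ) 1, ∀ t ∈ Ici τ, ∀ j,
      HasDerivWithinAt (fun y => u y t j) (ux x t j) (Icc 0 1) x) ∧
    (∀ x ∈ Icc (0 : ℝ) 1, ∀ t ∈ Ici τ, ∀ j,
      HasDerivWithinAt (fun s => u x s j) (ut x t j) (Ici τ) t) ∧
    ∀ x ∈ Ioo (0 : ℝ) 1, ∀ t ∈ Ioi τ, ∀ j,
      |ut x t j + a j x t * ux x t j + ∑ k, b j k x t * u x t k| ≤ F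
  boundary : ∀ t ∈ Ici τ, ∀ j : Fin n,
    u (if (j : ℕ) < m then 0 else 1) t j = reflection m p (fun x => u x t) j

/-- The weight of the `j`-th component in the energy. -/
def energyWeight {n : ℕ} (m : ℕ) (δ : ℝ) (j : Fin n) (x : ℝ) : ℝ :=
  if (j : ℕ) < m then δ + (1 - δ) * x else 1 - (1 - δ) * x

/-- The derivative of `energyWeight`. -/
def energySlope {n : ℕ} (m : ℕ) (δ : ℝ) (j : Fin n) : ℝ :=
  if (j : ℕ) < m then 1 - δ else -(1 - δ)

section Weight

variable {n m : ℕ} {δ : ℝ} {j : Fin n}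

theorem hasDerivAt_energyWeight (x : ℝ) :
    HasDerivAt (energyWeight m δ j) (energySlope m δ j) x := by
  unfold energyWeight energySlope
  split_ifs
  · simpa using! ((hasDerivAt_id x).const_mul (1 - δ)).const_add δ
  · simpa using! ((hasDerivAt_id x).const_mul (1 - δ)).const_sub 1

theorem continuous_energyWeight : Continuous (energyWeight m δ j) :=
  continuous_iff_continuousAt.2 fun x => (hasDerivAt_energyWeight x).continuousAt

theorem energyWeight_le (hδ1 : δ ≤ 1) {x : ℝ} (hx : x ∈ Icc (0 : ℝ) 1) :
    energyWeight m δ j x ≤ 1 := by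
  unfold energyWeight
  split_ifs <;> nlinarith [hx.1, hx.2]

theorem le_energyWeight (hδ1 : δ ≤ 1) {x : ℝ} (hx : x ∈ Icc (0 : ℝ) 1) :
    δ ≤ energyWeight m δ j x := by
  unfold energyWeight
  split_ifs <;> nlinarith [hx.1, hx.2]

theorem abs_energySlope_le (hδ : 0 < δ) (hδ1 : δ ≤ 1) : |energySlope m δ j| ≤ 1 := by
  unfold energySlope
  split_ifs
  · rw [abs_le]; constructor <;> linarith
  · rw [abs_le]; constructor <;> linarith

end Weight

/-- The energy flux through the boundary is directed outwards if the weights are small enough at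
the incoming ends. -/
theorem boundary_flux_nonneg {n m : ℕ} {p : Fin n → Fin n → ℝ} {α₀ α₁ : Fin n → ℝ} {Λ B δ : ℝ}
    (hpos : ∀ j : Fin n, (j : ℕ) < m → Λ ≤ α₁ j ∧ α₀ j ≤ B)
    (hneg : ∀ j : Fin n, m ≤ (j : ℕ) → α₀ j ≤ -Λ ∧ -B ≤ α₁ j) (hδ : 0 < δ) (hB : 0 ≤ B)
    (hδB : δ * B * ∑ j, ∑ k, p j k ^ 2 ≤ Λ) {v : ℝ → Fin n → ℝ}
    (hv : ∀ j : Fin n, v (if (j : ℕ) < m then 0 else 1) j = reflection m p v j) :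
    0 ≤ ∑ j, energyWeight m δ j 1 * α₁ j * v 1 j ^ 2 -
      ∑ j, energyWeight m δ j 0 * α₀ j * v 0 j ^ 2 := by
  set o : Fin n → ℝ := fun k => if (k : ℕ) < m then v 1 k else v 0 k with ho
  -- The exit end has weight `1` and supplies at least `Λ o_j²`. The entry end has weight `δ` and
  -- costs at most `δB` times the squared reflection, which Cauchy–Schwarz bounds by the outgoing
  -- values.
  have h1 : ∀ j, Λ * o j ^ 2 - δ * B * ((∑ k, p j k ^ 2) * ∑ k, o k ^ 2) ≤
      energyWeight m δ j 1 * α₁ j * v 1 j ^ 2 - energyWeight m δ j 0 * α₀ j * v 0 j ^ 2 := by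
    intro j
    have h2 : (reflection m p v j) ^ 2 ≤ (∑ k, p j k ^ 2) * ∑ k, o k ^ 2 :=
      Finset.sum_mul_sq_le_sq_mul_sq _ _ _
    have h3 := mul_le_mul_of_nonneg_left h2 (mul_nonneg hδ.le hB)
    have hvj := hv j
    rcases lt_or_ge (j : ℕ) m with h | h
    · obtain ⟨h4, h5⟩ := hpos j h
      simp only [if_pos h] at hvj
      simp only [energyWeight, ho, if_pos h]
      rw [← hvj] at h3
      have h6 := mul_le_mul_of_nonneg_right h4 (sq_nonneg (v 1 j))
      have h7 := mul_le_mul_of_nonneg_right h5 (mul_nonneg hδ.le (sq_nonneg (v 0 j)))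
      linarith
    · obtain ⟨h4, h5⟩ := hneg j h
      simp only [if_neg h.not_gt] at hvj
      simp only [energyWeight, ho, if_neg h.not_gt]
      rw [← hvj] at h3
      have h6 := mul_le_mul_of_nonneg_right h4 (sq_nonneg (v 0 j))
      have h7 := mul_le_mul_of_nonneg_right h5 (mul_nonneg hδ.le (sq_nonneg (v 1 j)))
      linarith
  have h8 := Finset.sum_le_sum fun j (_ : j ∈ Finset.univ) => h1 j
  rw [Finset.sum_sub_distrib, Finset.sum_sub_distrib, ← Finset.mul_sum, ← Finset.mul_sum,
    ← Finset.sum_mul] at h8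
  refine le_trans ?_ h8
  have h9 : 0 ≤ ∑ k, o k ^ 2 := Finset.sum_nonneg fun k _ => sq_nonneg _
  have h10 := mul_le_mul_of_nonneg_right hδB h9
  linarith

/-- Pointwise form of the energy inequality. -/
theorem energy_density_le {n : ℕ} {ρ s a ax u ux ut : Fin n → ℝ} {b : Fin n → Fin n → ℝ}
    {B F : ℝ} (hρ : ∀ j, ρ j ∈ Icc (0 : ℝ) 1) (hs : ∀ j, |s j| ≤ 1) (ha : ∀ j, |a j| ≤ B)
    (hax : ∀ j, |ax j| ≤ B) (hb : ∀ j k, |b j k| ≤ B)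
    (hf : ∀ j, |ut j + a j * ux j + ∑ k, b j k * u k| ≤ F) :
    ∑ j, ρ j * (2 * u j * ut j) ≤
      (2 * B + 2 * n * B + 1) * ∑ j, u j ^ 2 + n * F ^ 2 -
      ∑ j, ((s j * a j + ρ j * ax j) * u j ^ 2 + ρ j * a j * (2 * u j * ux j)) := by
  -- When `s` and `ax` are the slopes of `ρ` and `a`, the subtracted bracket is the `x`-derivative
  -- of the flux `ρ a u²`. Substituting the equation for `ut` cancels all terms with `ux`.
  have h1 : ∀ j, ρ j * (2 * u j * ut j) ≤ (2 * B + 1) * u j ^ 2 + F ^ 2 +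
      ∑ k, B * (u j ^ 2 + u k ^ 2) -
      ((s j * a j + ρ j * ax j) * u j ^ 2 + ρ j * a j * (2 * u j * ux j)) := by
    intro j
    obtain ⟨h0, h01⟩ := hρ j
    have hB : 0 ≤ B := (abs_nonneg _).trans (ha j)
    set f := ut j + a j * ux j + ∑ k, b j k * u k with hf'
    have hfj := hf j
    rw [← hf'] at hfj
    have hut : ut j = f - a j * ux j - ∑ k, b j k * u k := by rw [hf']; ring
    have h2 : ρ j * (2 * u j * f) ≤ u j ^ 2 + F ^ 2 := by
      have h3 : 2 * u j * f ≤ u j ^ 2 + f ^ 2 := by nlinarith [sq_nonneg (u j - f)]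
      have h4 : f ^ 2 ≤ F ^ 2 := sq_le_sq' (abs_le.1 hfj).1 (abs_le.1 hfj).2
      have h5 : 0 ≤ u j ^ 2 + F ^ 2 := by positivity
      nlinarith
    have h6 : -(ρ j * (2 * u j * ∑ k, b j k * u k)) ≤ ∑ k, B * (u j ^ 2 + u k ^ 2) := by
      rw [Finset.mul_sum, Finset.mul_sum, ← Finset.sum_neg_distrib]
      refine Finset.sum_le_sum fun k _ => ?_
      have h7 : |ρ j * b j k| ≤ B := by
        rw [abs_mul, abs_of_nonneg h0]
        exact (mul_le_mul h01 (hb j k) (abs_nonneg _) zero_le_one).trans (by simp)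
      have h8 : |2 * u j * u k| ≤ u j ^ 2 + u k ^ 2 := by
        rw [abs_le]
        constructor <;> nlinarith [sq_nonneg (u j - u k), sq_nonneg (u j + u k)]
      have h9 := mul_le_mul h7 h8 (abs_nonneg _) hB
      rw [← abs_mul] at h9
      have h10 := (neg_le_abs _).trans h9
      linarith
    have h11 : |s j * a j + ρ j * ax j| ≤ 2 * B := by
      refine (abs_add_le _ _).trans ?_
      rw [abs_mul, abs_mul, abs_of_nonneg h0]
      have h12 := mul_le_mul (hs j) (ha j) (abs_nonneg _) zero_le_one
      have h13 := mul_le_mul h01 (hax j) (abs_nonneg _) zero_le_one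
      linarith
    have h14 := mul_le_mul_of_nonneg_right (le_abs_self _ |>.trans h11) (sq_nonneg (u j))
    rw [hut]
    linarith
  refine (Finset.sum_le_sum fun j _ => h1 j).trans (le_of_eq ?_)
  simp only [Finset.sum_sub_distrib, Finset.sum_add_distrib, ← Finset.mul_sum, Finset.sum_const,
    Finset.card_univ, Fintype.card_fin, nsmul_eq_mul]
  ring

/-- The function `(E + G/C) exp(-C(t-τ))` is nonincreasing. Continuity suffices at `τ`, where the
system itself is not imposed. -/
theorem gronwall_energy {E E' : ℝ → ℝ} {τ C G : ℝ} (hC : 0 < C) (hE : ContinuousOn E (Ici τ))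
    (hE' : ∀ t > τ, HasDerivAt E (E' t) t) (hle : ∀ t > τ, E' t ≤ C * E t + G) {t : ℝ}
    (ht : τ ≤ t) :
    E t ≤ Real.exp (C * (t - τ)) * E τ + G / C * (Real.exp (C * (t - τ)) - 1) := by
  have hd : ∀ t > τ, HasDerivAt (fun t => (E t + G / C) * Real.exp (-(C * (t - τ))))
      ((E' t - (C * E t + G)) * Real.exp (-(C * (t - τ)))) t := by
    intro t ht
    have h1 : HasDerivAt (fun t => Real.exp (-(C * (t - τ))))
        (Real.exp (-(C * (t - τ))) * -C) t := by
      simpa using! (((hasDerivAt_id t).sub_const τ).const_mul C).neg.exp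
    refine (((hE' t ht).add_const (G / C)).mul h1).congr_deriv ?_
    field_simp
    ring
  have hanti : AntitoneOn (fun t => (E t + G / C) * Real.exp (-(C * (t - τ)))) (Ici τ) := by
    refine antitoneOn_of_deriv_nonpos (convex_Ici τ) ?_ ?_ ?_
    · exact (hE.add continuousOn_const).mul (by fun_prop)
    · intro t ht
      rw [interior_Ici] at ht
      exact (hd t ht).differentiableAt.differentiableWithinAt
    · intro t ht
      rw [interior_Ici] at ht
      rw [(hd t ht).deriv]
      exact mul_nonpos_of_nonpos_of_nonneg (by linarith [hle t ht]) (Real.exp_pos _).le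
  have h2 := hanti self_mem_Ici ht ht
  simp only [sub_self, mul_zero, neg_zero, Real.exp_zero, mul_one] at h2
  rw [Real.exp_neg, ← div_eq_mul_inv, div_le_iff₀ (Real.exp_pos _)] at h2
  linarith

/-- Extending constantly across the edges of the half strip gives a continuous function on the
plane, to which results on parameter integrals apply. -/
theorem continuous_extend {n : ℕ} {u : ℝ → ℝ → Fin n → ℝ} {τ : ℝ}
    (hu : ContinuousOn (fun q : ℝ × ℝ => u q.1 q.2) (Icc 0 1 ×ˢ Ici τ)) (j : Fin n) :
    Continuous fun z : ℝ × ℝ => u (clamp z.1) (max z.2 τ) j :=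
  (continuous_apply j).comp (hu.comp_continuous
    (f := fun z : ℝ × ℝ => (clamp z.1, max z.2 τ))
    ((continuous_clamp.comp continuous_fst).prodMk (continuous_snd.max continuous_const))
    fun z => ⟨clamp_mem z.1, mem_Ici.2 (le_max_right _ _)⟩)

theorem continuousOn_slice {n : ℕ} {u : ℝ → ℝ → Fin n → ℝ} {τ t : ℝ}
    (hu : ContinuousOn (fun q : ℝ × ℝ => u q.1 q.2) (Icc 0 1 ×ˢ Ici τ)) (ht : τ ≤ t)
    (j : Fin n) : ContinuousOn (fun x => u x t j) (Icc 0 1) :=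
  (continuous_apply j).comp_continuousOn (hu.comp
    (by fun_prop : ContinuousOn (fun x : ℝ => (x, t)) (Icc 0 1)) fun _ hx => ⟨hx, ht⟩)

/-- The energy of the profile `v`. -/
def energy {n : ℕ} (m : ℕ) (δ : ℝ) (v : ℝ → Fin n → ℝ) : ℝ :=
  ∫ x in (0 : ℝ)..1, ∑ j, energyWeight m δ j x * v x j ^ 2

theorem energy_congr {n m : ℕ} {δ : ℝ} {v v' : ℝ → Fin n → ℝ}
    (h : ∀ x ∈ Icc (0 : ℝ) 1, v x = v' x) : energy m δ v = energy m δ v' := by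
  refine intervalIntegral.integral_congr fun x hx => ?_
  rw [uIcc_of_le zero_le_one] at hx
  simp only [h x hx]

theorem continuousOn_energy {n m : ℕ} {δ τ : ℝ} {u : ℝ → ℝ → Fin n → ℝ}
    (hu : ContinuousOn (fun q : ℝ × ℝ => u q.1 q.2) (Icc 0 1 ×ˢ Ici τ)) :
    ContinuousOn (fun t => energy m δ fun x => u x t) (Ici τ) := by
  have h1 : Continuous fun t => energy m δ fun x => u (clamp x) (max t τ) := by
    refine intervalIntegral.continuous_parametric_intervalIntegral_of_continuous'
      (f := fun t x => ∑ j, energyWeight m δ j x * u (clamp x) (max t τ) j ^ 2) ?_ 0 1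
    refine continuous_finsetSum _ fun j _ =>
      (continuous_energyWeight.comp continuous_snd).mul (Continuous.pow ?_ 2)
    exact (continuous_extend hu j).comp continuous_swap
  refine h1.continuousOn.congr fun t ht => ?_
  refine energy_congr fun x hx => ?_
  rw [clamp_of_mem hx, max_eq_left ht]

theorem hasDerivAt_energy {n m : ℕ} {δ τ : ℝ} {u ut : ℝ → ℝ → Fin n → ℝ}
    (hu : ContinuousOn (fun q : ℝ × ℝ => u q.1 q.2) (Icc 0 1 ×ˢ Ici τ))
    (hut : ContinuousOn (fun q : ℝ × ℝ => ut q.1 q.2) (Icc 0 1 ×ˢ Ici τ))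
    (hd : ∀ x ∈ Icc (0 : ℝ) 1, ∀ t ∈ Ici τ, ∀ j,
      HasDerivWithinAt (fun s => u x s j) (ut x t j) (Ici τ) t) {t : ℝ} (ht : τ < t) :
    HasDerivAt (fun t => energy m δ fun x => u x t)
      (∫ x in (0 : ℝ)..1, ∑ j, energyWeight m δ j x * (2 * u x t j * ut x t j)) t := by
  have hcu := fun j => (continuous_extend hu j).comp (continuous_swap (X := ℝ) (Y := ℝ))
  have hcut := fun j => (continuous_extend hut j).comp (continuous_swap (X := ℝ) (Y := ℝ))
  have hcF : Continuous fun z : ℝ × ℝ => ∑ j, energyWeight m δ j z.2 *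
      u (clamp z.2) (max z.1 τ) j ^ 2 :=
    continuous_finsetSum _ fun j _ =>
      (continuous_energyWeight.comp continuous_snd).mul ((hcu j).pow 2)
  have hcF' : Continuous fun z : ℝ × ℝ => ∑ j, energyWeight m δ j z.2 *
      (2 * u (clamp z.2) (max z.1 τ) j * ut (clamp z.2) (max z.1 τ) j) :=
    continuous_finsetSum _ fun j _ => (continuous_energyWeight.comp continuous_snd).mul
      ((continuous_const.mul (hcu j)).mul (hcut j))
  have hsl : ∀ s : ℝ, Continuous fun x : ℝ => (s, x) := fun s => by fun_prop
  obtain ⟨C, s, hs, hC⟩ := exists_bound_near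
    (g := fun s x => ∑ j, energyWeight m δ j x *
      (2 * u (clamp x) (max s τ) j * ut (clamp x) (max s τ) j)) hcF' t 0 1
  have h1 := (intervalIntegral.hasDerivAt_integral_of_dominated_loc_of_deriv_le
    (F := fun s x => ∑ j, energyWeight m δ j x * u (clamp x) (max s τ) j ^ 2)
    (F' := fun s x => ∑ j, energyWeight m δ j x *
      (2 * u (clamp x) (max s τ) j * ut (clamp x) (max s τ) j))
    (bound := fun _ => C) (a := 0) (b := 1) (μ := volume)
    (inter_mem hs (Ioi_mem_nhds ht))
    (Eventually.of_forall fun s => (hcF.comp (hsl s)).aestronglyMeasurable)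
    ((hcF.comp (hsl t)).intervalIntegrable 0 1) (hcF'.comp (hsl t)).aestronglyMeasurable
    (Eventually.of_forall fun x hx r hr => ?_) (by simp)
    (Eventually.of_forall fun x _ r hr => ?_)).2
  · refine (h1.congr_of_eventuallyEq ?_).congr_deriv ?_
    · filter_upwards [Ioi_mem_nhds ht] with r hr
      refine energy_congr fun x hx => ?_
      rw [clamp_of_mem hx, max_eq_left (le_of_lt hr)]
    · refine intervalIntegral.integral_congr fun x hx => ?_
      rw [uIcc_of_le zero_le_one] at hx
      simp only [clamp_of_mem hx, max_eq_left ht.le]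
  · rw [uIoc_of_le zero_le_one] at hx
    exact hC r hr.1 x (Ioc_subset_Icc_self hx)
  · refine HasDerivAt.fun_sum fun j _ => ?_
    have hr' : τ < r := hr.2
    have h2 : HasDerivAt (fun s => u (clamp x) (max s τ) j) (ut (clamp x) (max r τ) j) r := by
      rw [max_eq_left hr'.le]
      refine ((hd _ (clamp_mem x) r hr'.le j).hasDerivAt (Ici_mem_nhds hr')).congr_of_eventuallyEq
        ?_
      filter_upwards [Ioi_mem_nhds hr'] with s hs
      rw [max_eq_left (le_of_lt hs)]
    simpa using! (h2.pow 2).const_mul (energyWeight m δ j x)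

/-- **Energy estimate**, with constants that do not depend on the initial time. -/
theorem exists_energy_estimate {n m : ℕ} {a : Fin n → ℝ → ℝ → ℝ}
    {b : Fin n → Fin n → ℝ → ℝ → ℝ} (p : Fin n → Fin n → ℝ) (ha : ∀ j, IsBC1 (a j))
    (hb : ∀ i j, IsBC1 (b i j)) {Λ₀ : ℝ} (hΛ₀ : 0 < Λ₀)
    (hpos : ∀ j : Fin n, (j : ℕ) < m → ∀ x ∈ Icc (0 : ℝ) 1, ∀ t : ℝ, Λ₀ ≤ a j x t)
    (hneg : ∀ j : Fin n, m ≤ (j : ℕ) → ∀ x ∈ Icc (0 : ℝ) 1, ∀ t : ℝ, a j x t ≤ -Λ₀) :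
    ∃ δ C : ℝ, 0 < δ ∧ δ ≤ 1 ∧ 0 < C ∧ ∀ (τ F : ℝ) (u : ℝ → ℝ → Fin n → ℝ),
      HasResidual m a b p τ F u → ∀ t ≥ τ, energy m δ (fun x => u x t) ≤
        Real.exp (C * (t - τ)) * energy m δ (fun x => u x τ) +
          n * F ^ 2 / C * (Real.exp (C * (t - τ)) - 1) := by
  choose ax hax haxd using fun j => (ha j).deriv_x
  choose B₁ hB₁ using fun j => (ha j).isBC.bounded
  choose B₂ hB₂ using fun j => (hax j).bounded
  choose B₃ hB₃ using fun i j => (hb i j).isBC.bounded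
  obtain ⟨B, hB0, haB, haxB, hbB⟩ : ∃ B, 0 ≤ B ∧
      (∀ j, ∀ x ∈ Icc (0 : ℝ) 1, ∀ t, |a j x t| ≤ B) ∧
      (∀ j, ∀ x ∈ Icc (0 : ℝ) 1, ∀ t, |ax j x t| ≤ B) ∧
      ∀ i j, ∀ x ∈ Icc (0 : ℝ) 1, ∀ t, |b i j x t| ≤ B := by
    obtain ⟨C₁, h₁⟩ := exists_le_of_finite B₁
    obtain ⟨C₂, h₂⟩ := exists_le_of_finite B₂
    obtain ⟨C₃, h₃⟩ := exists_le_of_finite fun i : Fin n × Fin n => B₃ i.1 i.2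
    refine ⟨max (max C₁ C₂) (max C₃ 0), by simp, fun j x hx t => (hB₁ j x hx t).trans ?_,
      fun j x hx t => (hB₂ j x hx t).trans ?_, fun i j x hx t => (hB₃ i j x hx t).trans ?_⟩
    · exact (h₁ j).trans (by simp)
    · exact (h₂ j).trans (by simp)
    · exact (h₃ (i, j)).trans (by simp)
  set Pp := ∑ j, ∑ k, p j k ^ 2 with hPp
  have hPp0 : 0 ≤ Pp := Finset.sum_nonneg fun j _ => Finset.sum_nonneg fun k _ => sq_nonneg _
  have hden : 0 < Λ₀ + B * Pp := by positivity
  -- Chosen to give both `δ ≤ 1` and the flux condition `δ B Pp ≤ Λ₀`.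
  set δ := Λ₀ / (Λ₀ + B * Pp) with hδdef
  have hδ : 0 < δ := by positivity
  have hδ1 : δ ≤ 1 := (div_le_one hden).2 (by have := mul_nonneg hB0 hPp0; linarith)
  have hδB : δ * B * Pp ≤ Λ₀ := by
    rw [hδdef, div_mul_eq_mul_div, div_mul_eq_mul_div, div_le_iff₀ hden]
    nlinarith [sq_nonneg Λ₀]
  set C₀ := 2 * B + 2 * n * B + 1 with hC₀
  have hC₀p : 0 < C₀ := by positivity
  -- The division by `δ` pays for bounding the unweighted sum `∑ u_j²` by the energy density.
  refine ⟨δ, C₀ / δ, hδ, hδ1, by positivity, fun τ F u hu t ht => ?_⟩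
  obtain ⟨ux, ut, huxc, hutc, huxd, hutd, hpde⟩ := hu.system
  refine gronwall_energy (by positivity) (continuousOn_energy hu.continuousOn)
    (fun t ht => hasDerivAt_energy hu.continuousOn hutc hutd ht) (fun t ht => ?_) ht
  have ht' : τ ≤ t := le_of_lt ht
  -- `Ψ` is the energy flux: the integral of `Ψ'` is `Ψ 1 - Ψ 0 ≥ 0` and enters with a minus sign.
  set Ψ : ℝ → ℝ := fun x => ∑ j, energyWeight m δ j x * a j x t * u x t j ^ 2 with hΨ
  set Ψ' : ℝ → ℝ := fun x => ∑ j, ((energySlope m δ j * a j x t +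
    energyWeight m δ j x * ax j x t) * u x t j ^ 2 +
      energyWeight m δ j x * a j x t * (2 * u x t j * ux x t j)) with hΨ'
  have hcu := fun j => continuousOn_slice hu.continuousOn ht' j
  have hcux := fun j => continuousOn_slice huxc ht' j
  have hcut := fun j => continuousOn_slice hutc ht' j
  have hca := fun j => (ha j).isBC.continuousOn_slice t
  have hcax := fun j => (hax j).continuousOn_slice t
  have hcρ : ∀ j : Fin n, ContinuousOn (energyWeight m δ j) (Icc 0 1) := fun j =>
    continuous_energyWeight.continuousOn
  have hΨc : ContinuousOn Ψ (Icc 0 1) := continuousOn_finsetSum _ fun j _ =>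
    ((hcρ j).mul (hca j)).mul ((hcu j).pow 2)
  have hΨc' : ContinuousOn Ψ' (Icc 0 1) := continuousOn_finsetSum _ fun j _ =>
    (((continuousOn_const.mul (hca j)).add ((hcρ j).mul (hcax j))).mul ((hcu j).pow 2)).add
      (((hcρ j).mul (hca j)).mul ((continuousOn_const.mul (hcu j)).mul (hcux j)))
  have hΨd : ∀ x ∈ Ioo (0 : ℝ) 1, HasDerivAt Ψ (Ψ' x) x := by
    intro x hx
    refine HasDerivAt.fun_sum fun j _ => ?_
    have hn : Icc (0 : ℝ) 1 ∈ 𝓝 x := Icc_mem_nhds hx.1 hx.2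
    have h1 := (haxd j x (Ioo_subset_Icc_self hx) t).hasDerivAt hn
    have h2 := (huxd x (Ioo_subset_Icc_self hx) t ht' j).hasDerivAt hn
    simpa using! ((hasDerivAt_energyWeight x).mul h1).mul (h2.pow 2)
  have hintble : ∀ {f : ℝ → ℝ}, ContinuousOn f (Icc 0 1) → IntervalIntegrable f volume 0 1 :=
    fun hf => ContinuousOn.intervalIntegrable (by rwa [uIcc_of_le zero_le_one])
  have hΨi := intervalIntegral.integral_eq_sub_of_hasDerivAt_of_le zero_le_one hΨc hΨd (hintble hΨc')
  have hflux : 0 ≤ Ψ 1 - Ψ 0 := by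
    refine boundary_flux_nonneg (Λ := Λ₀) (B := B) (p := p) (v := fun x => u x t)
      (fun j h => ⟨hpos j h 1 (by simp) t, (le_abs_self _).trans (haB j 0 (by simp) t)⟩)
      (fun j h => ⟨hneg j h 0 (by simp) t, (abs_le.1 (haB j 1 (by simp) t)).1⟩) hδ hB0 hδB
      (hu.boundary t ht')
  have hce : ContinuousOn (fun x => ∑ j, energyWeight m δ j x * u x t j ^ 2) (Icc 0 1) :=
    continuousOn_finsetSum _ fun j _ => (hcρ j).mul ((hcu j).pow 2)
  calc ∫ x in (0 : ℝ)..1, ∑ j, energyWeight m δ j x * (2 * u x t j * ut x t j)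
      ≤ ∫ x in (0 : ℝ)..1, (C₀ / δ * (∑ j, energyWeight m δ j x * u x t j ^ 2) + n * F ^ 2 -
          Ψ' x) := by
        refine intervalIntegral.integral_mono_on_of_le_Ioo zero_le_one
          (hintble (continuousOn_finsetSum _ fun j _ => (hcρ j).mul
            ((continuousOn_const.mul (hcu j)).mul (hcut j))))
          (hintble (((continuousOn_const.mul hce).add continuousOn_const).sub hΨc')) fun x hx => ?_
        have hx' := Ioo_subset_Icc_self hx
        have h1 := energy_density_le (ρ := fun j => energyWeight m δ j x)
          (s := fun j => energySlope m δ j) (a := fun j => a j x t) (ax := fun j => ax j x t)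
          (u := u x t) (ux := ux x t) (ut := ut x t) (b := fun j k => b j k x t) (B := B) (F := F)
          (fun j => ⟨hδ.le.trans (le_energyWeight hδ1 hx'), energyWeight_le hδ1 hx'⟩)
          (fun j => abs_energySlope_le hδ hδ1) (fun j => haB j x hx' t) (fun j => haxB j x hx' t)
          (fun j k => hbB j k x hx' t) (hpde x hx t ht)
        refine h1.trans ?_
        have h2 : ∑ j, u x t j ^ 2 ≤ (∑ j, energyWeight m δ j x * u x t j ^ 2) / δ := by
          rw [le_div_iff₀ hδ, Finset.sum_mul]
          refine Finset.sum_le_sum fun j _ => ?_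
          rw [mul_comm]
          exact mul_le_mul_of_nonneg_right (le_energyWeight hδ1 hx') (sq_nonneg _)
        have h3 := mul_le_mul_of_nonneg_left h2 hC₀p.le
        have h4 : C₀ * ((∑ j, energyWeight m δ j x * u x t j ^ 2) / δ) =
            C₀ / δ * ∑ j, energyWeight m δ j x * u x t j ^ 2 := by ring
        simp only [hΨ']
        linarith
    _ = C₀ / δ * energy m δ (fun x => u x t) + n * F ^ 2 - (Ψ 1 - Ψ 0) := by
        have h1 : ContinuousOn (fun x => C₀ / δ * ∑ j, energyWeight m δ j x * u x t j ^ 2)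
            (Icc 0 1) := continuousOn_const.mul hce
        have h2 : ContinuousOn (fun x => C₀ / δ * (∑ j, energyWeight m δ j x * u x t j ^ 2) +
            n * F ^ 2) (Icc 0 1) := h1.add continuousOn_const
        rw [intervalIntegral.integral_sub (hintble h2) (hintble hΨc'), intervalIntegral.integral_add
          (hintble h1) (by simp), intervalIntegral.integral_const_mul, hΨi]
        simp [energy]
    _ ≤ _ := by linarith

end HypSys

namespace HypSys

/-! ### Functions on the unit interval as elements of `L²(0,1)ⁿ` -/

variable {n m : ℕ}

open Classical in
/-- The class in `L²(0,1)ⁿ` of a function with square integrable components. -/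
def toL2 (v : ℝ → Fin n → ℝ) : L2n n := fun j =>
  if h : MemLp (fun x => v x j) 2 unitMeasure then h.toLp _ else 0

theorem memLp_of_continuousOn {f : ℝ → ℝ} (hf : ContinuousOn f (Icc 0 1)) :
    MemLp f 2 unitMeasure := by
  obtain ⟨C, hC⟩ := isCompact_Icc.exists_bound_of_continuousOn hf
  refine MemLp.of_bound ((hf.mono Ioo_subset_Icc_self).aestronglyMeasurable measurableSet_Ioo) C ?_
  filter_upwards [ae_restrict_mem measurableSet_Ioo] with x hx
  exact hC x (Ioo_subset_Icc_self hx)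

section

variable {v v' : ℝ → Fin n → ℝ}

theorem toL2_apply {j : Fin n} (h : MemLp (fun x => v x j) 2 unitMeasure) :
    toL2 v j = h.toLp _ := dif_pos h

theorem toL2_add (hv : ∀ j, ContinuousOn (fun x => v x j) (Icc 0 1))
    (hv' : ∀ j, ContinuousOn (fun x => v' x j) (Icc 0 1)) :
    toL2 (fun x => v x + v' x) = toL2 v + toL2 v' := by
  funext j
  have h := memLp_of_continuousOn (hv j)
  have h' := memLp_of_continuousOn (hv' j)
  rw [Pi.add_apply, toL2_apply h, toL2_apply h', ← MemLp.toLp_add,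
    toL2_apply (v := fun x => v x + v' x) (h.add h')]
  rfl

theorem toL2_smul (c : ℝ) (hv : ∀ j, ContinuousOn (fun x => v x j) (Icc 0 1)) :
    toL2 (fun x => c • v x) = c • toL2 v := by
  funext j
  have h := memLp_of_continuousOn (hv j)
  rw [Pi.smul_apply, toL2_apply h, ← MemLp.toLp_const_smul,
    toL2_apply (v := fun x => c • v x) (h.const_smul c)]
  rfl

theorem toL2_sub (hv : ∀ j, ContinuousOn (fun x => v x j) (Icc 0 1))
    (hv' : ∀ j, ContinuousOn (fun x => v' x j) (Icc 0 1)) :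
    toL2 (fun x => v x - v' x) = toL2 v - toL2 v' := by
  funext j
  have h := memLp_of_continuousOn (hv j)
  have h' := memLp_of_continuousOn (hv' j)
  rw [Pi.sub_apply, toL2_apply h, toL2_apply h', ← MemLp.toLp_sub,
    toL2_apply (v := fun x => v x - v' x) (h.sub h')]
  rfl

theorem toL2_congr (hv : ∀ j, ContinuousOn (fun x => v x j) (Icc 0 1))
    (h : ∀ x ∈ Icc (0 : ℝ) 1, v' x = v x) : toL2 v' = toL2 v := by
  funext j
  have h1 := memLp_of_continuousOn (hv j)
  have h2 : ContinuousOn (fun x => v' x j) (Icc 0 1) := (hv j).congr fun x hx => by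
    simp only [h x hx]
  rw [toL2_apply h1, toL2_apply (memLp_of_continuousOn h2), MemLp.toLp_eq_toLp_iff]
  filter_upwards [ae_restrict_mem measurableSet_Ioo] with x hx
  rw [h x (Ioo_subset_Icc_self hx)]

theorem l2dist_eq_edist (f : L2n n) (hv : ∀ j, ContinuousOn (fun x => v x j) (Icc 0 1)) :
    l2dist f v = edist f (toL2 v) := by
  rw [edist_pi_def, Finset.sup_univ_eq_iSup, l2dist]
  refine iSup_congr fun j => ?_
  have h := memLp_of_continuousOn (hv j)
  rw [Lp.edist_def, toL2_apply h]
  refine eLpNorm_congr_ae ?_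
  filter_upwards [h.coeFn_toLp] with x hx
  rw [Pi.sub_apply, hx]

theorem norm_toL2_apply_sq (hv : ∀ j, ContinuousOn (fun x => v x j) (Icc 0 1)) (j : Fin n) :
    ‖toL2 v j‖ ^ 2 = ∫ x in (0 : ℝ)..1, v x j ^ 2 := by
  have h := memLp_of_continuousOn (hv j)
  rw [← real_inner_self_eq_norm_sq, L2.inner_def, intervalIntegral.integral_of_le zero_le_one,
    integral_Ioc_eq_integral_Ioo, toL2_apply h]
  refine integral_congr_ae ?_
  filter_upwards [h.coeFn_toLp] with x hx
  rw [hx, real_inner_self_eq_norm_sq, Real.norm_eq_abs, sq_abs]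

theorem intervalIntegrable_of_continuousOn {f : ℝ → ℝ} (hf : ContinuousOn f (Icc 0 1)) :
    IntervalIntegrable f volume 0 1 :=
  ContinuousOn.intervalIntegrable (by rwa [uIcc_of_le zero_le_one])

theorem energy_eq_sum {δ : ℝ} (hv : ∀ j, ContinuousOn (fun x => v x j) (Icc 0 1)) :
    energy m δ v = ∑ j, ∫ x in (0 : ℝ)..1, energyWeight m δ j x * v x j ^ 2 :=
  intervalIntegral.integral_finsetSum fun j _ => intervalIntegrable_of_continuousOn
    (continuous_energyWeight.continuousOn.mul ((hv j).pow 2))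

/-- The weights are at most `1`; the factor `n` appears because `X` carries the maximum norm while
the energy is a sum. -/
theorem energy_le {δ : ℝ} (hδ1 : δ ≤ 1) (hv : ∀ j, ContinuousOn (fun x => v x j) (Icc 0 1)) :
    energy m δ v ≤ n * ‖toL2 v‖ ^ 2 := by
  rw [energy_eq_sum hv]
  refine (Finset.sum_le_card_nsmul _ _ (‖toL2 v‖ ^ 2) fun j _ => ?_).trans (by simp)
  refine le_trans ?_ (pow_le_pow_left₀ (norm_nonneg _) (norm_le_pi_norm (toL2 v) j) 2)
  rw [norm_toL2_apply_sq hv]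
  refine intervalIntegral.integral_mono_on zero_le_one (intervalIntegrable_of_continuousOn
    (continuous_energyWeight.continuousOn.mul ((hv j).pow 2)))
    (intervalIntegrable_of_continuousOn ((hv j).pow 2)) fun x hx => ?_
  exact mul_le_of_le_one_left (sq_nonneg _) (energyWeight_le hδ1 hx)

theorem norm_toL2_sq_le {δ : ℝ} (hδ : 0 < δ) (hδ1 : δ ≤ 1)
    (hv : ∀ j, ContinuousOn (fun x => v x j) (Icc 0 1)) :
    ‖toL2 v‖ ^ 2 ≤ energy m δ v / δ := by
  have h1 : ∀ j, ‖toL2 v j‖ ^ 2 ≤ energy m δ v / δ := by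
    intro j
    rw [le_div_iff₀ hδ, norm_toL2_apply_sq hv, energy_eq_sum hv, mul_comm,
      ← intervalIntegral.integral_const_mul]
    refine le_trans ?_ (Finset.single_le_sum
      (f := fun j => ∫ x in (0 : ℝ)..1, energyWeight m δ j x * v x j ^ 2) (fun j _ => ?_)
      (Finset.mem_univ j))
    · refine intervalIntegral.integral_mono_on zero_le_one (intervalIntegrable_of_continuousOn
        (continuousOn_const.mul ((hv j).pow 2))) (intervalIntegrable_of_continuousOn
        (continuous_energyWeight.continuousOn.mul ((hv j).pow 2))) fun x hx => ?_
      exact mul_le_mul_of_nonneg_right (le_energyWeight hδ1 hx) (sq_nonneg _)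
    · refine intervalIntegral.integral_nonneg zero_le_one fun x hx => ?_
      exact mul_nonneg (hδ.le.trans (le_energyWeight hδ1 hx)) (sq_nonneg _)
  have h0 : 0 ≤ energy m δ v / δ := by
    refine div_nonneg (intervalIntegral.integral_nonneg zero_le_one fun x hx =>
      Finset.sum_nonneg fun j _ => ?_) hδ.le
    exact mul_nonneg (hδ.le.trans (le_energyWeight hδ1 hx)) (sq_nonneg _)
  have h2 : ‖toL2 v‖ ≤ √(energy m δ v / δ) :=
    (pi_norm_le_iff_of_nonneg (Real.sqrt_nonneg _)).2 fun j => Real.le_sqrt_of_sq_le (h1 j)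
  exact (pow_le_pow_left₀ (norm_nonneg _) h2 2).trans (Real.sq_sqrt h0).le

end

theorem IsTestFunction.continuousOn {φ : ℝ → Fin n → ℝ} (hφ : IsTestFunction φ) (j : Fin n) :
    ContinuousOn (fun x => φ x j) (Icc 0 1) :=
  (contDiff_pi.1 hφ.contDiff j).continuous.continuousOn

/-! ### Density of test functions -/

/-- The classes of scalar test functions in `L²(0,1)`. -/
def testSubmodule : Submodule ℝ (Lp ℝ 2 unitMeasure) where
  carrier := {f | ∃ ψ : ℝ → ℝ, ContDiff ℝ ((⊤ : ℕ∞) : WithTop ℕ∞) ψ ∧ HasCompactSupport ψ ∧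
    tsupport ψ ⊆ Ioo 0 1 ∧ f =ᵐ[unitMeasure] ψ}
  zero_mem' := ⟨0, contDiff_const, HasCompactSupport.zero, by simp [tsupport],
    Lp.coeFn_zero _ _ _⟩
  add_mem' := by
    rintro f g ⟨ψ, h1, h2, h3, h4⟩ ⟨χ, h1', h2', h3', h4'⟩
    exact ⟨ψ + χ, h1.add h1', h2.add h2', (tsupport_add ψ χ).trans (union_subset h3 h3'),
      (Lp.coeFn_add f g).trans (h4.add h4')⟩
  smul_mem' := by
    rintro c f ⟨ψ, h1, h2, h3, h4⟩
    exact ⟨c • ψ, h1.const_smul c, h2.smul_left,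
      (tsupport_smul_subset_right (fun _ => c) ψ).trans h3,
      (Lp.coeFn_smul c f).trans (h4.const_smul c)⟩

/-- An element orthogonal to all test functions vanishes almost everywhere by the fundamental lemma
of the calculus of variations; in a Hilbert space this is density. -/
theorem dense_testSubmodule : Dense (testSubmodule : Set (Lp ℝ 2 unitMeasure)) := by
  rw [Submodule.dense_iff_topologicalClosure_eq_top, Submodule.topologicalClosure_eq_top_iff,
    Submodule.eq_bot_iff]
  intro f hf
  rw [Submodule.mem_orthogonal] at hf
  have hintble : IntegrableOn f (Ioo 0 1) volume := (Lp.memLp f).integrable (by norm_num)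
  have h0 := isOpen_Ioo.ae_eq_zero_of_integral_contDiff_smul_eq_zero (U := Ioo (0 : ℝ) 1)
    (μ := volume) (f := f) hintble.locallyIntegrableOn fun g h1 h2 h3 => by
      have hg : MemLp g 2 unitMeasure := memLp_of_continuousOn h1.continuous.continuousOn
      have h4 := hf (hg.toLp g) ⟨g, h1, h2, h3, hg.coeFn_toLp⟩
      rw [L2.inner_def] at h4
      have h5 : ∫ x in Ioo (0 : ℝ) 1, g x • f x = ∫ x, g x • f x :=
        setIntegral_eq_integral_of_forall_compl_eq_zero fun x hx => by
          have : g x = 0 := image_eq_zero_of_notMem_tsupport fun h => hx (h3 h)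
          rw [this, zero_smul]
      refine h5.symm.trans (Eq.trans (integral_congr_ae ?_) h4)
      filter_upwards [hg.coeFn_toLp] with x hx
      rw [hx]
      simp [mul_comm]
  rw [Lp.eq_zero_iff_ae_eq_zero]
  exact (ae_restrict_iff' measurableSet_Ioo).2 h0

theorem dense_test (n : ℕ) :
    Dense {f : L2n n | ∃ φ : ℝ → Fin n → ℝ, IsTestFunction φ ∧ f = toL2 φ} := by
  refine (dense_pi univ fun (_ : Fin n) _ => dense_testSubmodule).mono fun f hf => ?_
  have hf' : ∀ j, f j ∈ testSubmodule := fun j => hf j trivial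
  choose ψ h1 h2 h3 h4 using hf'
  have hsub : tsupport (fun x j => ψ j x) ⊆ ⋃ j, tsupport (ψ j) := by
    refine closure_minimal (fun x hx => ?_) (isClosed_iUnion_of_finite fun j =>
      isClosed_tsupport _)
    obtain ⟨j, hj⟩ := Function.ne_iff.1 hx
    exact mem_iUnion.2 ⟨j, subset_tsupport _ hj⟩
  have hsub' : tsupport (fun x j => ψ j x) ⊆ Ioo 0 1 := hsub.trans (iUnion_subset h3)
  have hφ : IsTestFunction fun x j => ψ j x := ⟨contDiff_pi.2 h1,
    isCompact_Icc.of_isClosed_subset (isClosed_tsupport _) (hsub'.trans Ioo_subset_Icc_self),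
    hsub'⟩
  refine ⟨_, hφ, funext fun j => ?_⟩
  have hm := memLp_of_continuousOn (hφ.continuousOn j)
  rw [toL2_apply hm]
  exact Lp.ext ((h4 j).trans hm.coeFn_toLp.symm)

end HypSys

namespace HypSys

/-! ### Strong continuity of evolution families -/

section Abstract

variable {X : Type*} [NormedAddCommGroup X] [NormedSpace ℝ X] {U : ℝ → ℝ → X →L[ℝ] X} {M w : ℝ}

theorem norm_apply_le_of_exp_bound (hM : 0 ≤ M) (hw : 0 ≤ w)
    (hU : ∀ t τ, τ ≤ t → ‖U t τ‖ ≤ M * Real.exp (w * (t - τ))) {t τ R : ℝ} (ht : τ ≤ t)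
    (hR : t - τ ≤ R) (x : X) : ‖U t τ x‖ ≤ M * Real.exp (w * R) * ‖x‖ := by
  refine ((U t τ).le_opNorm x).trans (mul_le_mul_of_nonneg_right ((hU t τ ht).trans ?_)
    (norm_nonneg x))
  gcongr

/-- Continuity in time extends from a dense set of initial values. -/
theorem continuousOn_time_of_dense (hM : 0 ≤ M) (hw : 0 ≤ w)
    (hU : ∀ t τ, τ ≤ t → ‖U t τ‖ ≤ M * Real.exp (w * (t - τ))) {τ : ℝ} {S : Set X} (hS : Dense S)
    (h : ∀ y ∈ S, ContinuousOn (fun t => U t τ y) (Ici τ)) (x : X) :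
    ContinuousOn (fun t => U t τ x) (Ici τ) := by
  intro t₀ ht₀
  refine continuousWithinAt_of_locally_uniform_approx_of_continuousWithinAt ht₀ fun V hV => ?_
  obtain ⟨ε, hε, hεV⟩ := Metric.mem_uniformity_dist.1 hV
  -- The exponential bounds the operators up to time `t₀ + 1`; the added `1` allows division by `N`
  -- even if `M = 0`.
  set N := M * Real.exp (w * (t₀ + 1 - τ)) + 1 with hN
  have hN0 : 0 < N := by positivity
  obtain ⟨y, hyS, hy⟩ := hS.exists_dist_lt x (div_pos hε hN0)
  refine ⟨Ici τ ∩ Iio (t₀ + 1), inter_mem self_mem_nhdsWithin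
    (mem_nhdsWithin_of_mem_nhds (Iio_mem_nhds (by linarith))), fun t => U t τ y,
    h y hyS t₀ ht₀, fun t ht => hεV ?_⟩
  rw [dist_eq_norm, ← map_sub]
  have h1 := norm_apply_le_of_exp_bound hM hw hU ht.1
    (R := t₀ + 1 - τ) (by linarith [mem_Iio.1 ht.2]) (x - y)
  rw [dist_eq_norm, lt_div_iff₀ hN0] at hy
  nlinarith [norm_nonneg (x - y)]

/-- Uniform continuity at the initial time extends from a dense set of initial values. -/
theorem continuous_initial_of_dense (hM : 1 ≤ M) (hw : 0 ≤ w)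
    (hU : ∀ t τ, τ ≤ t → ‖U t τ‖ ≤ M * Real.exp (w * (t - τ))) {S : Set X} (hS : Dense S)
    (h : ∀ y ∈ S, ∀ ε > 0, ∃ δ > 0, ∀ τ t, τ ≤ t → t ≤ τ + δ → ‖U t τ y - y‖ ≤ ε) (x : X) :
    ∀ ε > 0, ∃ δ > 0, ∀ τ t, τ ≤ t → t ≤ τ + δ → ‖U t τ x - x‖ ≤ ε := by
  intro ε hε
  have hM0 : 0 ≤ M := by linarith
  set N := M * Real.exp (w * 1) with hN
  have hN0 : 0 < N := by positivity
  obtain ⟨y, hyS, hy⟩ := hS.exists_dist_lt x (div_pos (half_pos hε) (by linarith : 0 < N + 1))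
  obtain ⟨δ, hδ, hyδ⟩ := h y hyS (ε / 2) (half_pos hε)
  refine ⟨min δ 1, by positivity, fun τ t ht ht' => ?_⟩
  have h1 := norm_apply_le_of_exp_bound hM0 hw hU ht (R := 1)
    (by linarith [min_le_right δ 1]) (x - y)
  have h2 := hyδ τ t ht (by linarith [min_le_left δ 1])
  rw [dist_eq_norm, lt_div_iff₀ (by linarith)] at hy
  have h3 : U t τ x - x = U t τ (x - y) + (U t τ y - y) - (x - y) := by
    rw [map_sub]; abel
  rw [h3]
  have h4 := norm_sub_le (U t τ (x - y) + (U t τ y - y)) (x - y)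
  have h5 := norm_add_le (U t τ (x - y)) (U t τ y - y)
  nlinarith

/-- `U(t,τ)x` is compared with `U(max t τ₀, τ₀)x`, which is continuous in `t`. If `t < τ₀`, the
latter is `x` and `t - τ` is small. Otherwise the cocycle law writes the difference, up to sign, as
a bounded operator applied to `U(s',s)x - x`, where `s ≤ s'` are `τ` and `τ₀` in order. Uniformity
of `hstart` in the initial time is essential, since `τ` moves. -/
theorem continuousOn_of_exp_bound (hM : 1 ≤ M) (hw : 0 ≤ w)
    (hrefl : ∀ τ, U τ τ = ContinuousLinearMap.id ℝ X)
    (hcomp : ∀ t s τ, τ ≤ s → s ≤ t → (U t s).comp (U s τ) = U t τ)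
    (hU : ∀ t τ, τ ≤ t → ‖U t τ‖ ≤ M * Real.exp (w * (t - τ))) {x : X}
    (htime : ∀ τ, ContinuousOn (fun t => U t τ x) (Ici τ))
    (hstart : ∀ ε > 0, ∃ δ > 0, ∀ τ t, τ ≤ t → t ≤ τ + δ → ‖U t τ x - x‖ ≤ ε) :
    ContinuousOn (fun q : ℝ × ℝ => U q.1 q.2 x) {q : ℝ × ℝ | q.2 ≤ q.1} := by
  rintro ⟨t₀, τ₀⟩ h₀
  have h₀' : τ₀ ≤ t₀ := h₀
  have hM0 : 0 ≤ M := by linarith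
  have hc : Continuous fun q : ℝ × ℝ => U (max q.1 τ₀) τ₀ x :=
    (htime τ₀).comp_continuous (continuous_fst.max continuous_const)
      fun q => mem_Ici.2 (le_max_right _ _)
  rw [Metric.continuousWithinAt_iff']
  intro ε hε
  -- The `2` allows both endpoints to move by less than `1`.
  set N := M * Real.exp (w * (t₀ - τ₀ + 2)) with hN
  have hN1 : 1 ≤ N := by
    have : 1 ≤ Real.exp (w * (t₀ - τ₀ + 2)) :=
      Real.one_le_exp (mul_nonneg hw (by linarith))
    nlinarith
  obtain ⟨δ, hδ, hδx⟩ := hstart (ε / 2 / N) (by positivity)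
  have h1 : ∀ᶠ q : ℝ × ℝ in 𝓝 (t₀, τ₀), dist (U (max q.1 τ₀) τ₀ x) (U t₀ τ₀ x) < ε / 2 := by
    have := hc.tendsto (t₀, τ₀)
    simp only [max_eq_left h₀'] at this
    exact Metric.tendsto_nhds.1 this _ (half_pos hε)
  have h2 : ∀ᶠ q : ℝ × ℝ in 𝓝 (t₀, τ₀), |q.1 - t₀| < 1 ∧ |q.2 - τ₀| < min δ 1 := by
    refine (Filter.Eventually.and ?_ ?_)
    · exact (by fun_prop : Continuous fun q : ℝ × ℝ => |q.1 - t₀|).continuousAt.eventually_lt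
        continuousAt_const (by simp)
    · exact (by fun_prop : Continuous fun q : ℝ × ℝ => |q.2 - τ₀|).continuousAt.eventually_lt
        continuousAt_const (by simpa using hδ)
  filter_upwards [mem_nhdsWithin_of_mem_nhds h1, mem_nhdsWithin_of_mem_nhds h2,
    self_mem_nhdsWithin] with q hq1 hq2 hq3
  obtain ⟨t, τ⟩ := q
  obtain ⟨hqt, hqτ⟩ := hq2
  replace hq3 : τ ≤ t := hq3
  simp only at hq1 hqt hqτ ⊢
  have hqτδ := abs_lt.1 (hqτ.trans_le (min_le_left _ _))
  have hqτ1 := abs_lt.1 (hqτ.trans_le (min_le_right _ _))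
  have hqt1 := abs_lt.1 hqt
  have hε2 : ε / 2 / N ≤ ε / 2 := div_le_self (by positivity) hN1
  have key : ‖U t τ x - U (max t τ₀) τ₀ x‖ ≤ ε / 2 := by
    have hmul : ∀ y : X, ‖y‖ ≤ ε / 2 / N → N * ‖y‖ ≤ ε / 2 := fun y hy => by
      rw [le_div_iff₀ (by linarith)] at hy; linarith
    rcases lt_or_ge t τ₀ with h | h
    · rw [max_eq_right h.le, hrefl, ContinuousLinearMap.id_apply]
      exact (hδx τ t hq3 (by linarith)).trans hε2
    · rw [max_eq_left h]
      rcases le_total τ τ₀ with h' | h'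
      · rw [← hcomp t τ₀ τ h' h, ContinuousLinearMap.comp_apply, ← map_sub]
        exact (norm_apply_le_of_exp_bound hM0 hw hU h (by linarith) _).trans
          (hmul _ (hδx τ τ₀ h' (by linarith)))
      · rw [← hcomp t τ τ₀ h' hq3, ContinuousLinearMap.comp_apply, ← map_sub]
        refine (norm_apply_le_of_exp_bound hM0 hw hU hq3 (by linarith) _).trans (hmul _ ?_)
        rw [norm_sub_rev]
        exact hδx τ₀ τ h' (by linarith)
  have h4 := dist_triangle (U t τ x) (U (max t τ₀) τ₀ x) (U t₀ τ₀ x)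
  rw [dist_eq_norm (U t τ x) (U (max t τ₀) τ₀ x)] at h4
  linarith

end Abstract

/-! ### The space of classical solutions -/

variable {n m : ℕ} {a : Fin n → ℝ → ℝ → ℝ} {b : Fin n → Fin n → ℝ → ℝ → ℝ}
  {p : Fin n → Fin n → ℝ} {τ : ℝ}

theorem reflection_add (v v' : ℝ → Fin n → ℝ) (j : Fin n) :
    reflection m p (fun x => v x + v' x) j = reflection m p v j + reflection m p v' j := by
  simp only [reflection, ← Finset.sum_add_distrib]
  refine Finset.sum_congr rfl fun k _ => ?_
  split_ifs <;> simp [mul_add]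

theorem reflection_smul (c : ℝ) (v : ℝ → Fin n → ℝ) (j : Fin n) :
    reflection m p (fun x => c • v x) j = c * reflection m p v j := by
  simp only [reflection, Finset.mul_sum]
  refine Finset.sum_congr rfl fun k _ => ?_
  split_ifs <;> simp only [Pi.smul_apply, smul_eq_mul] <;> ring

/-! ### Linearity, restarting and residuals of classical solutions -/

namespace IsClassicalSolution

variable {φ ψ : ℝ → Fin n → ℝ} {u v : ℝ → ℝ → Fin n → ℝ}

theorem add (hu : IsClassicalSolution m a b p τ φ u) (hv : IsClassicalSolution m a b p τ ψ v) :
    IsClassicalSolution m a b p τ (fun x => φ x + ψ x) fun x t => u x t + v x t where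
  continuousOn := hu.continuousOn.add hv.continuousOn
  system := by
    obtain ⟨ux, ut, h1, h2, h3, h4, h5⟩ := hu.system
    obtain ⟨vx, vt, k1, k2, k3, k4, k5⟩ := hv.system
    refine ⟨fun x t => ux x t + vx x t, fun x t => ut x t + vt x t, h1.add k1, h2.add k2,
      fun x hx t ht j => (h3 x hx t ht j).add (k3 x hx t ht j),
      fun x hx t ht j => (h4 x hx t ht j).add (k4 x hx t ht j), fun x hx t ht j => ?_⟩
    have h6 := h5 x hx t ht j
    have k6 := k5 x hx t ht j
    simp only [Pi.add_apply, mul_add, Finset.sum_add_distrib]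
    linarith
  boundary t ht j := by
    rw [reflection_add, Pi.add_apply, hu.boundary t ht j, hv.boundary t ht j]
  initial x hx := by rw [hu.initial x hx, hv.initial x hx]

theorem smul (c : ℝ) (hu : IsClassicalSolution m a b p τ φ u) :
    IsClassicalSolution m a b p τ (fun x => c • φ x) fun x t => c • u x t where
  continuousOn := hu.continuousOn.const_smul c
  system := by
    obtain ⟨ux, ut, h1, h2, h3, h4, h5⟩ := hu.system
    refine ⟨fun x t => c • ux x t, fun x t => c • ut x t, h1.const_smul c, h2.const_smul c,
      fun x hx t ht j => (h3 x hx t ht j).const_mul c,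
      fun x hx t ht j => (h4 x hx t ht j).const_mul c, fun x hx t ht j => ?_⟩
    have h6 := h5 x hx t ht j
    have h7 : ∑ k, b j k x t * (c * u x t k) = c * ∑ k, b j k x t * u x t k := by
      rw [Finset.mul_sum]; exact Finset.sum_congr rfl fun k _ => by ring
    simp only [Pi.smul_apply, smul_eq_mul, h7]
    linear_combination c * h6
  boundary t ht j := by
    rw [reflection_smul, Pi.smul_apply, hu.boundary t ht j, smul_eq_mul]
  initial x hx := by rw [hu.initial x hx]

theorem zero : IsClassicalSolution m a b p τ (fun _ => 0) fun _ _ => 0 where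
  continuousOn := continuousOn_const
  system := ⟨fun _ _ => 0, fun _ _ => 0, continuousOn_const, continuousOn_const,
    fun _ _ _ _ _ => hasDerivWithinAt_const _ _ _,
    fun _ _ _ _ _ => hasDerivWithinAt_const _ _ _, by simp⟩
  boundary t ht j := by simp [reflection]
  initial _ _ := rfl

theorem restrict (hu : IsClassicalSolution m a b p τ φ u) {s : ℝ} (hs : τ ≤ s) :
    IsClassicalSolution m a b p s (fun x => u x s) u where
  continuousOn := hu.continuousOn.mono (prod_mono_right (Ici_subset_Ici.2 hs))
  system := by
    obtain ⟨ux, ut, h1, h2, h3, h4, h5⟩ := hu.system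
    have hsub : Ici s ⊆ Ici τ := Ici_subset_Ici.2 hs
    exact ⟨ux, ut, h1.mono (prod_mono_right hsub), h2.mono (prod_mono_right hsub),
      fun x hx t ht j => h3 x hx t (hsub ht) j,
      fun x hx t ht j => (h4 x hx t (hsub ht) j).mono hsub,
      fun x hx t ht j => h5 x hx t (hs.trans_lt ht) j⟩
  boundary t ht j := hu.boundary t (hs.trans ht) j
  initial _ _ := rfl

theorem hasResidual (hu : IsClassicalSolution m a b p τ φ u) : HasResidual m a b p τ 0 u where
  continuousOn := hu.continuousOn
  system := by
    obtain ⟨ux, ut, h1, h2, h3, h4, h5⟩ := hu.system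
    exact ⟨ux, ut, h1, h2, h3, h4, fun x hx t ht j => by rw [h5 x hx t ht j, abs_zero]⟩
  boundary := hu.boundary

/-- The stationary profile `φ` vanishes at both ends and violates the system only by `aφ' + bφ`. As
`u - φ` starts from zero, the energy estimate then controls `U(t,τ)φ - φ` uniformly in `τ`. -/
theorem hasResidual_sub (hu : IsClassicalSolution m a b p τ φ u) (hφ : IsTestFunction φ) {F : ℝ}
    (hF : ∀ x ∈ Icc (0 : ℝ) 1, ∀ t j,
      |a j x t * deriv (fun y => φ y j) x + ∑ k, b j k x t * φ x k| ≤ F) :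
    HasResidual m a b p τ F fun x t => u x t - φ x where
  continuousOn := hu.continuousOn.sub
    (hφ.contDiff.continuous.comp continuous_fst).continuousOn
  system := by
    obtain ⟨ux, ut, h1, h2, h3, h4, h5⟩ := hu.system
    have hsm : ∀ j, ContDiff ℝ 1 fun y => φ y j := fun j =>
      contDiff_infty.1 (contDiff_pi.1 hφ.contDiff j) 1
    refine ⟨fun x t j => ux x t j - deriv (fun y => φ y j) x, ut, h1.sub
      (continuous_pi fun j => ((hsm j).continuous_deriv le_rfl).comp continuous_fst).continuousOn,
      h2, fun x hx t ht j => (h3 x hx t ht j).sub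
        (((hsm j).differentiable (by norm_num) x).hasDerivAt.hasDerivWithinAt),
      fun x hx t ht j => (h4 x hx t ht j).sub_const _, fun x hx t ht j => ?_⟩
    have h6 := h5 x hx t ht j
    have h7 := hF x (Ioo_subset_Icc_self hx) t j
    rw [← abs_neg] at h7
    refine le_of_eq_of_le (congrArg _ ?_) h7
    simp only [Pi.sub_apply, mul_sub, Finset.sum_sub_distrib]
    linear_combination h6
  boundary t ht j := by
    have h0 : φ 0 = 0 := (hφ.eventuallyEq_zero (by simp)).eq_of_nhds
    have h1 : φ 1 = 0 := (hφ.eventuallyEq_zero (by simp)).eq_of_nhds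
    have h2 : φ (if (j : ℕ) < m then 0 else 1) = 0 := by split_ifs <;> assumption
    rw [Pi.sub_apply, h2, hu.boundary t ht j]
    simp [reflection, h0, h1]

theorem slice (hu : IsClassicalSolution m a b p τ φ u) {t : ℝ} (ht : τ ≤ t) (j : Fin n) :
    ContinuousOn (fun x => u x t j) (Icc 0 1) :=
  continuousOn_slice hu.continuousOn ht j

theorem continuousOn_toL2 (hu : IsClassicalSolution m a b p τ φ u) :
    ContinuousOn (fun t => toL2 fun x => u x t) (Ici τ) := by
  intro t₀ ht₀
  rw [ContinuousWithinAt, tendsto_iff_norm_sub_tendsto_zero]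
  have hsl : ContinuousOn (fun q : ℝ × ℝ => u q.1 t₀) (Icc 0 1 ×ˢ Ici τ) :=
    hu.continuousOn.comp (by fun_prop : ContinuousOn (fun q : ℝ × ℝ => (q.1, t₀)) _)
      fun q hq => ⟨hq.1, ht₀⟩
  -- With `δ = 1` all energy weights equal `1`, so the energy is the sum of the squared `L²` norms.
  have h1 := (continuousOn_energy (m := m) (δ := 1) (τ := τ)
    (u := fun x t => u x t - u x t₀) (hu.continuousOn.sub hsl)) t₀ ht₀
  have h2 : energy m 1 (fun x => u x t₀ - u x t₀) = 0 := by simp [energy]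
  rw [ContinuousWithinAt, h2] at h1
  have h3 := (Real.continuous_sqrt.tendsto 0).comp h1
  rw [Real.sqrt_zero] at h3
  refine squeeze_zero' (Eventually.of_forall fun _ => norm_nonneg _) ?_ h3
  filter_upwards [self_mem_nhdsWithin] with t ht
  refine Real.le_sqrt_of_sq_le ?_
  have hct := hu.slice ht
  have hct₀ := hu.slice ht₀
  rw [← toL2_sub hct hct₀]
  simpa using norm_toL2_sq_le (m := m) one_pos le_rfl (v := fun x => u x t - u x t₀)
    fun j => (hct j).sub (hct₀ j)

end IsClassicalSolution

/-- The space of classical solutions on `[0,1] × [τ,∞)`. -/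
def classicalSpace (m : ℕ) (a : Fin n → ℝ → ℝ → ℝ) (b : Fin n → Fin n → ℝ → ℝ → ℝ)
    (p : Fin n → Fin n → ℝ) (τ : ℝ) : Submodule ℝ (ℝ → ℝ → Fin n → ℝ) where
  carrier := {u | IsClassicalSolution m a b p τ (fun x => u x τ) u}
  zero_mem' := IsClassicalSolution.zero
  add_mem' := fun hu hv => hu.add hv
  smul_mem' := fun c _ hu => hu.smul c

/-- The value at time `t` of classical solutions on `[0,1] × [τ,∞)`. -/
def evalL2 (m : ℕ) (a : Fin n → ℝ → ℝ → ℝ) (b : Fin n → Fin n → ℝ → ℝ → ℝ)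
    (p : Fin n → Fin n → ℝ) (τ : ℝ) {t : ℝ} (ht : τ ≤ t) :
    classicalSpace m a b p τ →ₗ[ℝ] L2n n where
  toFun u := toL2 fun x => u.1 x t
  map_add' u v := toL2_add (u.2.slice ht) (v.2.slice ht)
  map_smul' c u := toL2_smul c (u.2.slice ht)

/-- The evolution family of the problem: the continuous extension of the solution operator for
classical solutions. -/
def evolution (m : ℕ) (a : Fin n → ℝ → ℝ → ℝ) (b : Fin n → Fin n → ℝ → ℝ → ℝ)
    (p : Fin n → Fin n → ℝ) (t τ : ℝ) : L2n n →L[ℝ] L2n n :=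
  if ht : τ ≤ t then (evalL2 m a b p τ ht).extendOfNorm (evalL2 m a b p τ le_rfl) else 0

/-- The `L²` form of the energy estimate. -/
theorem exists_L2_estimate (p : Fin n → Fin n → ℝ) (ha : ∀ j, IsBC1 (a j))
    (hb : ∀ i j, IsBC1 (b i j)) {Λ₀ : ℝ} (hΛ₀ : 0 < Λ₀)
    (hpos : ∀ j : Fin n, (j : ℕ) < m → ∀ x ∈ Icc (0 : ℝ) 1, ∀ t : ℝ, Λ₀ ≤ a j x t)
    (hneg : ∀ j : Fin n, m ≤ (j : ℕ) → ∀ x ∈ Icc (0 : ℝ) 1, ∀ t : ℝ, a j x t ≤ -Λ₀) :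
    ∃ M w : ℝ, 1 ≤ M ∧ 0 ≤ w ∧ ∀ (τ F : ℝ) (u : ℝ → ℝ → Fin n → ℝ),
      HasResidual m a b p τ F u → ∀ t ≥ τ, ‖toL2 fun x => u x t‖ ^ 2 ≤
        (M * Real.exp (w * (t - τ)) * ‖toL2 fun x => u x τ‖) ^ 2 +
          M * F ^ 2 * (Real.exp (2 * w * (t - τ)) - 1) := by
  obtain ⟨δ, C, hδ, hδ1, hC, h⟩ := exists_energy_estimate p ha hb hΛ₀ hpos hneg
  set M := n / δ + n / C / δ + 1 with hM
  have hM1 : n / δ ≤ M := by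
    have : 0 ≤ n / C / δ := by positivity
    linarith
  have hM2 : n / C / δ ≤ M := by
    have : 0 ≤ n / δ := by positivity
    linarith
  have hM3 : 1 ≤ M := by
    have h1 : 0 ≤ n / δ := by positivity
    have h2 : 0 ≤ n / C / δ := by positivity
    linarith
  -- The energy is quadratic, so its growth rate is halved for the norm.
  refine ⟨M, C / 2, hM3, by positivity, fun τ F u hu t ht => ?_⟩
  have h1 := h τ F u hu t ht
  have h2 := norm_toL2_sq_le (m := m) hδ hδ1 fun j => continuousOn_slice hu.continuousOn ht j
  have h3 := energy_le (m := m) hδ1 fun j => continuousOn_slice hu.continuousOn le_rfl j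
  set e := Real.exp (C * (t - τ)) with he
  have he1 : 1 ≤ e := Real.one_le_exp (mul_nonneg hC.le (sub_nonneg.2 ht))
  have he2 : Real.exp (C / 2 * (t - τ)) ^ 2 = e := by
    rw [← Real.exp_nat_mul]; congr 1; push_cast; ring
  have he3 : Real.exp (2 * (C / 2) * (t - τ)) = e := by rw [he]; congr 1; ring
  rw [mul_pow, mul_pow, he2, he3]
  set A := ‖toL2 fun x => u x τ‖ ^ 2
  have hA : 0 ≤ A := sq_nonneg _
  calc _ ≤ (e * (n * A) + n * F ^ 2 / C * (e - 1)) / δ := by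
        refine h2.trans (div_le_div_of_nonneg_right (h1.trans ?_) hδ.le)
        gcongr
    _ = n / δ * (e * A) + n / C / δ * (F ^ 2 * (e - 1)) := by ring
    _ ≤ M ^ 2 * (e * A) + M * (F ^ 2 * (e - 1)) := by
        have h4 : 0 ≤ F ^ 2 * (e - 1) := mul_nonneg (sq_nonneg _) (by linarith)
        have h5 : n / δ ≤ M ^ 2 := by nlinarith
        have h6 : 0 ≤ e * A := by positivity
        gcongr
    _ = _ := by ring

/-- The evolution family of the problem is exponentially bounded and generated by the problem. -/
theorem evolution_spec (p : Fin n → Fin n → ℝ) (ha : ∀ j, IsBC1 (a j))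
    (hb : ∀ i j, IsBC1 (b i j)) {Λ₀ : ℝ} (hΛ₀ : 0 < Λ₀)
    (hpos : ∀ j : Fin n, (j : ℕ) < m → ∀ x ∈ Icc (0 : ℝ) 1, ∀ t : ℝ, Λ₀ ≤ a j x t)
    (hneg : ∀ j : Fin n, m ≤ (j : ℕ) → ∀ x ∈ Icc (0 : ℝ) 1, ∀ t : ℝ, a j x t ≤ -Λ₀) :
    IsEvolutionFamily (evolution m a b p) ∧ IsExponentiallyBounded (evolution m a b p) ∧
      Generates m a b p (evolution m a b p) := by
  obtain ⟨M, w, hM, hw, hest⟩ := exists_L2_estimate p ha hb hΛ₀ hpos hneg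
  have hM0 : 0 ≤ M := by linarith
  have hexist : ∀ τ {φ : ℝ → Fin n → ℝ}, IsTestFunction φ →
      ∃ u, IsClassicalSolution m a b p τ φ u := fun τ φ hφ =>
    exists_isClassicalSolution p ha hb hΛ₀ hpos hneg τ hφ
  -- The estimate with zero residual shows that the value at `τ` determines the value at `t`; this
  -- makes the continuous extension meaningful.
  have hnorm : ∀ τ t (ht : τ ≤ t) (u : classicalSpace m a b p τ),
      ‖evalL2 m a b p τ ht u‖ ≤
        M * Real.exp (w * (t - τ)) * ‖evalL2 m a b p τ le_rfl u‖ := by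
    intro τ t ht u
    have h1 := hest τ 0 u.1 u.2.hasResidual t ht
    simp only [ne_eq, OfNat.ofNat_ne_zero, not_false_eq_true, zero_pow, mul_zero, zero_mul,
      add_zero] at h1
    exact le_of_sq_le_sq h1 (by positivity)
  have hdense : ∀ τ, DenseRange (evalL2 m a b p τ (le_refl τ)) := by
    refine fun τ => (dense_test n).mono ?_
    rintro f ⟨φ, hφ, rfl⟩
    obtain ⟨u, hu⟩ := hexist τ hφ
    exact ⟨⟨u, hu.restrict le_rfl⟩, toL2_congr hφ.continuousOn hu.initial⟩
  set U := evolution m a b p with hUdef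
  have happ : ∀ {τ t : ℝ} (ht : τ ≤ t) {φ : ℝ → Fin n → ℝ} {u : ℝ → ℝ → Fin n → ℝ},
      IsClassicalSolution m a b p τ φ u →
      U t τ (toL2 fun x => u x τ) = toL2 fun x => u x t := by
    intro τ t ht φ u hu
    rw [hUdef, evolution, dif_pos ht]
    exact LinearMap.extendOfNorm_eq (hdense τ) ⟨_, hnorm τ t ht⟩ ⟨u, hu.restrict le_rfl⟩
  have hbound : ∀ t τ, τ ≤ t → ‖U t τ‖ ≤ M * Real.exp (w * (t - τ)) := by
    intro t τ ht
    rw [hUdef, evolution, dif_pos ht]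
    exact LinearMap.opNorm_extendOfNorm_le (hdense τ) (by positivity) (hnorm τ t ht)
  have hrefl : ∀ τ, U τ τ = ContinuousLinearMap.id ℝ (L2n n) := by
    intro τ
    refine ContinuousLinearMap.coeFn_injective ((hdense τ).equalizer (U τ τ).continuous
      continuous_id (funext fun u => ?_))
    exact happ le_rfl u.2
  have hcomp : ∀ t s τ, τ ≤ s → s ≤ t → (U t s).comp (U s τ) = U t τ := by
    intro t s τ hs ht
    refine ContinuousLinearMap.coeFn_injective ((hdense τ).equalizer
      ((U t s).comp (U s τ)).continuous (U t τ).continuous (funext fun u => ?_))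
    have h1 := happ hs u.2
    have h2 := happ (hs.trans ht) u.2
    have h3 := happ ht (u.2.restrict hs)
    exact (congrArg (U t s) h1).trans (h3.trans h2.symm)
  have htime : ∀ x τ, ContinuousOn (fun t => U t τ x) (Ici τ) := by
    intro x τ
    refine continuousOn_time_of_dense hM0 hw hbound (hdense τ) ?_ x
    rintro _ ⟨u, rfl⟩
    exact u.2.continuousOn_toL2.congr fun t ht => happ ht u.2
  -- For a test function the coefficients are bounded in time, so the residual bound `F`, and with
  -- it `δ`, does not depend on `τ`.
  have hstart : ∀ x, ∀ ε > 0, ∃ δ > 0, ∀ τ t, τ ≤ t → t ≤ τ + δ → ‖U t τ x - x‖ ≤ ε := by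
    refine continuous_initial_of_dense hM hw hbound (dense_test n) ?_
    rintro _ ⟨φ, hφ, rfl⟩ ε hε
    obtain ⟨F, hF⟩ : ∃ F, ∀ x ∈ Icc (0 : ℝ) 1, ∀ t j,
        |a j x t * deriv (fun y => φ y j) x + ∑ k, b j k x t * φ x k| ≤ F := by
      have h1 : ∀ j, IsTimeBC1 fun x t => a j (clamp x) t * deriv (fun y => φ y j) (clamp x) +
          ∑ k, b j k (clamp x) t * φ (clamp x) k := fun j =>
        ((ha j).isTimeBC1.mul (.of_continuousOn ((contDiff_infty.1 (contDiff_pi.1 hφ.contDiff j)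
          1).continuous_deriv le_rfl).continuousOn)).add
          (IsTimeBC1.sum _ fun k => (hb j k).isTimeBC1.mul (.of_continuousOn (hφ.continuousOn k)))
      choose _ C _ h2 _ using h1
      obtain ⟨F, hF⟩ := exists_le_of_finite C
      refine ⟨F, fun x hx t j => ?_⟩
      simpa only [clamp_of_mem hx] using (h2 j x t).trans (hF j)
    have hlim : Tendsto (fun s => M * F ^ 2 * (Real.exp (2 * w * s) - 1)) (𝓝 0) (𝓝 0) := by
      have : Continuous fun s => M * F ^ 2 * (Real.exp (2 * w * s) - 1) := by fun_prop
      simpa using this.tendsto 0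
    obtain ⟨δ, hδ, hδF⟩ := Metric.eventually_nhds_iff.1
      (hlim.eventually_lt_const (by positivity : 0 < ε ^ 2))
    refine ⟨δ / 2, by positivity, fun τ t ht ht' => ?_⟩
    obtain ⟨u, hu⟩ := hexist τ hφ
    have h1 := hest τ F _ (hu.hasResidual_sub hφ hF) t ht
    have h2 : (toL2 fun x => u x τ) = toL2 φ := toL2_congr hφ.continuousOn hu.initial
    rw [toL2_sub (hu.slice ht) hφ.continuousOn, toL2_sub (hu.slice le_rfl) hφ.continuousOn, h2,
      sub_self, norm_zero, mul_zero, zero_pow two_ne_zero, zero_add] at h1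
    rw [← h2, happ ht hu, h2]
    refine le_of_sq_le_sq (h1.trans (hδF ?_).le) hε.le
    rw [Real.dist_eq, sub_zero, abs_of_nonneg (sub_nonneg.2 ht)]
    linarith
  have hstrong : ∀ x : L2n n,
      ContinuousOn (fun q : ℝ × ℝ => U q.1 q.2 x) {q : ℝ × ℝ | q.2 ≤ q.1} := fun x =>
    continuousOn_of_exp_bound hM hw hrefl hcomp hbound (htime x) (hstart x)
  refine ⟨⟨hrefl, hcomp, hstrong⟩, ⟨w, M, hM, hbound⟩, fun τ φ =>
    ⟨htime φ τ, fun φl hφl hlim => ⟨fun l => hexist τ (hφl l), fun ul hul T hT => ?_⟩⟩⟩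
  -- Every classical solution is an orbit of `U`, so on `[τ,T]` its distance to `U(θ,τ)φ` is at most
  -- the operator bound times the initial distance.
  have hlim' : Tendsto (fun l => ENNReal.ofReal (M * Real.exp (w * (T - τ))) *
      l2dist φ (φl l)) atTop (𝓝 0) := by
    simpa using ENNReal.Tendsto.const_mul hlim (Or.inr ENNReal.ofReal_ne_top)
  refine tendsto_of_tendsto_of_tendsto_of_le_of_le tendsto_const_nhds hlim'
    (fun _ => bot_le) fun l => ?_
  refine iSup₂_le fun θ hθ => ?_
  have h2 : (toL2 fun x => ul l x τ) = toL2 (φl l) :=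
    toL2_congr (hφl l).continuousOn (hul l).initial
  rw [l2dist_eq_edist _ ((hul l).slice hθ.1), l2dist_eq_edist _ (hφl l).continuousOn,
    ← happ hθ.1 (hul l), h2, edist_eq_enorm_sub, edist_eq_enorm_sub, ← map_sub,
    ← ofReal_norm, ← ofReal_norm, ← ENNReal.ofReal_mul (by positivity)]
  exact ENNReal.ofReal_le_ofReal
    (norm_apply_le_of_exp_bound hM0 hw hbound hθ.1 (by linarith [hθ.2]) _)

end HypSys

end

theorem theorem2p1 (n : ℕ) (hn : 2 ≤ n) (m : ℕ) (hm : m ≤ n)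
    (a : Fin n → ℝ → ℝ → ℝ) (b : Fin n → Fin n → ℝ → ℝ → ℝ) (p : Fin n → Fin n → ℝ)
    (ha : ∀ j, HypSys.IsBC1 (a j))
    (hb : ∀ i j, HypSys.IsBC1 (b i j))
    (Λ₀ : ℝ) (hΛ₀ : 0 < Λ₀)
    (hpos : ∀ j : Fin n, (j : ℕ) < m → ∀ x ∈ Set.Icc (0 : ℝ) 1, ∀ t : ℝ, Λ₀ ≤ a j x t)
    (hneg : ∀ j : Fin n, m ≤ (j : ℕ) → ∀ x ∈ Set.Icc (0 : ℝ) 1, ∀ t : ℝ, a j x t ≤ -Λ₀) :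
    ∃ U : ℝ → ℝ → HypSys.L2n n →L[ℝ] HypSys.L2n n,
      HypSys.IsEvolutionFamily U ∧ HypSys.IsExponentiallyBounded U ∧
        HypSys.Generates m a b p U :=
  ⟨_, HypSys.evolution_spec p ha hb hΛ₀ hpos hneg⟩
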